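/- Let $n\ge 3$, let $M$ be a smooth $n$-manifold (Hausdorff, second countable, without boundary), let $h$ be a smooth background Riemannian metric on $M$ with Levi-Civita connection $\tilde\nabla$ and Ricci tensor $\tilde R_{ij}$, let $K\subset M$ be compact and $C_s\in\mathbb R$. For a continuous Riemannian metric $g$ on $M$ that lies in $W^{1,n}_{\rm loc}$ (in every chart the components $g_{ij}$ and their weak first derivatives are in $L^n$ on compact sets) put $$\Gamma_{ij}^k=\tfrac12 g^{kl}(\tilde\nabla_i g_{jl}+\tilde\nabla_j g_{il}-\tilde\nabla_l g_{ij}),\qquad V^k=g^{ij}\Gamma^k_{ij}-g^{ik}\Gamma^j_{ji},$$ $$F=g^{ij}\tilde R_{ij}-\tilde\nabla_k g^{ij}\,\Gamma^k_{ij}+\tilde\nabla_k g^{ik}\,\Gamma^j_{ji}+g^{ij}(\Gamma^k_{kl}\Gamma^l_{ij}-\Gamma^k_{jl}\Gamma^l_{ik}),$$ and let the scalar curvature distribution of $g$ be $$\langle R_g,\varphi\rangle=\int_M\Big(-V^k\,\tilde\nabla_k\Big(\varphi\frac{d\mu_g}{d\mu_h}\Big)+F\varphi\,\frac{d\mu_g}{d\mu_h}\Big)\,d\mu_h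 ,$$ with weak derivatives throughout. Say that the $L^2$ Sobolev constant of $(M,g)$ is at most $C_s$ if $$\Big(\int_M |u|^{\frac{2n}{n-2}}\,d\mu_g\Big)^{\frac{n-2}{n}}\le C_s\int_M|\nabla u|_g^2\,d\mu_g\qquad\text{for all }u\in C_0^\infty(M).$$ (1) Let $g$ be a continuous Riemannian metric in $W^{1,n}_{\rm loc}$ whose $L^2$ Sobolev constant is at most $C_s$, and let $(g_\delta)_{\delta>0}$ be smooth Riemannian metrics that coincide with $g$ outside $K$ and converge to $g$ locally in $C^0$ and in $W^{1,n}$ as $\delta\to0$ (in every chart the components converge uniformly, and together with their weak first derivatives in $L^n$, on compact sets). Then there is a function $\Psi$ with $\lim_{\delta\to0^+}\Psi(\delta)=0$ such that for every $\delta>0$ $$|\langle R_{g_\delta},u^2\rangle-\langle R_g,u^2\rangle|\le\Psi(\delta)\int_M|\nabla u|_g^2\,d\mu_g\qquad\text{for all }u\in C_0^\infty(M).$$ (2) The bound depends only on $C_s$ and the $C^0\cap W^{1,n}$-size of $g_\delta-g$, for fixed background data: given $M,h,K,C_s$ and real numbers $\Lambda,A$, there is a function $\psi$ with $\lim_{t\to0,\,t\ge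 0}\psi(t)=0$ and the following property. Let $g$ be any continuous Riemannian metric in $W^{1,n}_{\rm loc}$ whose $L^2$ Sobolev constant is at most $C_s$, and $g'$ any smooth Riemannian metric that coincides with $g$ outside $K$, such that $\Lambda^{-1}h\le g\le\Lambda h$ and $\Lambda^{-1}h\le g'\le\Lambda h$ on $K$ and $\int_K|\tilde\nabla g|_h^n\,d\mu_h\le A$. If $t\ge0$, $\sup_K|g'-g|_h\le t$ and $\big(\int_K|\tilde\nabla (g'-g)|_h^n\,d\mu_h\big)^{1/n}\le t$, then $$|\langle R_{g'},u^2\rangle-\langle R_g,u^2\rangle|\le\psi(t)\int_M|\nabla u|_g^2\,d\mu_g\qquad\text{for all }u\in C_0^\infty(M).$$ -/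

import Mathlib

open MeasureTheory Set Filter Topology
open scoped Manifold ContDiff ENNReal

/-! ## Weak derivatives on open subsets of `ℝⁿ` -/

/-- `ℝⁿ` with its Euclidean norm. -/
abbrev Rn (n : ℕ) : Type := EuclideanSpace ℝ (Fin n)

/-- The classical partial derivative `∂ₖ f (y)`. -/
noncomputable def partialD {n : ℕ} (k : Fin n) (f : Rn n → ℝ) (y : Rn n) : ℝ :=
  fderiv ℝ f y (EuclideanSpace.single k (1 : ℝ))

/-- `f'` is the weak `k`-th partial derivative of `f` on the open set `U`: both are locally
integrable on `U`, and integration by parts holds against every smooth function compactly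
supported in `U`. -/
def IsWeakPartial {n : ℕ} (U : Set (Rn n)) (k : Fin n) (f f' : Rn n → ℝ) : Prop :=
  LocallyIntegrableOn f U ∧ LocallyIntegrableOn f' U ∧
    ∀ φ : Rn n → ℝ, ContDiff ℝ ∞ φ → HasCompactSupport φ → tsupport φ ⊆ U →
      ∫ y in U, f y * partialD k φ y = - ∫ y in U, f' y * φ y

open Classical in
/-- The weak `k`-th partial derivative of `f` on `U` (unique up to null sets), when it exists. -/
noncomputable def weakPartial {n : ℕ} (U : Set (Rn n)) (k : Fin n) (f : Rn n → ℝ) : Rn n → ℝ :=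
  if h : ∃ f', IsWeakPartial U k f f' then h.choose else 0

/-! ## Pointwise tensor algebra in a frame

`G` is the matrix `g_ij` of a metric, and `T k i j` stands for `∇̃_k g_ij`, where `∇̃` is the
covariant derivative of the background metric `h`. The matrix `G⁻¹` is `g^ij`. -/

section Algebra

variable {n : ℕ}

/-- `Γ^k_ij = ½ g^{kl} (∇̃_i g_jl + ∇̃_j g_il - ∇̃_l g_ij)`. -/
noncomputable def gammaTensor (G : Matrix (Fin n) (Fin n) ℝ) (T : Fin n → Fin n → Fin n → ℝ)
    (k i j : Fin n) : ℝ :=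
  (1 / 2) * ∑ l, G⁻¹ k l * (T i j l + T j i l - T l i j)

/-- `∇̃_k g^{ij} = - g^{ia} g^{jb} ∇̃_k g_ab`. -/
noncomputable def nablaInv (G : Matrix (Fin n) (Fin n) ℝ) (T : Fin n → Fin n → Fin n → ℝ)
    (k i j : Fin n) : ℝ :=
  - ∑ a, ∑ b, G⁻¹ i a * G⁻¹ j b * T k a b

/-- `V^k = g^{ij} Γ^k_ij - g^{ik} Γ^j_ji`. -/
noncomputable def vecV (G : Matrix (Fin n) (Fin n) ℝ) (T : Fin n → Fin n → Fin n → ℝ)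
    (k : Fin n) : ℝ :=
  ∑ i, ∑ j, (G⁻¹ i j * gammaTensor G T k i j - G⁻¹ i k * gammaTensor G T j j i)

/-- `F = g^{ij} R̃_ij - ∇̃_k g^{ij} Γ^k_ij + ∇̃_k g^{ik} Γ^j_ji
  + g^{ij} (Γ^k_kl Γ^l_ij - Γ^k_jl Γ^l_ik)`, where `R̃_ij = Ric i j` is the Ricci tensor of the
background metric. -/
noncomputable def scalF (G Ric : Matrix (Fin n) (Fin n) ℝ) (T : Fin n → Fin n → Fin n → ℝ) : ℝ :=
  (∑ i, ∑ j, G⁻¹ i j * Ric i j)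
    - (∑ k, ∑ i, ∑ j, nablaInv G T k i j * gammaTensor G T k i j)
    + (∑ k, ∑ i, ∑ j, nablaInv G T k i k * gammaTensor G T j j i)
    + ∑ i, ∑ j, G⁻¹ i j * ∑ k, ∑ l,
        (gammaTensor G T k k l * gammaTensor G T l i j
          - gammaTensor G T k j l * gammaTensor G T l i k)

/-- The norm of a `2`-tensor with respect to the metric with matrix `H`. -/
noncomputable def norm2 (H : Matrix (Fin n) (Fin n) ℝ) (S : Fin n → Fin n → ℝ) : ℝ :=
  Real.sqrt (∑ i, ∑ j, ∑ a, ∑ b, H⁻¹ i a * H⁻¹ j b * S i j * S a b)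

/-- The norm of a `3`-tensor with respect to the metric with matrix `H`. -/
noncomputable def norm3 (H : Matrix (Fin n) (Fin n) ℝ) (T : Fin n → Fin n → Fin n → ℝ) : ℝ :=
  Real.sqrt (∑ k, ∑ i, ∑ j, ∑ c, ∑ a, ∑ b,
    H⁻¹ k c * H⁻¹ i a * H⁻¹ j b * T k i j * T c a b)

end Algebra

/-! ## Metrics on a manifold and their expressions in charts -/

section Charts

variable {n : ℕ} {M : Type*} [TopologicalSpace M] [ChartedSpace (Rn n) M]

/-- Fields of bilinear forms on the tangent spaces. -/
abbrev BilinField (n : ℕ) (M : Type*) [TopologicalSpace M] [ChartedSpace (Rn n) M] : Type _ :=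
  ∀ x : M, TangentSpace (𝓡 n) x →L[ℝ] TangentSpace (𝓡 n) x →L[ℝ] ℝ

/-- Continuous Riemannian metrics. -/
abbrev C0Metric (n : ℕ) (M : Type*) [TopologicalSpace M] [ChartedSpace (Rn n) M]
    [IsManifold (𝓡 n) ∞ M] : Type _ :=
  Bundle.ContinuousRiemannianMetric (Rn n) (fun x : M => TangentSpace (𝓡 n) x)

/-- Smooth Riemannian metrics. -/
abbrev SmoothMetric (n : ℕ) (M : Type*) [TopologicalSpace M] [ChartedSpace (Rn n) M]
    [IsManifold (𝓡 n) ∞ M] : Type _ :=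
  Bundle.ContMDiffRiemannianMetric (𝓡 n) ∞ (Rn n) (fun x : M => TangentSpace (𝓡 n) x)

/-- The coordinate vector `∂ᵢ` of the chart `e` at the point with coordinates `y`. -/
noncomputable def coordVec (e : OpenPartialHomeomorph M (Rn n)) (y : Rn n) (i : Fin n) :
    TangentSpace (𝓡 n) (e.symm y) :=
  mfderiv (𝓡 n) (𝓡 n) e.symm y (EuclideanSpace.single i (1 : ℝ) : Rn n)

/-- The components `g_ij = g(∂ᵢ, ∂ⱼ)` in the chart `e`. -/
noncomputable def gram (g : BilinField n M) (e : OpenPartialHomeomorph M (Rn n)) (y : Rn n) :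
    Matrix (Fin n) (Fin n) ℝ :=
  Matrix.of fun i j => g (e.symm y) (coordVec e y i) (coordVec e y j)

/-- The Christoffel symbols `Γ̃^k_ij` of the smooth metric `h` in the chart `e`. -/
noncomputable def christoffel (h : BilinField n M) (e : OpenPartialHomeomorph M (Rn n))
    (k i j : Fin n) (y : Rn n) : ℝ :=
  (1 / 2) * ∑ l, (gram h e y)⁻¹ k l *
    (partialD i (fun z => gram h e z j l) y + partialD j (fun z => gram h e z i l) y
      - partialD l (fun z => gram h e z i j) y)

/-- The Ricci tensor `R̃_ij = ∂ₖΓ̃^k_ij - ∂ⱼΓ̃^k_ik + Γ̃^k_kl Γ̃^l_ij - Γ̃^k_jl Γ̃^l_ik` of the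
smooth metric `h` in the chart `e`. -/
noncomputable def ricci (h : BilinField n M) (e : OpenPartialHomeomorph M (Rn n)) (y : Rn n) :
    Matrix (Fin n) (Fin n) ℝ :=
  Matrix.of fun i j => ∑ k,
    (partialD k (christoffel h e k i j) y - partialD j (christoffel h e k i k) y
      + ∑ l, (christoffel h e k k l y * christoffel h e l i j y
          - christoffel h e k j l y * christoffel h e l i k y))

/-- The weak covariant derivative
`∇̃_k g_ij = ∂ₖ g_ij - Γ̃^l_ki g_lj - Γ̃^l_kj g_il` with respect to `h`, in the chart `e`. -/
noncomputable def covDeriv (h g : BilinField n M) (e : OpenPartialHomeomorph M (Rn n)) (y : Rn n)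
    (k i j : Fin n) : ℝ :=
  weakPartial e.target k (fun z => gram g e z i j) y
    - ∑ l, christoffel h e l k i y * gram g e y l j
    - ∑ l, christoffel h e l k j y * gram g e y i l

/-- The density `dμ_g/dμ_h = √(det g / det h)`, in the chart `e`. -/
noncomputable def volRatio (h g : BilinField n M) (e : OpenPartialHomeomorph M (Rn n))
    (y : Rn n) : ℝ :=
  Real.sqrt ((gram g e y).det / (gram h e y).det)

/-- `g ∈ W^{1,p}_loc`: in every smooth chart, the components of `g` and their weak first
derivatives (which exist) are in `L^p` on the compact subsets of the chart. -/
def MemW1pLoc [IsManifold (𝓡 n) ∞ M] (p : ℝ≥0∞) (g : BilinField n M) : Prop :=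
  ∀ e ∈ IsManifold.maximalAtlas (𝓡 n) ∞ M, ∀ i j : Fin n,
    (∀ C ⊆ e.target, IsCompact C → MemLp (fun y => gram g e y i j) p (volume.restrict C)) ∧
    ∀ k : Fin n, ∃ f' : Rn n → ℝ, IsWeakPartial e.target k (fun y => gram g e y i j) f' ∧
      ∀ C ⊆ e.target, IsCompact C → MemLp f' p (volume.restrict C)

/-- `g_δ → g` locally in `C⁰` as `δ ↓ 0`: in every smooth chart, the components converge uniformly
on compact subsets. -/
def TendstoC0Loc [IsManifold (𝓡 n) ∞ M] (gδ : ℝ → BilinField n M) (g : BilinField n M) : Prop :=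
  ∀ e ∈ IsManifold.maximalAtlas (𝓡 n) ∞ M, ∀ i j : Fin n, ∀ C ⊆ e.target, IsCompact C →
    TendstoUniformlyOn (fun δ y => gram (gδ δ) e y i j) (fun y => gram g e y i j) (𝓝[>] 0) C

/-- `g_δ → g` locally in `W^{1,p}` as `δ ↓ 0`: in every smooth chart, the components and their
weak first derivatives converge in `L^p` on compact subsets. -/
def TendstoW1pLoc [IsManifold (𝓡 n) ∞ M] (p : ℝ≥0∞) (gδ : ℝ → BilinField n M)
    (g : BilinField n M) : Prop :=
  ∀ e ∈ IsManifold.maximalAtlas (𝓡 n) ∞ M, ∀ i j : Fin n, ∀ C ⊆ e.target, IsCompact C →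
    Tendsto (fun δ => eLpNorm (fun y => gram (gδ δ) e y i j - gram g e y i j) p
      (volume.restrict C)) (𝓝[>] 0) (𝓝 0) ∧
    ∀ k : Fin n, Tendsto (fun δ => eLpNorm (fun y =>
      weakPartial e.target k (fun z => gram (gδ δ) e z i j) y
        - weakPartial e.target k (fun z => gram g e z i j) y) p
      (volume.restrict C)) (𝓝[>] 0) (𝓝 0)

end Charts

/-! ## Integration on a manifold -/

section Integration

variable {n : ℕ} {M : Type*} [TopologicalSpace M] [ChartedSpace (Rn n) M]
  [T2Space M] [SecondCountableTopology M] [MeasurableSpace M] [BorelSpace M]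

/-- A manifold splits into countably many measurable pieces, locally finitely many, each contained
in a compact subset of the domain of a chart. The pieces are encoded by the map that sends a point
`x` to a point `r x` whose preferred chart is used at `x`. -/
theorem exists_chartCentre (n : ℕ) (M : Type*) [TopologicalSpace M] [ChartedSpace (Rn n) M]
    [T2Space M] [SecondCountableTopology M] [MeasurableSpace M] [BorelSpace M] :
    ∃ r : M → M, (range r).Countable ∧ (∀ p, MeasurableSet (r ⁻¹' {p})) ∧
      (∀ p, ∃ C : Set M, IsCompact C ∧ r ⁻¹' {p} ⊆ C ∧ C ⊆ (chartAt (Rn n) p).source) ∧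
      ∀ K : Set M, IsCompact K → (r '' K).Finite := by
  classical
  have : LocallyCompactSpace M := ChartedSpace.locallyCompactSpace (Rn n) M
  rcases isEmpty_or_nonempty M with hM | hM
  · refine ⟨id, Set.to_countable _, fun p => (hM.false p).elim, fun p => (hM.false p).elim,
      fun K _ => Set.toFinite _⟩
  have h1 : ∀ p : M, ∃ C ∈ 𝓝 p, C ⊆ (chartAt (Rn n) p).source ∧ IsCompact C := fun p =>
    local_compact_nhds ((chartAt (Rn n) p).open_source.mem_nhds (mem_chart_source (Rn n) p))
  choose C hCn hCs hCc using h1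
  obtain ⟨s, hs, hsU⟩ := TopologicalSpace.countable_cover_nhds
    (f := fun p => interior (C p)) (fun p => interior_mem_nhds.2 (hCn p))
  have hsne : s.Nonempty := by
    obtain ⟨x⟩ := hM
    have hx : x ∈ ⋃ p ∈ s, interior (C p) := by rw [hsU]; trivial
    simp only [mem_iUnion] at hx
    obtain ⟨p, hp, -⟩ := hx
    exact ⟨p, hp⟩
  obtain ⟨q, rfl⟩ := hs.exists_eq_range hsne
  have hex : ∀ x : M, ∃ k, x ∈ interior (C (q k)) := by
    intro x
    have hx : x ∈ ⋃ p ∈ range q, interior (C p) := by rw [hsU]; trivial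
    simpa using hx
  refine ⟨fun x => q (Nat.find (hex x)), ?_, ?_, ?_, ?_⟩
  · exact (countable_range q).mono (by rintro _ ⟨x, rfl⟩; exact mem_range_self _)
  · intro p
    have hm : Measurable (fun x : M => Nat.find (hex x)) :=
      measurable_find hex fun k => isOpen_interior.measurableSet
    have : (fun x => q (Nat.find (hex x))) ⁻¹' {p} =
        (fun x : M => Nat.find (hex x)) ⁻¹' (q ⁻¹' {p}) := rfl
    rw [this]
    exact hm (MeasurableSet.of_discrete)
  · intro p
    refine ⟨C p, hCc p, ?_, hCs p⟩
    intro x hx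
    have hx' : q (Nat.find (hex x)) = p := hx
    rw [← hx']
    exact interior_subset (Nat.find_spec (hex x))
  · intro K hK
    obtain ⟨t, ht⟩ := hK.elim_finite_subcover (fun k => interior (C (q k)))
      (fun k => isOpen_interior) (fun x _ => mem_iUnion.2 (hex x))
    obtain ⟨N, hN⟩ := t.bddAbove
    refine ((Set.finite_Iic N).image q).subset ?_
    rintro _ ⟨x, hx, rfl⟩
    obtain ⟨k, hk⟩ := mem_iUnion.1 (ht hx)
    obtain ⟨hkt, hkx⟩ := mem_iUnion.1 hk
    exact ⟨_, (Nat.find_le hkx).trans (hN hkt), rfl⟩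

/-- A choice of the map of `exists_chartCentre`. -/
noncomputable def chartCentre (n : ℕ) {M : Type*} [TopologicalSpace M] [ChartedSpace (Rn n) M]
    [T2Space M] [SecondCountableTopology M] [MeasurableSpace M] [BorelSpace M] : M → M :=
  (exists_chartCentre n M).choose

/-- The chart in which tensor fields are written at the point `x`. All the scalars built from it
below are contractions of tensors, so that their values do not depend on the choice. -/
noncomputable def refChart (n : ℕ) {M : Type*} [TopologicalSpace M] [ChartedSpace (Rn n) M]
    [T2Space M] [SecondCountableTopology M] [MeasurableSpace M] [BorelSpace M] (x : M) :
    OpenPartialHomeomorph M (Rn n) :=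
  chartAt (Rn n) (chartCentre n x)

/-- The measure `√(det g_ij) dy¹ ⋯ dyⁿ` on the domain of the chart `e`. -/
noncomputable def chartVolume (g : BilinField n M) (e : OpenPartialHomeomorph M (Rn n)) :
    Measure M :=
  Measure.map e.symm ((volume.restrict e.target).withDensity
    fun y => ENNReal.ofReal (Real.sqrt (gram g e y).det))

/-- The Riemannian measure `μ_g`, glued from the measures `√(det g_ij) dy¹ ⋯ dyⁿ` in charts. -/
noncomputable def riemVolume (g : BilinField n M) : Measure M :=
  Measure.sum fun p : range (chartCentre n (M := M)) =>
    (chartVolume g (chartAt (Rn n) (p : M))).restrict (chartCentre n ⁻¹' {(p : M)})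

/-- `|∇u|²_g = g^{ij} ∂ᵢu ∂ⱼu` at the point `x`, for a smooth function `u`. -/
noncomputable def gradSq (g : BilinField n M) (u : M → ℝ) (x : M) : ℝ :=
  let e := refChart n x
  let y := e x
  ∑ i, ∑ j, (gram g e y)⁻¹ i j *
    partialD i (fun z => u (e.symm z)) y * partialD j (fun z => u (e.symm z)) y

/-- The Dirichlet energy `∫_M |∇u|²_g dμ_g`. -/
noncomputable def energy (g : BilinField n M) (u : M → ℝ) : ℝ :=
  ∫ x, gradSq g u x ∂(riemVolume g)

/-- `u ∈ C_0^∞(M)`. -/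
def IsTest (u : M → ℝ) : Prop :=
  ContMDiff (𝓡 n) 𝓘(ℝ, ℝ) ∞ u ∧ HasCompactSupport u

/-- The `L²` Sobolev constant of `(M, g)` is at most `Cs`. -/
def SobolevBound (g : BilinField n M) (Cs : ℝ) : Prop :=
  ∀ u : M → ℝ, IsTest (n := n) u →
    (∫ x, |u x| ^ (2 * (n : ℝ) / ((n : ℝ) - 2)) ∂(riemVolume g)) ^ (((n : ℝ) - 2) / (n : ℝ))
      ≤ Cs * energy g u

/-- The function `F φ dμ_g/dμ_h - V · ∇̃(φ dμ_g/dμ_h)`, where the gradient of `φ dμ_g/dμ_h` is a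
weak one (the product with respect to `h` of `V` and a gradient is `V^k ∂ₖ`). -/
noncomputable def scalarCurvDensity (h g : BilinField n M) (φ : M → ℝ) (x : M) : ℝ :=
  let e := refChart n x
  let y := e x
  let G := gram g e y
  let T := covDeriv h g e y
  scalF G (ricci h e y) T * φ x * volRatio h g e y
    - ∑ k, vecV G T k * weakPartial e.target k (fun z => φ (e.symm z) * volRatio h g e z) y

/-- The scalar curvature distribution, computed with the background metric `h`:
`⟨R_g, φ⟩ = ∫_M (-V · ∇̃(φ dμ_g/dμ_h) + F φ dμ_g/dμ_h) dμ_h`. -/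
noncomputable def scalarCurvPairing (h g : BilinField n M) (φ : M → ℝ) : ℝ :=
  ∫ x, scalarCurvDensity h g φ x ∂(riemVolume h)

/-- `|g' - g|_h` at the point `x`. -/
noncomputable def distAt (h g g' : BilinField n M) (x : M) : ℝ :=
  let e := refChart n x
  let y := e x
  norm2 (gram h e y) fun i j => gram g' e y i j - gram g e y i j

/-- `|∇̃g|_h` at the point `x`. -/
noncomputable def nablaAt (h g : BilinField n M) (x : M) : ℝ :=
  let e := refChart n x
  let y := e x
  norm3 (gram h e y) (covDeriv h g e y)

/-- `|∇̃g' - ∇̃g|_h` at the point `x`. -/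
noncomputable def nablaDistAt (h g g' : BilinField n M) (x : M) : ℝ :=
  let e := refChart n x
  let y := e x
  norm3 (gram h e y) fun k i j => covDeriv h g' e y k i j - covDeriv h g e y k i j

/-- `Λ⁻¹ h ≤ g ≤ Λ h` on the set `K`. -/
def ComparableOn (K : Set M) (Λ : ℝ) (h g : BilinField n M) : Prop :=
  ∀ x ∈ K, ∀ v : TangentSpace (𝓡 n) x, Λ⁻¹ * h x v v ≤ g x v v ∧ g x v v ≤ Λ * h x v v

end Integration

/-! ## Calculus of weak partial derivatives -/

section WeakCalculus

variable {n : ℕ} {U V : Set (Rn n)} {k : Fin n} {f f' g g' : Rn n → ℝ}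

/-! After the product rule for the weak gradient of `u² dμ_g/dμ_h`, the density of `⟨R_g, u²⟩` in a
chart reads `u² P - 2 u ∑ₖ ∂ₖu Φᵏ`. Here `P` is at most quadratic and `Φ` is linear in `∇̃g`; their
remaining dependence is on `g`, `g⁻¹`, the volume ratio and smooth background data. Two facts drive
the estimate.

Pointwise, let two metrics have components, and inverse components, bounded on `K`, let `t` bound
the difference of their components, and put `D = |∇̃g' - ∇̃g|`, `X = 1 + |∇̃g| + D`, `E = t X + D`.
Then the `P`-coefficients differ by at most `C X E` and the `Φ`-coefficients by at most `C E`. This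
is an algebraic count of how many factors `∇̃g` each term has (`isNear_potTerm_and_fluxTerm`,
`exists_potTerm_fluxTerm_bound`).

Globally, the metrics agree off `K`, and weak derivatives are local, so only an integral over `K`
remains. With `q = 2n/(n-2)` one has `1/q + 1/n = 1/2`, and Hölder's inequality applied to `(|u|
E)(|u| X + |∂u|)` gives the bound `‖u‖_q ‖E‖_n (‖u‖_q ‖X‖_n + ‖∂u‖_2)`. The Sobolev inequality
controls `‖u‖_q` by the square root of the energy, and `‖∂u‖_2` on `K` is controlled in the same way
because `g` and `h` are comparable there. The outcome is a factor `‖E‖_n`, which tends to zero with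
the `C⁰ ∩ W^{1,n}` distance, times the energy. This is `exists_scalarCurvPairing_bound`, whose
constants are fixed before the metrics.

For the quantitative statement the resulting polynomial in `t` is the modulus `ψ`. For a convergent
family the bound is made small by taking `δ` small, while for each individual `δ` some finite
constant exists; `Ψ` is the infimum of the admissible constants.

The analytic groundwork is a chain rule for continuous functions with locally integrable weak
derivatives, `IsWeakPartial.comp`, proved by mollification. It is what allows the weak gradient of
`u² √(det g / det h)` to be computed when `g` is only continuous and weakly differentiable. -/

theorem partialD_eq_zero_of_notMem_tsupport {φ : Rn n → ℝ} {y : Rn n} (hy : y ∉ tsupport φ) :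
    partialD k φ y = 0 := by
  have h : φ =ᶠ[𝓝 y] 0 := notMem_tsupport_iff_eventuallyEq.1 hy
  have : fderiv ℝ φ y = 0 := by rw [h.fderiv_eq]; simp
  simp [partialD, this]

theorem setIntegral_eq_of_eq_zero_off {φ : Rn n → ℝ} (hφ : tsupport φ ⊆ U) (F : Rn n → ℝ)
    (hF : ∀ y ∉ tsupport φ, F y = 0) : ∫ y in U, F y = ∫ y, F y := by
  refine setIntegral_eq_integral_of_forall_compl_eq_zero fun y hy => hF y fun h => hy (hφ h)

theorem continuous_partialD {φ : Rn n → ℝ} (hφ : ContDiff ℝ 1 φ) : Continuous (partialD k φ) :=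
  (hφ.continuous_fderiv one_ne_zero).clm_apply continuous_const

theorem hasCompactSupport_partialD {φ : Rn n → ℝ} (hφ : HasCompactSupport φ) :
    HasCompactSupport (partialD k φ) :=
  hφ.mono' fun y hy => by
    by_contra h
    exact hy (partialD_eq_zero_of_notMem_tsupport h)

/-- A locally integrable function times a continuous function compactly supported in the domain
is integrable. -/
theorem integrable_mul_of_tsupport_subset {F φ : Rn n → ℝ} (hF : LocallyIntegrableOn F U)
    (hφ : Continuous φ) (hc : HasCompactSupport φ) (hs : tsupport φ ⊆ U) :
    Integrable fun y => F y * φ y := by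
  have h1 : IntegrableOn F (tsupport φ) := hF.integrableOn_compact_subset hs hc
  have h2 : IntegrableOn (fun y => F y * φ y) (tsupport φ) :=
    h1.mul_continuousOn hφ.continuousOn hc
  refine (integrableOn_iff_integrable_of_support_subset ?_).1 h2
  intro y hy
  by_contra h
  exact hy (by simp [image_eq_zero_of_notMem_tsupport h])

/-- Weak derivatives can be computed with integrals over the whole space. -/
theorem IsWeakPartial.integral_eq (h : IsWeakPartial U k f f') {φ : Rn n → ℝ}
    (hφ : ContDiff ℝ ∞ φ) (hc : HasCompactSupport φ) (hs : tsupport φ ⊆ U) :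
    ∫ y, f y * partialD k φ y = - ∫ y, f' y * φ y := by
  have := h.2.2 φ hφ hc hs
  rwa [setIntegral_eq_of_eq_zero_off hs _ fun y hy => by
      simp [partialD_eq_zero_of_notMem_tsupport hy],
    setIntegral_eq_of_eq_zero_off hs _ fun y hy => by
      simp [image_eq_zero_of_notMem_tsupport hy]] at this

theorem isWeakPartial_of_integral_eq (hf : LocallyIntegrableOn f U)
    (hf' : LocallyIntegrableOn f' U)
    (h : ∀ φ : Rn n → ℝ, ContDiff ℝ ∞ φ → HasCompactSupport φ → tsupport φ ⊆ U →
      ∫ y, f y * partialD k φ y = - ∫ y, f' y * φ y) : IsWeakPartial U k f f' := by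
  refine ⟨hf, hf', fun φ hφ hc hs => ?_⟩
  rw [setIntegral_eq_of_eq_zero_off hs _ fun y hy => by
      simp [partialD_eq_zero_of_notMem_tsupport hy],
    setIntegral_eq_of_eq_zero_off hs _ fun y hy => by
      simp [image_eq_zero_of_notMem_tsupport hy]]
  exact h φ hφ hc hs

theorem IsWeakPartial.mono (h : IsWeakPartial U k f f') (hVU : V ⊆ U) :
    IsWeakPartial V k f f' :=
  isWeakPartial_of_integral_eq (h.1.mono_set hVU) (h.2.1.mono_set hVU)
    fun _ hφ hc hs => h.integral_eq hφ hc (hs.trans hVU)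

theorem IsWeakPartial.congr (hU : IsOpen U) (h : IsWeakPartial U k f f') (hfg : EqOn f g U) :
    IsWeakPartial U k g f' := by
  have h1 : LocallyIntegrableOn g U := by
    intro x hx
    obtain ⟨s, hs, hi⟩ := h.1 x hx
    refine ⟨s ∩ U, inter_mem hs self_mem_nhdsWithin, ?_⟩
    have e : f =ᵐ[volume.restrict (s ∩ U)] g :=
      (ae_restrict_of_forall_mem hU.measurableSet fun y hy => hfg hy).filter_mono
        (ae_mono (Measure.restrict_mono inter_subset_right le_rfl))
    exact (integrableOn_congr_fun_ae e).1 (hi.mono_set inter_subset_left)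
  refine isWeakPartial_of_integral_eq h1 h.2.1 fun φ hφ hc hs => ?_
  rw [← h.integral_eq hφ hc hs]
  refine integral_congr_ae (Eventually.of_forall fun y => ?_)
  by_cases hy : y ∈ tsupport φ
  · simp [hfg (hs hy)]
  · simp [partialD_eq_zero_of_notMem_tsupport hy]

/-- Uniqueness of weak derivatives. -/
theorem IsWeakPartial.ae_eq (hU : IsOpen U) (h : IsWeakPartial U k f f')
    (h' : IsWeakPartial U k f g') : ∀ᵐ y, y ∈ U → f' y = g' y := by
  have := hU.ae_eq_zero_of_integral_contDiff_smul_eq_zero (μ := volume) (h.2.1.sub h'.2.1)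
    fun φ hφ hc hs => ?_
  · filter_upwards [this] with y hy hyU
    simpa [sub_eq_zero] using hy hyU
  · have h1 := h.integral_eq hφ hc hs
    have h2 := h'.integral_eq hφ hc hs
    have e1 := integrable_mul_of_tsupport_subset h.2.1 hφ.continuous hc hs
    have e2 := integrable_mul_of_tsupport_subset h'.2.1 hφ.continuous hc hs
    have : ∀ y, φ y • (f' - g') y = f' y * φ y - g' y * φ y := fun y => by
      simp; ring
    simp_rw [this]
    rw [integral_sub e1 e2]
    linarith

theorem isWeakPartial_weakPartial (h : ∃ f', IsWeakPartial U k f f') :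
    IsWeakPartial U k f (weakPartial U k f) := by
  rw [weakPartial, dif_pos h]
  exact h.choose_spec

theorem IsWeakPartial.weakPartial_ae_eq (hU : IsOpen U) (h : IsWeakPartial U k f f') :
    ∀ᵐ y, y ∈ U → weakPartial U k f y = f' y :=
  (isWeakPartial_weakPartial ⟨f', h⟩).ae_eq hU h

/-- The weak derivative of a `C¹` function is the classical one. -/
theorem isWeakPartial_of_contDiffOn (hU : IsOpen U) (hf : ContDiffOn ℝ 1 f U) :
    IsWeakPartial U k f (partialD k f) := by
  have hcont : ContinuousOn (partialD k f) U :=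
    (hf.continuousOn_fderiv_of_isOpen hU le_rfl).clm_apply continuousOn_const
  have l1 : LocallyIntegrableOn f U := hf.continuousOn.locallyIntegrableOn hU.measurableSet
  have l2 : LocallyIntegrableOn (partialD k f) U := hcont.locallyIntegrableOn hU.measurableSet
  refine isWeakPartial_of_integral_eq l1 l2 fun φ hφ hc hs => ?_
  -- Integration by parts needs differentiability of `f` only on the support of `φ`, so `f` does not
  -- have to be cut off or extended beyond `U`.
  have hd : ∀ y ∈ tsupport φ, DifferentiableAt ℝ f y := fun y hy =>
    (hf.differentiableOn one_ne_zero).differentiableAt (hU.mem_nhds (hs hy))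
  have hφ1 : ContDiff ℝ 1 φ := hφ.of_le (by norm_cast)
  exact integral_mul_fderiv_eq_neg_fderiv_mul_of_integrable
    (f := f) (g := φ) (v := EuclideanSpace.single k 1)
    (integrable_mul_of_tsupport_subset l2 hφ.continuous hc hs)
    (integrable_mul_of_tsupport_subset l1 (continuous_partialD hφ1)
      (hasCompactSupport_partialD hc) ((closure_minimal (fun y hy => by
        by_contra h
        exact hy (partialD_eq_zero_of_notMem_tsupport h)) (isClosed_tsupport _)).trans hs))
    (integrable_mul_of_tsupport_subset l1 hφ.continuous hc hs) hd
    (fun y _ => (hφ1.differentiable one_ne_zero) y)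

theorem partialD_mul {φ ψ : Rn n → ℝ} {y : Rn n} (hφ : DifferentiableAt ℝ φ y)
    (hψ : DifferentiableAt ℝ ψ y) :
    partialD k (fun z => φ z * ψ z) y = φ y * partialD k ψ y + ψ y * partialD k φ y := by
  unfold partialD
  rw [fderiv_fun_mul hφ hψ]
  simp

/-- Multiplying by a cutoff function turns a weak derivative on an open set into one on the whole
space. -/
theorem IsWeakPartial.mul_cutoff (h : IsWeakPartial U k f f') {χ : Rn n → ℝ}
    (hχ : ContDiff ℝ ∞ χ) (hc : HasCompactSupport χ) (hs : tsupport χ ⊆ U)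
    {φ : Rn n → ℝ} (hφ : ContDiff ℝ ∞ φ) :
    ∫ y, (f y * χ y) * partialD k φ y = - ∫ y, (f' y * χ y + f y * partialD k χ y) * φ y := by
  have h1 : (1 : ℕ∞ω) ≤ (∞ : ℕ∞ω) := by norm_cast
  have hχ1 := hχ.of_le h1
  have hφ1 := hφ.of_le h1
  have hsub : tsupport (fun y => χ y * φ y) ⊆ tsupport χ := tsupport_mul_subset_left
  -- `χ φ` is an admissible test function on `U` for every smooth `φ`, whatever its support; its
  -- Leibniz term `f ∂χ φ` becomes part of the new derivative.
  have e := h.integral_eq (hχ.mul hφ) hc.mul_right (hsub.trans hs)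
  have hs' : tsupport (partialD k χ) ⊆ U := (closure_minimal (fun y hy => by
        by_contra h
        exact hy (partialD_eq_zero_of_notMem_tsupport h)) (isClosed_tsupport _)).trans hs
  have i1 : Integrable fun y => f y * (χ y * partialD k φ y) :=
    integrable_mul_of_tsupport_subset h.1 (hχ.continuous.mul (continuous_partialD hφ1))
      hc.mul_right (tsupport_mul_subset_left.trans hs)
  have i2 : Integrable fun y => f y * (partialD k χ y * φ y) :=
    integrable_mul_of_tsupport_subset h.1 ((continuous_partialD hχ1).mul hφ.continuous)
      (hasCompactSupport_partialD hc).mul_right (tsupport_mul_subset_left.trans hs')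
  have i3 : Integrable fun y => f' y * (χ y * φ y) :=
    integrable_mul_of_tsupport_subset h.2.1 (hχ.continuous.mul hφ.continuous)
      hc.mul_right (tsupport_mul_subset_left.trans hs)
  have e1 : ∀ y, f y * partialD k (fun z => χ z * φ z) y
      = f y * (χ y * partialD k φ y) + f y * (partialD k χ y * φ y) := fun y => by
    rw [partialD_mul (hχ1.differentiable one_ne_zero y) (hφ1.differentiable one_ne_zero y)]; ring
  have e2 : ∀ y, (f' y * χ y + f y * partialD k χ y) * φ y
      = f' y * (χ y * φ y) + f y * (partialD k χ y * φ y) := fun y => by ring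
  simp_rw [e1] at e
  rw [integral_add i1 i2] at e
  simp_rw [e2, mul_assoc]
  rw [integral_add i3 i2]
  linarith

end WeakCalculus

/-! ### Mollification: uniform and `L¹` convergence. -/

section Mollification

open scoped Convolution Pointwise
open ContinuousLinearMap

variable {n : ℕ} {k : Fin n}

theorem norm_convolution_le_convolution_norm (η w : Rn n → ℝ) (hη : ∀ y, 0 ≤ η y) (x : Rn n) :
    ‖(η ⋆[lsmul ℝ ℝ, volume] w) x‖ ≤ (η ⋆[lsmul ℝ ℝ, volume] fun y => ‖w y‖) x := by
  rw [convolution_def, convolution_def]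
  refine (norm_integral_le_integral_norm _).trans_eq ?_
  refine integral_congr_ae (Eventually.of_forall fun t => ?_)
  simp [abs_of_nonneg (hη t)]

/-- The kernel is nonnegative with total mass one, so Fubini makes mollification a contraction of
`L¹`. -/
theorem integral_norm_normed_convolution_le (η : ContDiffBump (0 : Rn n)) {w : Rn n → ℝ}
    (hw : Integrable w) :
    ∫ x, ‖(η.normed volume ⋆[lsmul ℝ ℝ, volume] w) x‖ ≤ ∫ x, ‖w x‖ := by
  have hη : Integrable (η.normed (volume : Measure (Rn n))) := η.integrable_normed
  calc ∫ x, ‖(η.normed volume ⋆[lsmul ℝ ℝ, volume] w) x‖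
      ≤ ∫ x, (η.normed volume ⋆[lsmul ℝ ℝ, volume] fun y => ‖w y‖) x :=
        integral_mono (hη.integrable_convolution _ hw).norm (hη.integrable_convolution _ hw.norm)
          fun x => norm_convolution_le_convolution_norm _ _ η.nonneg_normed x
    _ = ∫ x, ‖w x‖ := by
        rw [integral_convolution _ hη hw.norm, η.integral_normed]
        simp

/-- A mollified value averages `v` over a ball of radius `rOut`, so the modulus of continuity of `v`
bounds the error at all points simultaneously. -/
theorem tendstoUniformly_normed_convolution {η : ℕ → ContDiffBump (0 : Rn n)}
    (hη : Tendsto (fun m => (η m).rOut) atTop (𝓝 0)) {v : Rn n → ℝ} (hv : UniformContinuous v) :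
    TendstoUniformly (fun m => (η m).normed volume ⋆[lsmul ℝ ℝ, volume] v) v atTop := by
  rw [Metric.tendstoUniformly_iff]
  intro ε hε
  obtain ⟨δ, hδ, h⟩ := Metric.uniformContinuous_iff.1 hv (ε / 2) (half_pos hε)
  filter_upwards [hη.eventually (gt_mem_nhds hδ)] with m hm x
  rw [dist_comm]
  refine ((η m).dist_normed_convolution_le hv.continuous.aestronglyMeasurable
    fun y hy => (h ?_).le).trans_lt (half_lt_self hε)
  exact (Metric.mem_ball.1 hy).trans hm

/-- Mollifications of an integrable function converge in `L¹`. -/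
theorem tendsto_integral_norm_normed_convolution_sub {η : ℕ → ContDiffBump (0 : Rn n)}
    (hη : Tendsto (fun m => (η m).rOut) atTop (𝓝 0)) {w : Rn n → ℝ} (hw : Integrable w) :
    Tendsto (fun m => ∫ x, ‖((η m).normed volume ⋆[lsmul ℝ ℝ, volume] w) x - w x‖) atTop
      (𝓝 0) := by
  rw [Metric.tendsto_atTop']
  intro ε hε
  -- A compactly supported continuous `ψ` replaces `w`. The total error splits into three terms of
  -- size at most `ε / 4`: the mollified `w - ψ`, the mollification error of `ψ`, and `w - ψ`
  -- itself.
  obtain ⟨ψ, hψc, hψ, hψcont, hψi⟩ :=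
    hw.exists_hasCompactSupport_integral_sub_le (ε := ε / 4) (by positivity)
  -- `S` contains the supports of `ψ` and of its mollifications at radius below one. Having finite
  -- volume `c`, it turns the uniform error `ε / (4 (c + 1))` into an `L¹` error of at most `ε / 4`.
  set S : Set (Rn n) := Metric.closedBall (0 : Rn n) 1 + tsupport ψ with hS
  have hScpt : IsCompact S := (isCompact_closedBall _ _).add hψc
  have hunif := tendstoUniformly_normed_convolution hη
    (hψc.uniformContinuous_of_continuous hψcont)
  set c : ℝ := (volume : Measure (Rn n)).real S with hc
  have hc0 : 0 ≤ c := measureReal_nonneg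
  have hev := (Metric.tendstoUniformly_iff.1 hunif (ε / (4 * (c + 1))) (by positivity)).and
    (hη.eventually (gt_mem_nhds one_pos))
  obtain ⟨N, hN⟩ := eventually_atTop.1 hev
  refine ⟨N, fun m hm => ?_⟩
  obtain ⟨h1, h2⟩ := hN m hm.le
  have hηi : Integrable ((η m).normed (volume : Measure (Rn n))) := (η m).integrable_normed
  have hsub : Integrable fun y => w y - ψ y := hw.sub hψi
  have hconv : ∀ᵐ x, ((η m).normed volume ⋆[lsmul ℝ ℝ, volume] w) x - w x
      = ((η m).normed volume ⋆[lsmul ℝ ℝ, volume] fun y => w y - ψ y) x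
        + (((η m).normed volume ⋆[lsmul ℝ ℝ, volume] ψ) x - ψ x) - (w x - ψ x) := by
    filter_upwards [hηi.ae_convolution_exists (lsmul ℝ ℝ) hsub,
      hηi.ae_convolution_exists (lsmul ℝ ℝ) hψi] with x hx1 hx2
    have e := hx1.distrib_add hx2
    have e' : (fun y => w y - ψ y) + ψ = w := by funext y; simp
    rw [e'] at e
    rw [e]
    ring
  have hzero : ∀ x ∉ S, ((η m).normed volume ⋆[lsmul ℝ ℝ, volume] ψ) x - ψ x = 0 := by
    intro x hx
    have e1 : ψ x = 0 := image_eq_zero_of_notMem_tsupport fun h => hx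
      ⟨0, by simp, x, h, by simp⟩
    have e2 : ((η m).normed volume ⋆[lsmul ℝ ℝ, volume] ψ) x = 0 := by
      by_contra h
      obtain ⟨a, ha, b, hb, hab⟩ := support_convolution_subset _ (Function.mem_support.2 h)
      refine hx ⟨a, ?_, b, subset_tsupport _ hb, hab⟩
      rw [(η m).support_normed_eq] at ha
      exact Metric.ball_subset_closedBall (Metric.ball_subset_ball h2.le ha)
    rw [e1, e2, sub_zero]
  have b2 : ∫ x, ‖((η m).normed volume ⋆[lsmul ℝ ℝ, volume] ψ) x - ψ x‖ ≤ ε / 4 := by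
    rw [← setIntegral_eq_integral_of_forall_compl_eq_zero (s := S) fun x hx => by
      rw [hzero x hx, norm_zero]]
    have := norm_setIntegral_le_of_norm_le_const (μ := volume) (s := S)
      (f := fun x => ‖((η m).normed volume ⋆[lsmul ℝ ℝ, volume] ψ) x - ψ x‖)
      (C := ε / (4 * (c + 1))) hScpt.measure_lt_top fun x _ => by
        rw [norm_norm, ← dist_eq_norm, dist_comm]
        exact (h1 x).le
    refine (le_abs_self _).trans (this.trans ?_)
    rw [← hc, div_mul_eq_mul_div, div_le_iff₀ (by positivity)]
    nlinarith
  have b1 := integral_norm_normed_convolution_le (η m) hsub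
  have i1 := (hηi.integrable_convolution (lsmul ℝ ℝ) hsub).norm
  have i2 := ((hηi.integrable_convolution (lsmul ℝ ℝ) hψi).sub hψi).norm
  have i3 := hsub.norm
  have key : ∫ x, ‖((η m).normed volume ⋆[lsmul ℝ ℝ, volume] w) x - w x‖
      ≤ ∫ x, (‖((η m).normed volume ⋆[lsmul ℝ ℝ, volume] fun y => w y - ψ y) x‖
        + ‖((η m).normed volume ⋆[lsmul ℝ ℝ, volume] ψ) x - ψ x‖ + ‖w x - ψ x‖) := by
    refine integral_mono_ae ((hηi.integrable_convolution (lsmul ℝ ℝ) hw).sub hw).norm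
      ((i1.add i2).add i3) ?_
    filter_upwards [hconv] with x hx
    rw [hx]
    exact (norm_sub_le _ _).trans (add_le_add (norm_add_le _ _) le_rfl)
  rw [integral_add (by exact i1.add i2) i3, integral_add i1 (by exact i2)] at key
  rw [Real.dist_0_eq_abs, abs_of_nonneg (integral_nonneg fun _ => norm_nonneg _)]
  linarith

/-- A compactly supported continuous function with an integrable weak derivative is approximated
uniformly by `C¹` functions whose derivatives converge in `L¹`. -/
theorem exists_contDiff_approx_of_weak {v v' : Rn n → ℝ} (hv : Continuous v)
    (hvc : HasCompactSupport v) (hv' : Integrable v')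
    (h : ∀ φ : Rn n → ℝ, ContDiff ℝ ∞ φ → HasCompactSupport φ →
      ∫ y, v y * partialD k φ y = - ∫ y, v' y * φ y) :
    ∃ f : ℕ → Rn n → ℝ, (∀ m, ContDiff ℝ 1 (f m)) ∧ TendstoUniformly f v atTop ∧
      (∀ m, Integrable (partialD k (f m))) ∧
      Tendsto (fun m => ∫ x, ‖partialD k (f m) x - v' x‖) atTop (𝓝 0) := by
  have hpos : ∀ m : ℕ, (0 : ℝ) < 1 / ((m : ℝ) + 1) := fun m => by positivity
  let η : ℕ → ContDiffBump (0 : Rn n) := fun m =>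
    ⟨1 / ((m : ℝ) + 1) / 2, 1 / ((m : ℝ) + 1), half_pos (hpos m), half_lt_self (hpos m)⟩
  have hη : Tendsto (fun m => (η m).rOut) atTop (𝓝 0) :=
    tendsto_one_div_add_atTop_nhds_zero_nat
  have hloc : LocallyIntegrable v := hv.locallyIntegrable
  have hsm : ∀ m, ContDiff ℝ ∞ ((η m).normed (volume : Measure (Rn n))) := fun m =>
    (η m).contDiff_normed
  have hcs : ∀ m, HasCompactSupport ((η m).normed (volume : Measure (Rn n))) := fun m =>
    (η m).hasCompactSupport_normed
  have h1 : (1 : ℕ∞ω) ≤ (∞ : ℕ∞ω) := by norm_cast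
  -- The derivative falls on the kernel, and the weak derivative is tested against `t ↦ η (x - t)`.
  -- The sign from differentiating this reflection cancels the sign of integration by parts.
  have hder : ∀ m, partialD k ((η m).normed volume ⋆[lsmul ℝ ℝ, volume] v)
      = (η m).normed volume ⋆[lsmul ℝ ℝ, volume] v' := by
    intro m
    funext x
    have e1 := (hcs m).hasFDerivAt_convolution_right (lsmul ℝ ℝ).flip hloc ((hsm m).of_le h1) x
    rw [convolution_flip] at e1
    have hη1 := (hsm m).of_le h1
    rw [partialD, e1.fderiv, convolution_precompR_apply _ hloc ((hcs m).fderiv ℝ)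
      (hη1.continuous_fderiv one_ne_zero), convolution_lsmul_swap, convolution_def]
    have hφ : ContDiff ℝ ∞ fun t => (η m).normed (volume : Measure (Rn n)) (x - t) :=
      (hsm m).comp (contDiff_const.sub contDiff_id)
    have hφc : HasCompactSupport fun t => (η m).normed (volume : Measure (Rn n)) (x - t) :=
      (hcs m).comp_homeomorph (Homeomorph.subLeft x)
    have hpd : ∀ t, partialD k (fun t => (η m).normed (volume : Measure (Rn n)) (x - t)) t
        = - partialD k ((η m).normed (volume : Measure (Rn n))) (x - t) := by
      intro t
      unfold partialD
      have : HasFDerivAt (fun t => (η m).normed (volume : Measure (Rn n)) (x - t)) _ t :=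
        ((hη1.differentiable one_ne_zero (x - t)).hasFDerivAt).comp t
          ((hasFDerivAt_const x t).sub (hasFDerivAt_id t))
      rw [this.fderiv]
      simp
    have e := h _ hφ hφc
    simp_rw [hpd, mul_neg, integral_neg, neg_inj] at e
    simp only [flip_apply, lsmul_apply, smul_eq_mul]
    calc _ = ∫ y, v y * partialD k ((η m).normed volume) (x - y) := by
          refine integral_congr_ae (Eventually.of_forall fun t => ?_)
          simp only [partialD]
          ring
      _ = _ := by
          rw [e]
          refine integral_congr_ae (Eventually.of_forall fun t => ?_)
          simp only
          ring
  refine ⟨fun m => (η m).normed volume ⋆[lsmul ℝ ℝ, volume] v, fun m => ?_,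
    tendstoUniformly_normed_convolution hη (hvc.uniformContinuous_of_continuous hv), fun m => ?_,
    ?_⟩
  · exact ((hcs m).contDiff_convolution_left (n := 1) (lsmul ℝ ℝ) ((hsm m).of_le h1) hloc)
  · rw [hder]
    exact ((η m).integrable_normed).integrable_convolution _ hv'
  · simp_rw [hder]
    exact tendsto_integral_norm_normed_convolution_sub hη hv'

end Mollification

/-! ### The chain rule for weak derivatives. -/

section ChainRule

/-- Composition with a continuous function preserves uniform convergence on compact sets. -/
theorem ContinuousOn.tendstoUniformlyOn_comp {α β γ : Type*} [TopologicalSpace α]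
    [PseudoMetricSpace β] [PseudoMetricSpace γ] {S : Set α} (hS : IsCompact S) {W : α → β}
    {Wm : ℕ → α → β} (hW : ContinuousOn W S) (h : TendstoUniformlyOn Wm W atTop S)
    {Ω : Set β} (hΩ : IsOpen Ω) {G : β → γ} (hG : ContinuousOn G Ω) (hmaps : MapsTo W S Ω) :
    TendstoUniformlyOn (fun m y => G (Wm m y)) (fun y => G (W y)) atTop S := by
  rw [← tendstoLocallyUniformlyOn_iff_tendstoUniformlyOn_of_compact hS,
    tendstoLocallyUniformlyOn_iff_forall_tendsto]
  intro x hx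
  have h1 : Tendsto (fun y : ℕ × α => W y.2) (atTop ×ˢ 𝓝[S] x) (𝓝 (W x)) :=
    (hW x hx).tendsto.comp tendsto_snd
  have h2 : Tendsto (fun y : ℕ × α => Wm y.1 y.2) (atTop ×ˢ 𝓝[S] x) (𝓝 (W x)) := by
    refine (tendsto_iff_of_dist ?_).1 h1
    have := (tendstoLocallyUniformlyOn_iff_forall_tendsto.1 h.tendstoLocallyUniformlyOn) x hx
    exact tendsto_uniformity_iff_dist_tendsto_zero.1 this
  have hGx : ContinuousAt G (W x) := hG.continuousAt (hΩ.mem_nhds (hmaps hx))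
  exact ((hGx.tendsto.comp h1).prodMk_nhds (hGx.tendsto.comp h2)).mono_right
    (nhds_le_uniformity _)

/-- Write `cₘ dₘ - c d = cₘ (dₘ - d) + (cₘ - c) d`. The first term is small by `L¹` convergence and
the eventual uniform bound on `cₘ`, the second by uniform convergence and integrability of `d`.
Continuity serves only to make the products measurable. -/
theorem tendsto_integral_mul_of_tendstoUniformly {α : Type*} [MeasurableSpace α]
    [TopologicalSpace α] [OpensMeasurableSpace α] {μ : Measure α} {c d : α → ℝ}
    {cm dm : ℕ → α → ℝ} (hc : Continuous c) (hcb : ∃ B, ∀ y, |c y| ≤ B)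
    (hcm : ∀ᶠ m in atTop, Continuous (cm m)) (h : TendstoUniformly cm c atTop)
    (hd : Integrable d μ) (hdm : ∀ m, Integrable (dm m) μ)
    (h' : Tendsto (fun m => ∫ y, ‖dm m y - d y‖ ∂μ) atTop (𝓝 0)) :
    Tendsto (fun m => ∫ y, cm m y * dm m y ∂μ) atTop (𝓝 (∫ y, c y * d y ∂μ)) := by
  obtain ⟨B, hB⟩ := hcb
  set D := ∫ y, ‖d y‖ ∂μ with hD
  have hD0 : 0 ≤ D := integral_nonneg fun _ => norm_nonneg _
  have hB0 : ∀ y : α, 0 ≤ B := fun y => (abs_nonneg _).trans (hB y)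
  have icd : Integrable (fun y => c y * d y) μ :=
    hd.bdd_mul hc.aestronglyMeasurable (Eventually.of_forall hB)
  rw [Metric.tendsto_atTop']
  intro ε hε
  -- The entry `1` bounds `cₘ` by `|B| + 1`; the other entry makes the term `r D` at most `ε / 2`.
  set r := min 1 (ε / (2 * (D + 1))) with hr
  have hr0 : 0 < r := lt_min one_pos (by positivity)
  have hev := ((Metric.tendstoUniformly_iff.1 h r hr0).and hcm).and
    (h'.eventually (gt_mem_nhds (show 0 < ε / (2 * (|B| + 1)) by positivity)))
  obtain ⟨N, hN⟩ := eventually_atTop.1 hev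
  refine ⟨N, fun m hm => ?_⟩
  obtain ⟨⟨h1, h2⟩, h3⟩ := hN m hm.le
  have hdiff : ∀ y, |cm m y - c y| ≤ r := fun y => by
    have := (h1 y).le
    rwa [dist_comm, Real.dist_eq] at this
  have hcmb : ∀ y, |cm m y| ≤ |B| + 1 := fun y => by
    have e1 := hdiff y
    have e2 := hB y
    have e3 : r ≤ 1 := min_le_left _ _
    have e4 := abs_sub_abs_le_abs_sub (cm m y) (c y)
    linarith [le_abs_self B]
  have icm : Integrable (fun y => cm m y * dm m y) μ :=
    (hdm m).bdd_mul h2.aestronglyMeasurable (Eventually.of_forall hcmb)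
  rw [Real.dist_eq, ← integral_sub icm icd]
  have i1 : Integrable (fun y => (|B| + 1) * ‖dm m y - d y‖) μ :=
    ((hdm m).sub hd).norm.const_mul _
  have i2 : Integrable (fun y => r * ‖d y‖) μ := hd.norm.const_mul _
  have key : |∫ y, (cm m y * dm m y - c y * d y) ∂μ|
      ≤ ∫ y, ((|B| + 1) * ‖dm m y - d y‖ + r * ‖d y‖) ∂μ := by
    refine (norm_integral_le_integral_norm _).trans (integral_mono (icm.sub icd).norm
      (i1.add i2) fun y => ?_)
    have e : cm m y * dm m y - c y * d y
        = cm m y * (dm m y - d y) + (cm m y - c y) * d y := by ring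
    change ‖cm m y * dm m y - c y * d y‖ ≤ (|B| + 1) * ‖dm m y - d y‖ + r * ‖d y‖
    rw [e]
    refine (norm_add_le _ _).trans (add_le_add ?_ ?_)
    · rw [norm_mul]
      exact mul_le_mul_of_nonneg_right (hcmb y) (norm_nonneg _)
    · rw [norm_mul]
      exact mul_le_mul_of_nonneg_right (hdiff y) (norm_nonneg _)
  rw [integral_add i1 i2, integral_const_mul, integral_const_mul] at key
  have e1 : (|B| + 1) * ∫ y, ‖dm m y - d y‖ ∂μ < ε / 2 := by
    have hb : 0 < |B| + 1 := by positivity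
    calc _ < (|B| + 1) * (ε / (2 * (|B| + 1))) := mul_lt_mul_of_pos_left h3 hb
      _ = ε / 2 := by field_simp
  have e2 : r * D ≤ ε / 2 := by
    have : r ≤ ε / (2 * (D + 1)) := min_le_right _ _
    calc r * D ≤ ε / (2 * (D + 1)) * D := mul_le_mul_of_nonneg_right this hD0
      _ ≤ ε / (2 * (D + 1)) * (D + 1) := by gcongr; linarith
      _ = ε / 2 := by field_simp
  linarith

variable {n : ℕ} {U : Set (Rn n)} {k : Fin n}

/-- A smooth cutoff function equal to one, with vanishing derivative, on a compact subset of an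
open set. -/
theorem exists_cutoff (hU : IsOpen U) {S : Set (Rn n)} (hS : IsCompact S) (hSU : S ⊆ U) :
    ∃ χ : Rn n → ℝ, ContDiff ℝ ∞ χ ∧ HasCompactSupport χ ∧ tsupport χ ⊆ U ∧
      ∀ y ∈ S, χ y = 1 ∧ ∀ k, partialD k χ y = 0 := by
  obtain ⟨L, hL, hSL, hLU⟩ := exists_compact_between hS hU hSU
  obtain ⟨χ, h1, h2, h3, h4⟩ := exists_contMDiff_support_eq_eq_one_iff (n := ⊤) 𝓘(ℝ, Rn n)
    (isOpen_interior (s := L)) hS.isClosed hSL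
  have hsub : tsupport χ ⊆ L := closure_minimal (h3.subset.trans interior_subset) hL.isClosed
  refine ⟨χ, h1.contDiff, hL.of_isClosed_subset (isClosed_tsupport _) hsub, hsub.trans hLU,
    fun y hy => ⟨(h4 y).1 hy, fun k => ?_⟩⟩
  -- The derivative vanishes on `S` because `χ` attains its maximal value one there; `χ` need not be
  -- constant near the point.
  have hmax : IsLocalMax χ y := Eventually.of_forall fun z => by
    rw [(h4 y).1 hy]
    exact (h2 (mem_range_self z)).2
  simp [partialD, hmax.fderiv_eq_zero]

theorem locallyIntegrableOn_finsetSum {ι : Type*} (s : Finset ι) {f : ι → Rn n → ℝ}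
    (hf : ∀ a ∈ s, LocallyIntegrableOn (f a) U) :
    LocallyIntegrableOn (fun y => ∑ a ∈ s, f a y) U := by
  classical
  induction s using Finset.induction_on with
  | empty => simpa using locallyIntegrableOn_zero
  | insert a s ha ih =>
    simp_rw [Finset.sum_insert ha]
    exact (hf a (by simp)).add (ih fun b hb => hf b (by simp [hb]))

/-- The chain rule for weak derivatives. -/
theorem IsWeakPartial.comp {ι : Type*} [Fintype ι] [DecidableEq ι] (hU : IsOpen U) {w w' : ι → Rn n → ℝ}
    (hw : ∀ a, ContinuousOn (w a) U) (hw' : ∀ a, IsWeakPartial U k (w a) (w' a))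
    {F : (ι → ℝ) → ℝ} {Ω : Set (ι → ℝ)} (hΩ : IsOpen Ω) (hF : ContDiffOn ℝ 1 F Ω)
    (hmaps : ∀ y ∈ U, (fun a => w a y) ∈ Ω) :
    IsWeakPartial U k (fun y => F fun a => w a y)
      (fun y => ∑ a, fderiv ℝ F (fun a => w a y) (Pi.single a 1) * w' a y) := by
  have hWc : ContinuousOn (fun y a => w a y) U := continuousOn_pi.2 hw
  have hF' : ∀ a, ContinuousOn (fun z => fderiv ℝ F z (Pi.single a 1)) Ω := fun a =>
    (hF.continuousOn_fderiv_of_isOpen hΩ le_rfl).clm_apply continuousOn_const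
  have hFU : ContinuousOn (fun y => F fun a => w a y) U := hF.continuousOn.comp hWc hmaps
  have hF'U : ∀ a, ContinuousOn (fun y => fderiv ℝ F (fun a => w a y) (Pi.single a 1)) U :=
    fun a => (hF' a).comp hWc hmaps
  have hloc : ∀ a, LocallyIntegrableOn
      (fun y => fderiv ℝ F (fun a => w a y) (Pi.single a 1) * w' a y) U := fun a =>
    (hw' a).2.1.continuousOn_mul (hF'U a) hU.isLocallyClosed
  refine isWeakPartial_of_integral_eq (hFU.locallyIntegrableOn hU.measurableSet)
    (locallyIntegrableOn_finsetSum _ fun a _ => hloc a) fun φ hφ hc hs => ?_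
  have h1 : (1 : ℕ∞ω) ≤ (∞ : ℕ∞ω) := by norm_cast
  have hφ1 := hφ.of_le h1
  set S := tsupport φ with hS
  have hScpt : IsCompact S := hc
  -- The functions `w a * χ` are defined on the whole space and can be mollified there; on the
  -- support of `φ` they agree with `w a`, as do their weak derivatives.
  obtain ⟨χ, hχ, hχc, hχs, hχ1⟩ := exists_cutoff hU hScpt hs
  have hχ' : tsupport (partialD k χ) ⊆ U := (closure_minimal (fun y hy => by
        by_contra h
        exact hy (partialD_eq_zero_of_notMem_tsupport h)) (isClosed_tsupport _)).trans hχs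
  have hv : ∀ a, Continuous fun y => w a y * χ y := fun a =>
    ((hw a).mul hχ.continuous.continuousOn).continuous_of_tsupport_subset hU
      (tsupport_mul_subset_right.trans hχs)
  have hv' : ∀ a, Integrable fun y => w' a y * χ y + w a y * partialD k χ y := fun a =>
    (integrable_mul_of_tsupport_subset (hw' a).2.1 hχ.continuous hχc hχs).add
      (integrable_mul_of_tsupport_subset (hw' a).1 (continuous_partialD (hχ.of_le h1))
        (hasCompactSupport_partialD hχc) hχ')
  have happ := fun a => exists_contDiff_approx_of_weak (k := k) (hv a) hχc.mul_left (hv' a)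
    fun φ hφ _ => (hw' a).mul_cutoff hχ hχc hχs hφ
  choose f hf1 hf2 hf3 hf4 using happ
  have hWm : TendstoUniformlyOn (fun m y a => f a m y) (fun y a => w a y) atTop S := by
    rw [Metric.tendstoUniformlyOn_iff]
    intro ε hε
    have : ∀ a, ∀ᶠ m in atTop, ∀ y, dist (w a y * χ y) (f a m y) < ε := fun a =>
      Metric.tendstoUniformly_iff.1 (hf2 a) ε hε
    filter_upwards [eventually_all.2 this] with m hm y hy
    rw [dist_pi_lt_iff hε]
    intro a
    simpa [(hχ1 y hy).1] using hm a y
  have hWS : ContinuousOn (fun y a => w a y) S := hWc.mono hs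
  have hmS : MapsTo (fun y a => w a y) S Ω := fun y hy => hmaps y (hs hy)
  -- The image of `S` is compact in the open set `Ω`, so a whole neighbourhood of it lies in `Ω` and
  -- uniformly close maps send `S` into `Ω`.
  have hin : ∀ᶠ m in atTop, ∀ y ∈ S, (fun a => f a m y) ∈ Ω := by
    obtain ⟨δ, hδ, hsub⟩ := (hScpt.image_of_continuousOn hWS).exists_thickening_subset_open hΩ
      hmS.image_subset
    filter_upwards [Metric.tendstoUniformlyOn_iff.1 hWm δ hδ] with m hm y hy
    refine hsub (Metric.mem_thickening_iff.2 ⟨_, mem_image_of_mem _ hy, ?_⟩)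
    rw [dist_comm]
    exact hm y hy
  have hfc : ∀ m, Continuous fun y a => f a m y := fun m =>
    continuous_pi fun a => (hf1 a m).continuous
  have hUm : ∀ m, IsOpen {y | (fun a => f a m y) ∈ Ω} := fun m => hΩ.preimage (hfc m)
  -- passing to the limit in integrals against functions supported in `S`
  have hlim : ∀ (G : (ι → ℝ) → ℝ), ContinuousOn G Ω → ∀ ψ : Rn n → ℝ, Continuous ψ →
      tsupport ψ ⊆ S → ∀ (d : Rn n → ℝ) (dm : ℕ → Rn n → ℝ), Integrable d →
      (∀ m, Integrable (dm m)) → Tendsto (fun m => ∫ y, ‖dm m y - d y‖) atTop (𝓝 0) →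
      Tendsto (fun m => ∫ y, (G (fun a => f a m y) * ψ y) * dm m y) atTop
        (𝓝 (∫ y, (G (fun a => w a y) * ψ y) * d y)) := by
    intro G hG ψ hψ hψS d dm hd hdm hdd
    have hψc : HasCompactSupport ψ := hScpt.of_isClosed_subset (isClosed_tsupport _) hψS
    obtain ⟨B, hB⟩ := hψ.bounded_above_of_compact_support hψc
    have hcont : Continuous fun y => G (fun a => w a y) * ψ y :=
      ((hG.comp hWc hmaps).mul hψ.continuousOn).continuous_of_tsupport_subset hU
        (tsupport_mul_subset_right.trans (hψS.trans hs))
    refine tendsto_integral_mul_of_tendstoUniformly hcont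
      (hcont.bounded_above_of_compact_support hψc.mul_left) ?_ ?_ hd hdm hdd
    · filter_upwards [hin] with m hm
      exact ((hG.comp (hfc m).continuousOn fun y hy => hy).mul
        hψ.continuousOn).continuous_of_tsupport_subset (hUm m)
        (tsupport_mul_subset_right.trans fun y hy => hm y (hψS hy))
    · have hu := ContinuousOn.tendstoUniformlyOn_comp hScpt hWS hWm hΩ hG hmS
      rw [Metric.tendstoUniformly_iff]
      intro ε hε
      filter_upwards [Metric.tendstoUniformlyOn_iff.1 hu (ε / (|B| + 1)) (by positivity)]
        with m hm y
      by_cases hy : y ∈ S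
      · have e := hm y hy
        rw [Real.dist_eq] at e ⊢
        rw [← sub_mul, abs_mul]
        have hb : |ψ y| < |B| + 1 := (hB y).trans_lt (by linarith [le_abs_self B])
        calc _ ≤ ε / (|B| + 1) * |ψ y| := by gcongr
          _ < ε / (|B| + 1) * (|B| + 1) := by gcongr
          _ = ε := by field_simp
      · have : ψ y = 0 := image_eq_zero_of_notMem_tsupport fun h => hy (hψS h)
        simpa [this] using hε
  have hφ' : tsupport (partialD k φ) ⊆ S := closure_minimal (fun y hy => by
        by_contra h
        exact hy (partialD_eq_zero_of_notMem_tsupport h)) (isClosed_tsupport _)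
  -- The left side of the identity carries no derivative of `f`. The constant sequence `χ`, equal to
  -- one on `S`, plays the role of the `L¹`-convergent factor.
  have hχi : Integrable χ := hχ.continuous.integrable_of_hasCompactSupport hχc
  have L1 := hlim F hF.continuousOn (partialD k φ) (continuous_partialD hφ1) hφ' χ (fun _ => χ)
    hχi (fun _ => hχi) (by simp)
  have L2 := fun a => hlim _ (hF' a) φ hφ.continuous le_rfl _ _ (hv' a) (hf3 a) (hf4 a)
  have L3 := tendsto_finsetSum Finset.univ fun a _ => L2 a
  have hEq : ∀ᶠ m in atTop, ∫ y, (F (fun a => f a m y) * partialD k φ y) * χ y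
      = - ∑ a, ∫ y, (fderiv ℝ F (fun a => f a m y) (Pi.single a 1) * φ y)
          * partialD k (f a m) y := by
    filter_upwards [hin] with m hm
    -- For the approximations the classical chain rule applies on the open preimage of `Ω`, which
    -- contains the support of `φ`.
    have hcd : ContDiffOn ℝ 1 (fun y => F fun a => f a m y) {y | (fun a => f a m y) ∈ Ω} :=
      hF.comp (contDiff_pi.2 fun a => hf1 a m).contDiffOn fun y hy => hy
    have e := (isWeakPartial_of_contDiffOn (k := k) (hUm m) hcd).integral_eq hφ hc hm
    have e1 : ∀ y, (F (fun a => f a m y) * partialD k φ y) * χ y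
        = F (fun a => f a m y) * partialD k φ y := fun y => by
      by_cases hy : y ∈ S
      · rw [(hχ1 y hy).1, mul_one]
      · simp [partialD_eq_zero_of_notMem_tsupport hy]
    have e2 : ∀ y, partialD k (fun y => F fun a => f a m y) y * φ y
        = ∑ a, (fderiv ℝ F (fun a => f a m y) (Pi.single a 1) * φ y)
          * partialD k (f a m) y := fun y => by
      by_cases hy : y ∈ S
      · have hd1 : DifferentiableAt ℝ F (fun a => f a m y) :=
          (hF.differentiableOn one_ne_zero).differentiableAt (hΩ.mem_nhds (hm y hy))
        have hd2 : ∀ a, HasFDerivAt (f a m) (fderiv ℝ (f a m) y) y := fun a =>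
          ((hf1 a m).differentiable one_ne_zero y).hasFDerivAt
        have hd3 := hd1.hasFDerivAt.comp y (hasFDerivAt_pi.2 hd2)
        have hd4 : partialD k (fun y => F fun a => f a m y) y
            = fderiv ℝ F (fun a => f a m y) (fun a => partialD k (f a m) y) := by
          unfold partialD
          have := hd3.fderiv
          simp only [Function.comp_def] at this
          rw [this]
          rfl
        have hsum : (fun a => partialD k (f a m) y)
            = ∑ a, partialD k (f a m) y • (Pi.single a (1 : ℝ) : ι → ℝ) := by
          funext b
          simp [Finset.sum_apply, Pi.single_apply]
        rw [hd4, hsum, map_sum, Finset.sum_mul]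
        refine Finset.sum_congr rfl fun a _ => ?_
        rw [map_smul, smul_eq_mul]
        ring
      · simp [image_eq_zero_of_notMem_tsupport hy]
    simp_rw [e1]
    rw [e]
    simp_rw [e2]
    rw [integral_finsetSum]
    intro a _
    have hcont : Continuous fun y => fderiv ℝ F (fun a => f a m y) (Pi.single a 1) * φ y :=
      (((hF' a).comp (hfc m).continuousOn fun y hy => hy).mul
        hφ.continuous.continuousOn).continuous_of_tsupport_subset (hUm m)
        (tsupport_mul_subset_right.trans fun y hy => hm y hy)
    obtain ⟨B, hB⟩ := hcont.bounded_above_of_compact_support hc.mul_left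
    exact (hf3 a m).bdd_mul hcont.aestronglyMeasurable (Eventually.of_forall hB)
  have L4 := (L1.congr' hEq)
  have := tendsto_nhds_unique L4 L3.neg
  have e1 : ∀ y, (F (fun a => w a y) * partialD k φ y) * χ y
        = F (fun a => w a y) * partialD k φ y := fun y => by
    by_cases hy : y ∈ S
    · rw [(hχ1 y hy).1, mul_one]
    · simp [partialD_eq_zero_of_notMem_tsupport hy]
  have e2 : ∀ a y, (fderiv ℝ F (fun a => w a y) (Pi.single a 1) * φ y)
      * (w' a y * χ y + w a y * partialD k χ y)
        = fderiv ℝ F (fun a => w a y) (Pi.single a 1) * w' a y * φ y := fun a y => by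
    by_cases hy : y ∈ S
    · rw [(hχ1 y hy).1, (hχ1 y hy).2]; ring
    · simp [image_eq_zero_of_notMem_tsupport hy]
  simp_rw [e1, e2] at this
  rw [this, ← integral_finsetSum]
  · simp_rw [Finset.sum_mul]
  · exact fun a _ => integrable_mul_of_tsupport_subset (hloc a) hφ.continuous hc hs

end ChainRule

/-! ### Regularity and positivity of metric components in charts. -/

section GramRegularity

open scoped Bundle

variable {n : ℕ} {M : Type*} [TopologicalSpace M] [ChartedSpace (Rn n) M]

/-- The coordinate field is the tangent map of the inverse chart applied to a constant section; on
the open target the derivative within the set is the full one. -/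
theorem contMDiffOn_coordVec [IsManifold (𝓡 n) ∞ M] {e : OpenPartialHomeomorph M (Rn n)}
    (he : e ∈ IsManifold.maximalAtlas (𝓡 n) ∞ M) (i : Fin n) :
    ContMDiffOn (𝓡 n) (𝓡 n).tangent ∞
      (fun y => (⟨e.symm y, coordVec e y i⟩ : TangentBundle (𝓡 n) M)) e.target := by
  have h1 : IsManifold (𝓡 n) 1 M := IsManifold.of_le (n := ∞) (by norm_cast)
  have hs : ContMDiffOn (𝓡 n) (𝓡 n) ∞ e.symm e.target := contMDiffOn_symm_of_mem_maximalAtlas he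
  have ht := hs.contMDiffOn_tangentMapWithin (m := ∞) (by norm_cast)
    e.open_target.uniqueMDiffOn
  have hc : ContMDiff (𝓡 n) (𝓡 n).tangent ∞
      (fun y => (⟨y, EuclideanSpace.single i (1 : ℝ)⟩ : TangentBundle (𝓡 n) (Rn n))) :=
    contMDiff_vectorSpace_iff_contDiff.2 contDiff_const
  refine (ht.comp hc.contMDiffOn fun y hy => hy).congr fun y hy => ?_
  simp only [Function.comp, tangentMapWithin, coordVec]
  congr 1
  rw [mfderivWithin_of_isOpen e.open_target hy]

/-- The order `m` is left free so that the same argument serves continuous metrics, with `m = 0`,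
and smooth ones. -/
theorem contDiffOn_gram [IsManifold (𝓡 n) ∞ M] {m : ℕ∞ω} (hm : m ≤ (∞ : ℕ∞ω)) {g : BilinField n M}
    (hg : ContMDiff (𝓡 n) ((𝓡 n).prod 𝓘(ℝ, Rn n →L[ℝ] Rn n →L[ℝ] ℝ)) m
      (fun b => Bundle.TotalSpace.mk' (Rn n →L[ℝ] Rn n →L[ℝ] ℝ) b (g b)))
    {e : OpenPartialHomeomorph M (Rn n)} (he : e ∈ IsManifold.maximalAtlas (𝓡 n) ∞ M)
    (i j : Fin n) : ContDiffOn ℝ m (fun y => gram g e y i j) e.target := by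
  rw [← contMDiffOn_iff_contDiffOn]
  have hs : ContMDiffOn (𝓡 n) (𝓡 n) ∞ e.symm e.target := contMDiffOn_symm_of_mem_maximalAtlas he
  intro y hy
  have : ContMDiffWithinAt (𝓡 n) ((𝓡 n).prod 𝓘(ℝ)) m
      (fun y ↦ Bundle.TotalSpace.mk' ℝ (E := Bundle.Trivial M ℝ) (e.symm y)
        (g (e.symm y) (coordVec e y i) (coordVec e y j))) e.target y := by
    apply ContMDiffWithinAt.clm_bundle_apply₂ (F₁ := Rn n) (F₂ := Rn n)
    · exact hg.contMDiffAt.comp_contMDiffWithinAt y ((hs y hy).of_le hm)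
    · exact (contMDiffOn_coordVec he i y hy).of_le hm
    · exact (contMDiffOn_coordVec he j y hy).of_le hm
  simp only [Bundle.contMDiffWithinAt_totalSpace] at this
  exact this.2

theorem C0Metric.continuousOn_gram [IsManifold (𝓡 n) ∞ M] (g : C0Metric n M) {e : OpenPartialHomeomorph M (Rn n)}
    (he : e ∈ IsManifold.maximalAtlas (𝓡 n) ∞ M) (i j : Fin n) :
    ContinuousOn (fun y => gram g.inner e y i j) e.target := by
  have hg : ContMDiff (𝓡 n) ((𝓡 n).prod 𝓘(ℝ, Rn n →L[ℝ] Rn n →L[ℝ] ℝ)) 0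
      (fun b => Bundle.TotalSpace.mk' (Rn n →L[ℝ] Rn n →L[ℝ] ℝ) b (g.inner b)) :=
    contMDiff_zero_iff.2 g.continuous
  exact (contDiffOn_gram (by simp) hg he i j).continuousOn

theorem SmoothMetric.contDiffOn_gram [IsManifold (𝓡 n) ∞ M] (g : SmoothMetric n M) {e : OpenPartialHomeomorph M (Rn n)}
    (he : e ∈ IsManifold.maximalAtlas (𝓡 n) ∞ M) (i j : Fin n) :
    ContDiffOn ℝ ∞ (fun y => gram g.inner e y i j) e.target :=
  _root_.contDiffOn_gram le_rfl g.contMDiff he i j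

theorem coordVec_sum (e : OpenPartialHomeomorph M (Rn n)) (y : Rn n) (v : Fin n → ℝ) :
    ∑ i, v i • coordVec e y i
      = mfderiv (𝓡 n) (𝓡 n) e.symm y (WithLp.toLp 2 v : Rn n) := by
  have : (WithLp.toLp 2 v : Rn n) = ∑ i, v i • (EuclideanSpace.single i (1 : ℝ) : Rn n) := by
    ext j
    simp [Finset.sum_apply, Pi.single_apply]
  let D : Rn n →L[ℝ] TangentSpace (𝓡 n) (e.symm y) := mfderiv (𝓡 n) (𝓡 n) e.symm y
  change _ = D _
  rw [this, map_sum]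
  refine Finset.sum_congr rfl fun i _ => ?_
  rw [map_smul]
  rfl

/-- Linear independence of the coordinate vectors: the differential of the inverse chart is
bijective. It carries positivity of the metric over to its matrix. -/
theorem coordVec_sum_ne_zero [IsManifold (𝓡 n) ∞ M] {e : OpenPartialHomeomorph M (Rn n)}
    (he : e ∈ IsManifold.maximalAtlas (𝓡 n) ∞ M) {y : Rn n} (hy : y ∈ e.target)
    {v : Fin n → ℝ} (hv : v ≠ 0) : ∑ i, v i • coordVec e y i ≠ 0 := by
  have hd : e.MDifferentiable (𝓡 n) (𝓡 n) :=
    ⟨(contMDiffOn_of_mem_maximalAtlas he).mdifferentiableOn (by simp),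
      (contMDiffOn_symm_of_mem_maximalAtlas he).mdifferentiableOn (by simp)⟩
  rw [coordVec_sum]
  intro h
  have hinj := (hd.symm.mfderiv_bijective (x := y) hy).1
  have : (WithLp.toLp 2 v : Rn n) = 0 := hinj (h.trans (map_zero _).symm)
  refine hv ?_
  funext i
  simpa using congrFun (congrArg WithLp.ofLp this) i

theorem sum_apply_apply_mul_mul {E : Type*} [TopologicalSpace E] [AddCommGroup E]
    [IsTopologicalAddGroup E] [Module ℝ E] [ContinuousSMul ℝ E] (B : E →L[ℝ] E →L[ℝ] ℝ)
    (c : Fin n → E) (v : Fin n → ℝ) :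
    ∑ i, ∑ j, B (c i) (c j) * v i * v j = B (∑ i, v i • c i) (∑ i, v i • c i) := by
  simp only [map_sum, map_smul, sum_apply, smul_apply, smul_eq_mul,
    Finset.mul_sum]
  rw [Finset.sum_comm]
  refine Finset.sum_congr rfl fun j _ => Finset.sum_congr rfl fun i _ => ?_
  ring

/-- A bilinear form evaluated through its components. -/
theorem gram_quadratic (g : BilinField n M) (e : OpenPartialHomeomorph M (Rn n)) (y : Rn n)
    (v : Fin n → ℝ) :
    ∑ i, ∑ j, gram g e y i j * v i * v j
      = g (e.symm y) (∑ i, v i • coordVec e y i) (∑ i, v i • coordVec e y i) :=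
  sum_apply_apply_mul_mul (g (e.symm y)) (coordVec e y) v

theorem gram_symm {g : BilinField n M} (hg : ∀ x v w, g x v w = g x w v)
    (e : OpenPartialHomeomorph M (Rn n)) (y : Rn n) (i j : Fin n) :
    gram g e y i j = gram g e y j i := by
  simp [gram, hg _ (coordVec e y i)]

theorem gram_pos [IsManifold (𝓡 n) ∞ M] {g : BilinField n M} (hg : ∀ x v, v ≠ 0 → 0 < g x v v)
    {e : OpenPartialHomeomorph M (Rn n)} (he : e ∈ IsManifold.maximalAtlas (𝓡 n) ∞ M) {y : Rn n}
    (hy : y ∈ e.target) {v : Fin n → ℝ} (hv : v ≠ 0) :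
    0 < ∑ i, ∑ j, gram g e y i j * v i * v j := by
  rw [gram_quadratic]
  exact hg _ _ (coordVec_sum_ne_zero he hy hv)

end GramRegularity

/-! ### The weak derivative of the volume ratio. -/

section VolumeDerivative

variable {n : ℕ}

/-- The logarithmic-derivative formula for `∂ₖ √(det G / det H)`, where `dG` and `dH` are the
derivatives of the matrices `G` and `H`. -/
noncomputable def volRatioD (G H : Matrix (Fin n) (Fin n) ℝ) (dG dH : Fin n → Fin n → ℝ) : ℝ :=
  1 / 2 * Real.sqrt (G.det / H.det) *
    (∑ i, ∑ j, G⁻¹ j i * dG i j - ∑ i, ∑ j, H⁻¹ j i * dH i j)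

/-- The determinant is affine in each single entry, with slope the cofactor. This is Jacobi's
formula one entry at a time. -/
theorem Matrix.det_add_smul_single (G : Matrix (Fin n) (Fin n) ℝ) (i j : Fin n) (t : ℝ) :
    (Matrix.of fun a b => G a b + t * (Pi.single (i, j) (1 : ℝ) : Fin n × Fin n → ℝ) (a, b)).det
      = G.det + t * G.adjugate j i := by
  have h : (Matrix.of fun a b => G a b
      + t * (Pi.single (i, j) (1 : ℝ) : Fin n × Fin n → ℝ) (a, b))
      = G.updateRow i (G i + t • Pi.single j 1) := by
    ext a b
    by_cases ha : a = i
    · subst ha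
      by_cases hb : b = j <;> simp [hb, Pi.single_apply]
    · simp [ha, Pi.single_apply]
  rw [h, Matrix.det_updateRow_add, Matrix.det_updateRow_smul, Matrix.updateRow_eq_self,
    Matrix.adjugate_apply]

theorem Matrix.inv_apply_eq (G : Matrix (Fin n) (Fin n) ℝ) (i j : Fin n) :
    G⁻¹ i j = G.adjugate i j / G.det := by
  rw [Matrix.inv_def]
  simp [div_eq_inv_mul]

/-- The indices of a number, a matrix `G` and a matrix `H`. -/
abbrev VolIndex (n : ℕ) : Type := Unit ⊕ ((Fin n × Fin n) ⊕ (Fin n × Fin n))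

/-- The determinant of the first matrix. -/
noncomputable def VolIndex.detG (w : VolIndex n → ℝ) : ℝ :=
  (Matrix.of fun i j : Fin n => w (Sum.inr (Sum.inl (i, j)))).det

/-- The determinant of the second matrix. -/
noncomputable def VolIndex.detH (w : VolIndex n → ℝ) : ℝ :=
  (Matrix.of fun i j : Fin n => w (Sum.inr (Sum.inr (i, j)))).det

theorem VolIndex.contDiff_detG {m : ℕ∞ω} : ContDiff ℝ m (VolIndex.detG (n := n)) := by
  unfold VolIndex.detG
  simp only [Matrix.det_apply, Matrix.of_apply]
  fun_prop

theorem VolIndex.contDiff_detH {m : ℕ∞ω} : ContDiff ℝ m (VolIndex.detH (n := n)) := by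
  unfold VolIndex.detH
  simp only [Matrix.det_apply, Matrix.of_apply]
  fun_prop

/-- The chain rule is applied to `φ √(det G / det H)` as a function of one number and two matrices,
on the open set where both determinants are positive. The derivative is the explicit expression
given by the chain rule, so the formula holds at every point of `U`. -/
theorem IsWeakPartial.mul_volRatio {U : Set (Rn n)} (hU : IsOpen U) {k : Fin n}
    {φ : Rn n → ℝ} (hφ : ContDiffOn ℝ 1 φ U) {G H : Rn n → Matrix (Fin n) (Fin n) ℝ}
    {dG : Fin n → Fin n → Rn n → ℝ}
    (hG : ∀ i j, ContinuousOn (fun y => G y i j) U)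
    (hdG : ∀ i j, IsWeakPartial U k (fun y => G y i j) (dG i j))
    (hH : ∀ i j, ContDiffOn ℝ 1 (fun y => H y i j) U)
    (hGpos : ∀ y ∈ U, 0 < (G y).det) (hHpos : ∀ y ∈ U, 0 < (H y).det) :
    ∃ f', IsWeakPartial U k (fun y => φ y * Real.sqrt ((G y).det / (H y).det)) f' ∧
      ∀ y ∈ U, f' y = partialD k φ y * Real.sqrt ((G y).det / (H y).det)
        + φ y * volRatioD (G y) (H y) (fun i j => dG i j y)
          (fun i j => partialD k (fun z => H z i j) y) := by
  classical
  let w : VolIndex n → Rn n → ℝ := Sum.elim (fun _ => φ)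
    (Sum.elim (fun a y => G y a.1 a.2) fun a y => H y a.1 a.2)
  let w' : VolIndex n → Rn n → ℝ := Sum.elim (fun _ => partialD k φ)
    (Sum.elim (fun a => dG a.1 a.2) fun a => partialD k fun y => H y a.1 a.2)
  let Ω : Set (VolIndex n → ℝ) := {w | 0 < VolIndex.detG w ∧ 0 < VolIndex.detH w}
  let F : (VolIndex n → ℝ) → ℝ := fun w =>
    w (Sum.inl ()) * Real.sqrt (VolIndex.detG w / VolIndex.detH w)
  have hΩ : IsOpen Ω := (isOpen_lt continuous_const
    (VolIndex.contDiff_detG (m := 0)).continuous).inter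
    (isOpen_lt continuous_const (VolIndex.contDiff_detH (m := 0)).continuous)
  have hF : ContDiffOn ℝ 1 F Ω := by
    refine ContDiffOn.mul (contDiff_apply ℝ ℝ _).contDiffOn (ContDiffOn.sqrt ?_ ?_)
    · exact ContDiffOn.div VolIndex.contDiff_detG.contDiffOn VolIndex.contDiff_detH.contDiffOn
        fun y hy => hy.2.ne'
    · exact fun y hy => (div_pos hy.1 hy.2).ne'
  have hwc : ∀ a, ContinuousOn (w a) U := by
    rintro (a | a | a)
    · exact hφ.continuousOn
    · exact hG _ _
    · exact (hH _ _).continuousOn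
  have hw' : ∀ a, IsWeakPartial U k (w a) (w' a) := by
    rintro (a | a | a)
    · exact isWeakPartial_of_contDiffOn hU hφ
    · exact hdG _ _
    · exact isWeakPartial_of_contDiffOn hU (hH _ _)
  have hmaps : ∀ y ∈ U, (fun a => w a y) ∈ Ω := fun y hy => ⟨hGpos y hy, hHpos y hy⟩
  refine ⟨_, IsWeakPartial.comp hU hwc hw' hΩ hF hmaps, fun y hy => ?_⟩
  set p : VolIndex n → ℝ := fun a => w a y with hp
  have hg : 0 < (G y).det := hGpos y hy
  have hh : 0 < (H y).det := hHpos y hy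
  have hdet1 : VolIndex.detG p = (G y).det := rfl
  have hdet2 : VolIndex.detH p = (H y).det := rfl
  set ρ := Real.sqrt ((G y).det / (H y).det) with hρ
  have hρ0 : 0 < ρ := Real.sqrt_pos.2 (div_pos hg hh)
  have hρ2 : ρ ^ 2 = (G y).det / (H y).det := Real.sq_sqrt (div_pos hg hh).le
  have hFd : DifferentiableAt ℝ F p :=
    (hF.differentiableOn one_ne_zero).differentiableAt (hΩ.mem_nhds (hmaps y hy))
  -- Since `F` is differentiable at `p`, each of its partial derivatives is a derivative along a
  -- line, where at most one determinant varies, and affinely.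
  have hline : ∀ a (c : ℝ), HasDerivAt (fun t : ℝ => F (p + t • Pi.single a 1)) c 0 →
      fderiv ℝ F p (Pi.single a 1) = c := by
    intro a c hc
    have h1 : HasLineDerivAt ℝ F c p (Pi.single a 1) := hc
    exact (hFd.hasFDerivAt.hasLineDerivAt _).unique h1
  have d0 : fderiv ℝ F p (Pi.single (Sum.inl ()) 1) = ρ := by
    refine hline _ _ ?_
    have : (fun t : ℝ => F (p + t • Pi.single (Sum.inl ()) 1)) = fun t => (φ y + t) * ρ := by
      funext t
      simp [F, VolIndex.detG, VolIndex.detH, hp, w, hρ]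
      exact Or.inl rfl
    rw [this]
    simpa using ((hasDerivAt_id (0 : ℝ)).const_add (φ y)).mul_const ρ
  have d1 : ∀ i j, fderiv ℝ F p (Pi.single (Sum.inr (Sum.inl (i, j))) 1)
      = φ y * (1 / 2 * ρ * (G y)⁻¹ j i) := by
    intro i j
    refine hline _ _ ?_
    have : (fun t : ℝ => F (p + t • Pi.single (Sum.inr (Sum.inl (i, j))) 1)) = fun t =>
        φ y * Real.sqrt (((G y).det + t * (G y).adjugate j i) / (H y).det) := by
      funext t
      rw [← Matrix.det_add_smul_single]
      simp [F, VolIndex.detG, VolIndex.detH, hp, w, Pi.single_apply]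
      exact Or.inl rfl
    rw [this]
    have e1 : HasDerivAt (fun t : ℝ => ((G y).det + t * (G y).adjugate j i) / (H y).det)
        ((G y).adjugate j i / (H y).det) 0 := by
      simpa using (((hasDerivAt_id (0 : ℝ)).mul_const ((G y).adjugate j i)).const_add
        (G y).det).div_const (H y).det
    have e2 := (e1.sqrt (by simpa using (div_pos hg hh).ne')).const_mul (φ y)
    refine e2.congr_deriv ?_
    rw [zero_mul, add_zero, ← hρ, Matrix.inv_apply_eq]
    -- Eliminating `det H` in favour of `ρ` turns the identity into one between rational
    -- expressions.
    have : (H y).det = (G y).det / ρ ^ 2 := by rw [hρ2]; field_simp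
    rw [this]
    field_simp
  have d2 : ∀ i j, fderiv ℝ F p (Pi.single (Sum.inr (Sum.inr (i, j))) 1)
      = - (φ y * (1 / 2 * ρ * (H y)⁻¹ j i)) := by
    intro i j
    refine hline _ _ ?_
    have : (fun t : ℝ => F (p + t • Pi.single (Sum.inr (Sum.inr (i, j))) 1)) = fun t =>
        φ y * Real.sqrt ((G y).det / ((H y).det + t * (H y).adjugate j i)) := by
      funext t
      rw [← Matrix.det_add_smul_single]
      simp [F, VolIndex.detG, VolIndex.detH, hp, w, Pi.single_apply]
      exact Or.inl rfl
    rw [this]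
    have e1 : HasDerivAt (fun t : ℝ => (G y).det / ((H y).det + t * (H y).adjugate j i))
        (- ((G y).det * (H y).adjugate j i) / (H y).det ^ 2) 0 := by
      have := (hasDerivAt_const (0 : ℝ) (G y).det).fun_div
        (((hasDerivAt_id (0 : ℝ)).mul_const ((H y).adjugate j i)).const_add (H y).det)
        (by simpa using hh.ne')
      simpa using this
    have e2 := (e1.sqrt (by simpa using (div_pos hg hh).ne')).const_mul (φ y)
    refine e2.congr_deriv ?_
    rw [zero_mul, add_zero, ← hρ, Matrix.inv_apply_eq]
    have : (G y).det = ρ ^ 2 * (H y).det := by rw [hρ2]; field_simp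
    rw [this]
    field_simp
  rw [Fintype.sum_sum_type, Fintype.sum_sum_type, Fintype.sum_prod_type, Fintype.sum_prod_type]
  simp only [Finset.univ_unique, Finset.sum_singleton]
  change fderiv ℝ F p (Pi.single (Sum.inl ()) 1) * partialD k φ y
    + ((∑ i, ∑ j, fderiv ℝ F p (Pi.single (Sum.inr (Sum.inl (i, j))) 1) * dG i j y)
    + ∑ i, ∑ j, fderiv ℝ F p (Pi.single (Sum.inr (Sum.inr (i, j))) 1)
      * partialD k (fun z => H z i j) y) = _
  simp only [d0, d1, d2]
  have s1 : ∑ i, ∑ j, φ y * (1 / 2 * ρ * (G y)⁻¹ j i) * dG i j y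
      = φ y * (1 / 2 * ρ) * ∑ i, ∑ j, (G y)⁻¹ j i * dG i j y := by
    simp only [Finset.mul_sum]
    exact Finset.sum_congr rfl fun i _ => Finset.sum_congr rfl fun j _ => by ring
  have s2 : ∑ i, ∑ j, -(φ y * (1 / 2 * ρ * (H y)⁻¹ j i)) * partialD k (fun z => H z i j) y
      = - (φ y * (1 / 2 * ρ) * ∑ i, ∑ j, (H y)⁻¹ j i * partialD k (fun z => H z i j) y) := by
    simp only [Finset.mul_sum, ← Finset.sum_neg_distrib]
    exact Finset.sum_congr rfl fun i _ => Finset.sum_congr rfl fun j _ => by ring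
  rw [s1, s2, volRatioD, ← hρ]
  ring

end VolumeDerivative

/-! ### Calculus of sizes and differences of pairs of quantities. -/

section Near

variable {ι : Type*} {X ε : ι → ℝ}

/-- `a` and `a'` are bounded by multiples of `X ^ d`, and their difference by a multiple of
`X ^ d * ε`, uniformly in the parameter. -/
def IsNear (X ε : ι → ℝ) (d : ℕ) (a a' : ι → ℝ) : Prop :=
  ∃ C, 0 ≤ C ∧ ∀ q, |a q| ≤ C * X q ^ d ∧ |a' q| ≤ C * X q ^ d ∧
    |a' q - a q| ≤ C * (X q ^ d * ε q)

theorem IsNear.zero (d : ℕ) :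
    IsNear X ε d (fun _ => 0) (fun _ => 0) :=
  ⟨0, le_rfl, fun q => by simp⟩

/-- This covers bounded quantities compared with themselves, such as the background data. -/
theorem IsNear.of_bound (hε : ∀ q, 0 ≤ ε q) {a : ι → ℝ} {B : ℝ}
    (ha : ∀ q, |a q| ≤ B) : IsNear X ε 0 a a := by
  refine ⟨|B|, abs_nonneg _, fun q => ⟨?_, ?_, ?_⟩⟩
  · simpa using (ha q).trans (le_abs_self B)
  · simpa using (ha q).trans (le_abs_self B)
  · simpa using mul_nonneg (abs_nonneg B) (hε q)

theorem IsNear.mono (hX : ∀ q, 1 ≤ X q) (hε : ∀ q, 0 ≤ ε q) {d d' : ℕ} (hd : d ≤ d')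
    {a a' : ι → ℝ} (h : IsNear X ε d a a') : IsNear X ε d' a a' := by
  obtain ⟨C, hC, h⟩ := h
  refine ⟨C, hC, fun q => ?_⟩
  have h1 : X q ^ d ≤ X q ^ d' := pow_le_pow_right₀ (hX q) hd
  obtain ⟨e1, e2, e3⟩ := h q
  have := hε q
  exact ⟨e1.trans (by gcongr), e2.trans (by gcongr), e3.trans (by gcongr)⟩

theorem IsNear.add {d : ℕ} {a a' b b' : ι → ℝ} (ha : IsNear X ε d a a')
    (hb : IsNear X ε d b b') : IsNear X ε d (fun q => a q + b q) (fun q => a' q + b' q) := by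
  obtain ⟨C, hC, ha⟩ := ha
  obtain ⟨D, hD, hb⟩ := hb
  refine ⟨C + D, by positivity, fun q => ?_⟩
  obtain ⟨e1, e2, e3⟩ := ha q
  obtain ⟨f1, f2, f3⟩ := hb q
  refine ⟨(abs_add_le _ _).trans (by linarith), (abs_add_le _ _).trans (by linarith), ?_⟩
  have : a' q + b' q - (a q + b q) = (a' q - a q) + (b' q - b q) := by ring
  rw [this]
  exact (abs_add_le _ _).trans (by linarith)

theorem IsNear.neg {d : ℕ} {a a' : ι → ℝ} (ha : IsNear X ε d a a') :
    IsNear X ε d (fun q => - a q) (fun q => - a' q) := by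
  obtain ⟨C, hC, ha⟩ := ha
  refine ⟨C, hC, fun q => ?_⟩
  obtain ⟨e1, e2, e3⟩ := ha q
  refine ⟨by rwa [abs_neg], by rwa [abs_neg], ?_⟩
  rwa [← neg_sub', abs_neg]

theorem IsNear.sub {d : ℕ} {a a' b b' : ι → ℝ} (ha : IsNear X ε d a a')
    (hb : IsNear X ε d b b') : IsNear X ε d (fun q => a q - b q) (fun q => a' q - b' q) := by
  simpa only [sub_eq_add_neg] using ha.add hb.neg

/-- From `a' b' - a b = (a' - a) b' + a (b' - b)`: the degrees in `X` add up, while `ε` enters only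
once. -/
theorem IsNear.mul {d d' e : ℕ} (he : d + d' = e) {a a' b b' : ι → ℝ} (hX : ∀ q, 1 ≤ X q)
    (ha : IsNear X ε d a a') (hb : IsNear X ε d' b b') :
    IsNear X ε e (fun q => a q * b q) (fun q => a' q * b' q) := by
  subst he
  obtain ⟨C, hC, ha⟩ := ha
  obtain ⟨D, hD, hb⟩ := hb
  refine ⟨2 * (C * D), by positivity, fun q => ?_⟩
  obtain ⟨e1, e2, e3⟩ := ha q
  obtain ⟨f1, f2, f3⟩ := hb q
  have hx : 0 ≤ X q := zero_le_one.trans (hX q)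
  have p1 : |a q * b q| ≤ (C * X q ^ d) * (D * X q ^ d') := by
    rw [abs_mul]; gcongr
  have p2 : |a' q * b' q| ≤ (C * X q ^ d) * (D * X q ^ d') := by
    rw [abs_mul]; gcongr
  have p3 : 0 ≤ (C * X q ^ d) * (D * X q ^ d') := by positivity
  refine ⟨p1.trans ?_, p2.trans ?_, ?_⟩
  · rw [pow_add]; linarith
  · rw [pow_add]; linarith
  · have : a' q * b' q - a q * b q = (a' q - a q) * b' q + a q * (b' q - b q) := by ring
    rw [this]
    have r1 : |(a' q - a q) * b' q| ≤ (C * (X q ^ d * ε q)) * (D * X q ^ d') := by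
      rw [abs_mul]; gcongr; exact (abs_nonneg _).trans e3
    have r2 : |a q * (b' q - b q)| ≤ (C * X q ^ d) * (D * (X q ^ d' * ε q)) := by
      rw [abs_mul]; gcongr
    refine (abs_add_le _ _).trans ((add_le_add r1 r2).trans_eq ?_)
    rw [pow_add]
    ring

theorem IsNear.sum {d : ℕ} {κ : Type*} (s : Finset κ)
    {a a' : κ → ι → ℝ} (h : ∀ k ∈ s, IsNear X ε d (a k) (a' k)) :
    IsNear X ε d (fun q => ∑ k ∈ s, a k q) (fun q => ∑ k ∈ s, a' k q) := by
  classical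
  induction s using Finset.induction_on with
  | empty => simpa using IsNear.zero d
  | insert k s hk ih =>
    simp_rw [Finset.sum_insert hk]
    exact (h k (by simp)).add (ih fun l hl => h l (by simp [hl]))

theorem IsNear.prod (hX : ∀ q, 1 ≤ X q) (hε : ∀ q, 0 ≤ ε q) {κ : Type*} (s : Finset κ)
    {a a' : κ → ι → ℝ} (h : ∀ k ∈ s, IsNear X ε 0 (a k) (a' k)) :
    IsNear X ε 0 (fun q => ∏ k ∈ s, a k q) (fun q => ∏ k ∈ s, a' k q) := by
  classical
  induction s using Finset.induction_on with
  | empty => simpa using IsNear.of_bound (a := fun _ => 1) (B := 1) hε (by simp)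
  | insert k s hk ih =>
    simp_rw [Finset.prod_insert hk]
    exact (h k (by simp)).mul rfl hX (ih fun l hl => h l (by simp [hl]))

/-- The square root is Lipschitz away from zero. A lower bound for `a` alone suffices, because `|√a'
- √a| √a ≤ |a' - a|` whatever the sign of `a'`. -/
theorem IsNear.sqrt (hε : ∀ q, 0 ≤ ε q) {a a' : ι → ℝ} (h : IsNear X ε 0 a a')
    {B : ℝ} (ha : ∀ q, 0 < a q) (hB : ∀ q, (a q)⁻¹ ≤ B) :
    IsNear X ε 0 (fun q => Real.sqrt (a q)) (fun q => Real.sqrt (a' q)) := by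
  obtain ⟨C, hC, h⟩ := h
  refine ⟨max (Real.sqrt C) (C * Real.sqrt B), by positivity, fun q => ?_⟩
  obtain ⟨e1, e2, e3⟩ := h q
  simp only [pow_zero, mul_one, one_mul] at e1 e2 e3 ⊢
  refine ⟨?_, ?_, ?_⟩
  · rw [abs_of_nonneg (Real.sqrt_nonneg _)]
    exact (Real.sqrt_le_sqrt ((le_abs_self _).trans e1)).trans (le_max_left _ _)
  · rw [abs_of_nonneg (Real.sqrt_nonneg _)]
    exact (Real.sqrt_le_sqrt ((le_abs_self _).trans e2)).trans (le_max_left _ _)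
  · have hs : 0 < Real.sqrt (a q) := Real.sqrt_pos.2 (ha q)
    have hinv : 1 ≤ Real.sqrt B * Real.sqrt (a q) := by
      rw [← Real.sqrt_mul' _ (ha q).le, Real.one_le_sqrt]
      calc 1 = (a q)⁻¹ * a q := (inv_mul_cancel₀ (ha q).ne').symm
        _ ≤ B * a q := by gcongr; exacts [(ha q).le, hB q]
    have key : |Real.sqrt (a' q) - Real.sqrt (a q)| * Real.sqrt (a q) ≤ |a' q - a q| := by
      rcases le_total 0 (a' q) with h0 | h0
      · have e : a' q - a q = (Real.sqrt (a' q) - Real.sqrt (a q))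
            * (Real.sqrt (a' q) + Real.sqrt (a q)) := by
          have h1 := Real.mul_self_sqrt h0
          have h2 := Real.mul_self_sqrt (ha q).le
          linear_combination -h1 + h2
        rw [e, abs_mul]
        gcongr
        rw [abs_of_nonneg (by positivity)]
        linarith [Real.sqrt_nonneg (a' q)]
      -- For nonpositive `a'` the root is zero by convention, and the claim becomes `a ≤ a - a'`.
      · rw [Real.sqrt_eq_zero_of_nonpos h0, zero_sub, abs_neg, abs_of_pos hs,
          Real.mul_self_sqrt (ha q).le, abs_sub_comm, abs_of_nonneg (by linarith [ha q])]
        linarith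
    calc |Real.sqrt (a' q) - Real.sqrt (a q)|
        ≤ |Real.sqrt (a' q) - Real.sqrt (a q)| * (Real.sqrt B * Real.sqrt (a q)) :=
          le_mul_of_one_le_right (abs_nonneg _) hinv
      _ = (|Real.sqrt (a' q) - Real.sqrt (a q)| * Real.sqrt (a q)) * Real.sqrt B := by ring
      _ ≤ (C * ε q) * Real.sqrt B := 
          mul_le_mul_of_nonneg_right (key.trans e3) (Real.sqrt_nonneg _)
      _ = C * Real.sqrt B * ε q := by ring
      _ ≤ _ := by gcongr; exacts [hε q, le_max_right _ _]

end Near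

/-! ### Pointwise bounds for the coefficients of the curvature density. -/

section TensorBounds

variable {n : ℕ}

/-- The coefficient of `u ^ 2` in the density of `⟨R_g, u ^ 2⟩`, in terms of the matrices `G` and
`H` of the metric and of the background metric, the background Ricci tensor, the background
Christoffel symbols `Γ`, the derivatives `dH` of `H`, and `T = ∇̃ g`. -/
noncomputable def potTerm (G H Ric : Matrix (Fin n) (Fin n) ℝ)
    (Γ dH T : Fin n → Fin n → Fin n → ℝ) : ℝ :=
  scalF G Ric T * Real.sqrt (G.det / H.det)
    - ∑ k, vecV G T k * volRatioD G H
      (fun i j => T k i j + ∑ l, Γ l k i * G l j + ∑ l, Γ l k j * G i l) (dH k)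

/-- The coefficient of `- 2 u ∂ₖ u` in the density of `⟨R_g, u ^ 2⟩`. -/
noncomputable def fluxTerm (G H : Matrix (Fin n) (Fin n) ℝ)
    (T : Fin n → Fin n → Fin n → ℝ) (k : Fin n) : ℝ :=
  vecV G T k * Real.sqrt (G.det / H.det)

/-- Positive definite matrices whose entries, and those of their inverses, are at most `B`. -/
structure MatBound (B : ℝ) (G : Matrix (Fin n) (Fin n) ℝ) : Prop where
  posDef : G.PosDef
  entry : ∀ i j, |G i j| ≤ B
  inv_entry : ∀ i j, |G⁻¹ i j| ≤ B

variable {ι : Type*} {X ε : ι → ℝ}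

theorem IsNear.det (hX : ∀ q, 1 ≤ X q) (hε : ∀ q, 0 ≤ ε q)
    {G G' : ι → Matrix (Fin n) (Fin n) ℝ}
    (h : ∀ i j, IsNear X ε 0 (fun q => G q i j) (fun q => G' q i j)) :
    IsNear X ε 0 (fun q => (G q).det) (fun q => (G' q).det) := by
  simp only [Matrix.det_apply']
  refine IsNear.sum _ fun σ _ => ?_
  refine IsNear.mul (zero_add 0) hX (IsNear.of_bound (B := 1) hε fun q => ?_)
    (IsNear.prod hX hε _ fun i _ => h _ _)
  rcases Int.units_eq_one_or (Equiv.Perm.sign σ) with h | h <;> simp [h]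

/-- The reason is `G'⁻¹ - G⁻¹ = - G'⁻¹ (G' - G) G⁻¹`, in which both inverses are bounded by
assumption. -/
theorem IsNear.inv_entry (hX : ∀ q, 1 ≤ X q) (hε : ∀ q, 0 ≤ ε q)
    {G G' : ι → Matrix (Fin n) (Fin n) ℝ} {B : ℝ} (hG : ∀ q, MatBound B (G q))
    (hG' : ∀ q, MatBound B (G' q))
    (h : ∀ i j, IsNear X ε 0 (fun q => G q i j) (fun q => G' q i j)) (i j : Fin n) :
    IsNear X ε 0 (fun q => (G q)⁻¹ i j) (fun q => (G' q)⁻¹ i j) := by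
  have h1 : ∀ i j, IsNear X ε 0 (fun q => (G q)⁻¹ i j) (fun q => (G q)⁻¹ i j) := fun i j =>
    IsNear.of_bound hε fun q => (hG q).inv_entry i j
  have h2 : ∀ i j, IsNear X ε 0 (fun q => (G' q)⁻¹ i j) (fun q => (G' q)⁻¹ i j) := fun i j =>
    IsNear.of_bound hε fun q => (hG' q).inv_entry i j
  obtain ⟨C, hC, hd⟩ := IsNear.sum Finset.univ fun a _ =>
    IsNear.sum Finset.univ fun b _ =>
      ((h2 i a).mul (zero_add 0) hX (h a b)).mul (zero_add 0) hX (h1 b j)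
  refine ⟨|B| + C, by positivity, fun q => ?_⟩
  have hb1 := (hG q).inv_entry i j
  have hb2 := (hG' q).inv_entry i j
  have := le_abs_self B
  refine ⟨by simp only [pow_zero]; linarith, by simp only [pow_zero]; linarith, ?_⟩
  have key : (G' q)⁻¹ i j - (G q)⁻¹ i j
      = - (∑ a, ∑ b, (G' q)⁻¹ i a * G' q a b * (G q)⁻¹ b j
        - ∑ a, ∑ b, (G' q)⁻¹ i a * G q a b * (G q)⁻¹ b j) := by
    have u1 : IsUnit (G q).det := (hG q).posDef.isUnit.map Matrix.detMonoidHom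
    have u2 : IsUnit (G' q).det := (hG' q).posDef.isUnit.map Matrix.detMonoidHom
    have m1 : ((G' q)⁻¹ * G' q) * (G q)⁻¹ = (G q)⁻¹ := by
      rw [Matrix.nonsing_inv_mul _ u2, Matrix.one_mul]
    have m2 : (G' q)⁻¹ * (G q * (G q)⁻¹) = (G' q)⁻¹ := by
      rw [Matrix.mul_nonsing_inv _ u1, Matrix.mul_one]
    have s1 : ∑ a, ∑ b, (G' q)⁻¹ i a * G' q a b * (G q)⁻¹ b j = (G q)⁻¹ i j := by
      conv_rhs => rw [← m1]
      simp only [Matrix.mul_apply, Finset.sum_mul]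
      rw [Finset.sum_comm]
    have s2 : ∑ a, ∑ b, (G' q)⁻¹ i a * G q a b * (G q)⁻¹ b j = (G' q)⁻¹ i j := by
      conv_rhs => rw [← m2]
      simp only [Matrix.mul_apply, Finset.mul_sum, mul_assoc]
    rw [s1, s2]
    ring
  rw [key, abs_neg]
  refine (hd q).2.2.trans ?_
  have := hε q
  simp only [pow_zero, one_mul]
  gcongr
  linarith [abs_nonneg B]

/-- Division by `det H` is multiplication by `det H⁻¹`, a polynomial in bounded entries. The lower
bound on `det G / det H` required by the square root is an upper bound on `det H * det G⁻¹`. -/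
theorem IsNear.volRatio (hX : ∀ q, 1 ≤ X q) (hε : ∀ q, 0 ≤ ε q)
    {G G' H : ι → Matrix (Fin n) (Fin n) ℝ} {B : ℝ} (hG : ∀ q, MatBound B (G q))
    (hH : ∀ q, MatBound B (H q))
    (h : ∀ i j, IsNear X ε 0 (fun q => G q i j) (fun q => G' q i j)) :
    IsNear X ε 0 (fun q => Real.sqrt ((G q).det / (H q).det))
      (fun q => Real.sqrt ((G' q).det / (H q).det)) := by
  have hHinv : IsNear X ε 0 (fun q => ((H q)⁻¹).det) (fun q => ((H q)⁻¹).det) :=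
    IsNear.det hX hε fun i j => IsNear.of_bound hε fun q => (hH q).inv_entry i j
  have hHdet : IsNear X ε 0 (fun q => (H q).det) (fun q => (H q).det) :=
    IsNear.det hX hε fun i j => IsNear.of_bound hε fun q => (hH q).entry i j
  have hGinv : IsNear X ε 0 (fun q => ((G q)⁻¹).det) (fun q => ((G q)⁻¹).det) :=
    IsNear.det hX hε fun i j => IsNear.of_bound hε fun q => (hG q).inv_entry i j
  obtain ⟨C, hC, hb⟩ := hHdet.mul (zero_add 0) hX hGinv
  have hdiv : ∀ (A : ι → Matrix (Fin n) (Fin n) ℝ) q,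
      (A q).det * ((H q)⁻¹).det = (A q).det / (H q).det := fun A q => by
    rw [Matrix.det_nonsing_inv, Ring.inverse_eq_inv', div_eq_mul_inv]
  have key := (IsNear.det hX hε h).mul (zero_add 0) hX hHinv
  simp_rw [hdiv G, hdiv G'] at key
  refine key.sqrt hε (B := C) (fun q => div_pos (hG q).posDef.det_pos (hH q).posDef.det_pos)
    fun q => ?_
  have := (hb q).1
  beta_reduce at this
  rw [Matrix.det_nonsing_inv, Ring.inverse_eq_inv', ← div_eq_mul_inv, pow_zero, mul_one] at this
  rw [inv_div]
  exact (le_abs_self _).trans this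

/-- The degree counts factors of `T`: the difference tensor `Γ`, `∇̃g⁻¹`, `V` and the derivative of
the volume ratio have degree one, `F` has degree two, and inverses, volume ratio and background data
have degree zero. Terms of lower degree are raised to the common one, which is allowed as `X ≥ 1`.
-/
theorem isNear_potTerm_and_fluxTerm (hX : ∀ q, 1 ≤ X q) (hε : ∀ q, 0 ≤ ε q)
    {G G' H Ric : ι → Matrix (Fin n) (Fin n) ℝ}
    {Γ dH T T' : ι → Fin n → Fin n → Fin n → ℝ} {B : ℝ}
    (hG : ∀ q, MatBound B (G q)) (hG' : ∀ q, MatBound B (G' q)) (hH : ∀ q, MatBound B (H q))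
    (hRic : ∀ q i j, |Ric q i j| ≤ B) (hΓ : ∀ q k i j, |Γ q k i j| ≤ B)
    (hdH : ∀ q k i j, |dH q k i j| ≤ B)
    (h : ∀ i j, IsNear X ε 0 (fun q => G q i j) (fun q => G' q i j))
    (hT : ∀ k i j, IsNear X ε 1 (fun q => T q k i j) (fun q => T' q k i j)) :
    IsNear X ε 2 (fun q => potTerm (G q) (H q) (Ric q) (Γ q) (dH q) (T q))
        (fun q => potTerm (G' q) (H q) (Ric q) (Γ q) (dH q) (T' q)) ∧
      ∀ k, IsNear X ε 1 (fun q => fluxTerm (G q) (H q) (T q) k)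
        (fun q => fluxTerm (G' q) (H q) (T' q) k) := by
  have hinv := IsNear.inv_entry hX hε hG hG' h
  have hHinv : ∀ i j, IsNear X ε 0 (fun q => (H q)⁻¹ i j) (fun q => (H q)⁻¹ i j) := fun i j =>
    IsNear.of_bound hε fun q => (hH q).inv_entry i j
  have hρ := IsNear.volRatio hX hε hG hH h
  have nΓ : ∀ k i j, IsNear X ε 0 (fun q => Γ q k i j) (fun q => Γ q k i j) := fun k i j =>
    IsNear.of_bound hε fun q => hΓ q k i j
  have ndH : ∀ k i j, IsNear X ε 0 (fun q => dH q k i j) (fun q => dH q k i j) := fun k i j =>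
    IsNear.of_bound hε fun q => hdH q k i j
  have nRic : ∀ i j, IsNear X ε 0 (fun q => Ric q i j) (fun q => Ric q i j) := fun i j =>
    IsNear.of_bound hε fun q => hRic q i j
  have nc : ∀ c : ℝ, IsNear X ε 0 (fun _ => c) (fun _ => c) := fun c =>
    IsNear.of_bound hε fun _ => le_rfl
  have hgam : ∀ k i j, IsNear X ε 1 (fun q => gammaTensor (G q) (T q) k i j)
      (fun q => gammaTensor (G' q) (T' q) k i j) := fun k i j =>
    (nc _).mul (zero_add 1) hX (IsNear.sum _ fun l _ =>
      (hinv k l).mul (zero_add 1) hX (((hT i j l).add (hT j i l)).sub (hT l i j)))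
  have hnab : ∀ k i j, IsNear X ε 1 (fun q => nablaInv (G q) (T q) k i j)
      (fun q => nablaInv (G' q) (T' q) k i j) := fun k i j =>
    (IsNear.sum _ fun a _ => IsNear.sum _ fun b _ =>
      ((hinv i a).mul (zero_add 0) hX (hinv j b)).mul (zero_add 1) hX (hT k a b)).neg
  have hV : ∀ k, IsNear X ε 1 (fun q => vecV (G q) (T q) k)
      (fun q => vecV (G' q) (T' q) k) := fun k =>
    IsNear.sum _ fun i _ => IsNear.sum _ fun j _ =>
      ((hinv i j).mul (zero_add 1) hX (hgam k i j)).sub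
        ((hinv i k).mul (zero_add 1) hX (hgam j j i))
  have hF : IsNear X ε 2 (fun q => scalF (G q) (Ric q) (T q))
      (fun q => scalF (G' q) (Ric q) (T' q)) := by
    refine IsNear.add (IsNear.add (IsNear.sub ?_ ?_) ?_) ?_
    · exact IsNear.mono hX hε (Nat.zero_le 2) (IsNear.sum _ fun i _ =>
        IsNear.sum _ fun j _ => (hinv i j).mul (zero_add 0) hX (nRic i j))
    · exact IsNear.sum _ fun k _ => IsNear.sum _ fun i _ =>
        IsNear.sum _ fun j _ => (hnab k i j).mul (one_add_one_eq_two) hX (hgam k i j)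
    · exact IsNear.sum _ fun k _ => IsNear.sum _ fun i _ =>
        IsNear.sum _ fun j _ => (hnab k i k).mul (one_add_one_eq_two) hX (hgam j j i)
    · exact IsNear.sum _ fun i _ => IsNear.sum _ fun j _ =>
        (hinv i j).mul (zero_add 2) hX (IsNear.sum _ fun k _ =>
          IsNear.sum _ fun l _ =>
            ((hgam k k l).mul one_add_one_eq_two hX (hgam l i j)).sub
              ((hgam k j l).mul one_add_one_eq_two hX (hgam l i k)))
  have hvd : ∀ k, IsNear X ε 1
      (fun q => volRatioD (G q) (H q) (fun i j => T q k i j + ∑ l, Γ q l k i * G q l j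
        + ∑ l, Γ q l k j * G q i l) (dH q k))
      (fun q => volRatioD (G' q) (H q) (fun i j => T' q k i j + ∑ l, Γ q l k i * G' q l j
        + ∑ l, Γ q l k j * G' q i l) (dH q k)) := fun k => by
    refine IsNear.mul (zero_add 1) hX ((nc _).mul (zero_add 0) hX hρ) (IsNear.sub ?_ ?_)
    · refine IsNear.sum _ fun i _ => IsNear.sum _ fun j _ =>
        (hinv j i).mul (zero_add 1) hX (((hT k i j).add ?_).add ?_)
      · exact IsNear.mono hX hε zero_le_one (IsNear.sum _ fun l _ =>
          (nΓ l k i).mul (zero_add 0) hX (h l j))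
      · exact IsNear.mono hX hε zero_le_one (IsNear.sum _ fun l _ =>
          (nΓ l k j).mul (zero_add 0) hX (h i l))
    · exact IsNear.mono hX hε zero_le_one (IsNear.sum _ fun i _ =>
        IsNear.sum _ fun j _ => (hHinv j i).mul (zero_add 0) hX (ndH k i j))
  exact ⟨(hF.mul (add_zero 2) hX hρ).sub (IsNear.sum _ fun k _ =>
    (hV k).mul one_add_one_eq_two hX (hvd k)), fun k => (hV k).mul (add_zero 1) hX hρ⟩

/-- Two metrics at a point, with the data of the background metric, and bounds for the distance
of the metrics and of their covariant derivatives. -/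
structure JetPair (n : ℕ) where
  /-- The first metric. -/
  G : Matrix (Fin n) (Fin n) ℝ
  /-- The second metric. -/
  G' : Matrix (Fin n) (Fin n) ℝ
  /-- The background metric. -/
  H : Matrix (Fin n) (Fin n) ℝ
  /-- The background Ricci tensor. -/
  Ric : Matrix (Fin n) (Fin n) ℝ
  /-- The background Christoffel symbols. -/
  Γ : Fin n → Fin n → Fin n → ℝ
  /-- The derivatives of the background metric. -/
  dH : Fin n → Fin n → Fin n → ℝ
  /-- The covariant derivative of the first metric. -/
  T : Fin n → Fin n → Fin n → ℝ
  /-- The covariant derivative of the second metric. -/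
  T' : Fin n → Fin n → Fin n → ℝ
  /-- The distance of the metrics. -/
  t : ℝ
  /-- The distance of the covariant derivatives. -/
  D : ℝ

/-- The sum of the absolute values of the components. -/
noncomputable def absSum (T : Fin n → Fin n → Fin n → ℝ) : ℝ := ∑ k, ∑ i, ∑ j, |T k i j|

theorem abs_le_absSum (T : Fin n → Fin n → Fin n → ℝ) (k i j : Fin n) :
    |T k i j| ≤ absSum T := by
  have h1 : |T k i j| ≤ ∑ j, |T k i j| :=
    Finset.single_le_sum (f := fun j => |T k i j|) (fun _ _ => abs_nonneg _) (Finset.mem_univ j)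
  have h2 : ∑ j, |T k i j| ≤ ∑ i, ∑ j, |T k i j| :=
    Finset.single_le_sum (f := fun i => ∑ j, |T k i j|)
      (fun _ _ => Finset.sum_nonneg fun _ _ => abs_nonneg _) (Finset.mem_univ i)
  have h3 : ∑ i, ∑ j, |T k i j| ≤ absSum T :=
    Finset.single_le_sum (f := fun k => ∑ i, ∑ j, |T k i j|)
      (fun _ _ => Finset.sum_nonneg fun _ _ => Finset.sum_nonneg fun _ _ => abs_nonneg _)
      (Finset.mem_univ k)
  linarith

theorem absSum_nonneg (T : Fin n → Fin n → Fin n → ℝ) : 0 ≤ absSum T :=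
  Finset.sum_nonneg fun _ _ => Finset.sum_nonneg fun _ _ => Finset.sum_nonneg fun _ _ =>
    abs_nonneg _

/-- The bounds under which the terms of the scalar curvature density are controlled. -/
structure JetPair.Bounded (B : ℝ) (q : JetPair n) : Prop where
  G : MatBound B q.G
  G' : MatBound B q.G'
  H : MatBound B q.H
  Ric : ∀ i j, |q.Ric i j| ≤ B
  Γ : ∀ k i j, |q.Γ k i j| ≤ B
  dH : ∀ k i j, |q.dH k i j| ≤ B
  t : 0 ≤ q.t
  D : 0 ≤ q.D
  dist_G : ∀ i j, |q.G' i j - q.G i j| ≤ q.t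
  dist_T : ∀ k i j, |q.T' k i j - q.T k i j| ≤ q.D

/-- The calculus of `IsNear` is run with the set of all bounded jets as parameter space, so that the
constant obtained is uniform over them. -/
theorem exists_potTerm_fluxTerm_bound (n : ℕ) (B : ℝ) : ∃ C, 0 ≤ C ∧
    ∀ q : JetPair n, q.Bounded B →
      |potTerm q.G q.H q.Ric q.Γ q.dH q.T| ≤ C * (1 + absSum q.T + q.D) ^ 2 ∧
      |potTerm q.G' q.H q.Ric q.Γ q.dH q.T' - potTerm q.G q.H q.Ric q.Γ q.dH q.T|
        ≤ C * ((1 + absSum q.T + q.D) * (q.t * (1 + absSum q.T + q.D) + q.D)) ∧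
      ∀ k, |fluxTerm q.G q.H q.T k| ≤ C * (1 + absSum q.T + q.D) ∧
        |fluxTerm q.G' q.H q.T' k - fluxTerm q.G q.H q.T k|
          ≤ C * (q.t * (1 + absSum q.T + q.D) + q.D) := by
  let ι := {q : JetPair n // q.Bounded B}
  let X : ι → ℝ := fun q => 1 + absSum q.1.T + q.1.D
  -- Normalised so that `X ε = t X + D`: then `G` varies by at most `ε` in degree zero and `T` by at
  -- most `X ε` in degree one, as `IsNear` demands.
  let ε : ι → ℝ := fun q => q.1.t + q.1.D / X q
  have hX : ∀ q, 1 ≤ X q := fun q => by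
    have := absSum_nonneg q.1.T
    have := q.2.D
    simp only [X]; linarith
  have hX0 : ∀ q, 0 < X q := fun q => zero_lt_one.trans_le (hX q)
  have hε : ∀ q, 0 ≤ ε q := fun q => add_nonneg q.2.t (div_nonneg q.2.D (hX0 q).le)
  have hDX : ∀ q : ι, q.1.D / X q ≤ ε q := fun q => le_add_of_nonneg_left q.2.t
  have htX : ∀ q : ι, q.1.t ≤ ε q := fun q =>
    le_add_of_nonneg_right (div_nonneg q.2.D (hX0 q).le)
  have hG : ∀ i j, IsNear X ε 0 (fun q : ι => q.1.G i j) (fun q => q.1.G' i j) := fun i j => by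
    refine ⟨|B| + 1, by positivity, fun q => ?_⟩
    have := le_abs_self B
    have h1 := q.2.G.entry i j
    have h2 := q.2.G'.entry i j
    have h3 := (q.2.dist_G i j).trans (htX q)
    have h4 : ε q ≤ (|B| + 1) * ε q := le_mul_of_one_le_left (hε q) (by linarith [abs_nonneg B])
    simp only [pow_zero, mul_one, one_mul]
    exact ⟨by linarith, by linarith, by linarith⟩
  have hT : ∀ k i j, IsNear X ε 1 (fun q : ι => q.1.T k i j) (fun q => q.1.T' k i j) :=
    fun k i j => by
      refine ⟨1, zero_le_one, fun q => ?_⟩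
      have h1 := abs_le_absSum q.1.T k i j
      have h2 := q.2.dist_T k i j
      have h3 := q.2.D
      have h4 : q.1.D ≤ X q * ε q := by
        calc q.1.D = X q * (q.1.D / X q) := by field_simp [(hX0 q).ne']
          _ ≤ X q * ε q := by gcongr; exacts [(hX0 q).le, hDX q]
      have h5 : |q.1.T' k i j| ≤ |q.1.T k i j| + |q.1.T' k i j - q.1.T k i j| := by
        have := abs_add_le (q.1.T k i j) (q.1.T' k i j - q.1.T k i j)
        rwa [add_sub_cancel] at this
      have h6 : X q = 1 + absSum q.1.T + q.1.D := rfl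
      simp only [pow_one, one_mul]
      exact ⟨by linarith, by linarith, by linarith⟩
  obtain ⟨⟨C, hC, h1⟩, h2⟩ := isNear_potTerm_and_fluxTerm (n := n) hX hε
    (fun q : ι => q.2.G) (fun q => q.2.G') (fun q => q.2.H) (fun q => q.2.Ric) (fun q => q.2.Γ)
    (fun q => q.2.dH) hG hT
  choose D hD h2 using h2
  refine ⟨C + ∑ k, D k, add_nonneg hC (Finset.sum_nonneg fun k _ => hD k), fun q hq => ?_⟩
  have hCle : C ≤ C + ∑ k, D k :=
    le_add_of_nonneg_right (Finset.sum_nonneg fun k _ => hD k)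
  have hDle : ∀ k, D k ≤ C + ∑ k, D k := fun k =>
    (Finset.single_le_sum (fun k _ => hD k) (Finset.mem_univ k)).trans
      (le_add_of_nonneg_left hC)
  have hx0 : 0 < 1 + absSum q.T + q.D := hX0 ⟨q, hq⟩
  have hXε : (1 + absSum q.T + q.D) * (q.t + q.D / (1 + absSum q.T + q.D))
      = q.t * (1 + absSum q.T + q.D) + q.D := by field_simp
  have hE : 0 ≤ q.t * (1 + absSum q.T + q.D) + q.D :=
    add_nonneg (mul_nonneg hq.t hx0.le) hq.D
  obtain ⟨a1, -, a3⟩ := h1 ⟨q, hq⟩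
  simp only [X, ε] at a1 a3
  rw [pow_two, mul_assoc, hXε] at a3
  refine ⟨a1.trans (by gcongr), a3.trans (by gcongr), fun k => ?_⟩
  obtain ⟨b1, -, b3⟩ := h2 k ⟨q, hq⟩
  simp only [X, ε, pow_one] at b1 b3
  rw [hXε] at b3
  exact ⟨b1.trans (by gcongr; exact hDle k), b3.trans (by gcongr; exact hDle k)⟩

end TensorBounds

/-! ### Bounds for positive definite matrices and for tensor norms. -/

section QuadraticForms

open scoped Kronecker
open Matrix (of)

variable {κ : Type*} [Fintype κ] [DecidableEq κ] {n : ℕ}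

/-- The quadratic form of a matrix. -/
def quadForm (P : Matrix κ κ ℝ) (v : κ → ℝ) : ℝ := ∑ i, ∑ j, P i j * v i * v j

omit [DecidableEq κ] in
theorem quadForm_eq_dotProduct (P : Matrix κ κ ℝ) (v : κ → ℝ) :
    quadForm P v = v ⬝ᵥ P.mulVec v := by
  simp only [quadForm, dotProduct, Matrix.mulVec, Finset.mul_sum]
  exact Finset.sum_congr rfl fun i _ => Finset.sum_congr rfl fun j _ => by ring

omit [DecidableEq κ] in
theorem posDef_of_quadForm_pos {P : Matrix κ κ ℝ} (hs : ∀ i j, P i j = P j i)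
    (hp : ∀ v, v ≠ 0 → 0 < quadForm P v) : P.PosDef := by
  refine Matrix.PosDef.of_dotProduct_mulVec_pos (Matrix.IsHermitian.ext fun i j => ?_)
    fun v hv => ?_
  · simp [hs j i]
  · simpa [quadForm_eq_dotProduct] using hp v hv

omit [DecidableEq κ] in
theorem quadForm_nonneg {P : Matrix κ κ ℝ} (hP : P.PosDef) (v : κ → ℝ) : 0 ≤ quadForm P v := by
  simpa [quadForm_eq_dotProduct] using hP.posSemidef.dotProduct_mulVec_nonneg v

theorem quadForm_inv_single {P : Matrix κ κ ℝ} (hP : P.PosDef) (i : κ) :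
    quadForm P (P⁻¹.mulVec (Pi.single i 1)) = P⁻¹ i i := by
  have u : IsUnit P.det := hP.isUnit.map Matrix.detMonoidHom
  rw [quadForm_eq_dotProduct, Matrix.mulVec_mulVec, Matrix.mul_nonsing_inv _ u, Matrix.one_mulVec]
  simp

/-- Cauchy–Schwarz for the quadratic form of `P` and a dual basis vector. -/
theorem sq_le_inv_mul_quadForm {P : Matrix κ κ ℝ} (hP : P.PosDef) (v : κ → ℝ) (i : κ) :
    v i ^ 2 ≤ P⁻¹ i i * quadForm P v := by
  have u : IsUnit P.det := hP.isUnit.map Matrix.detMonoidHom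
  set w := P⁻¹.mulVec (Pi.single i 1) with hw
  have hPw : P.mulVec w = Pi.single i 1 := by
    rw [hw, Matrix.mulVec_mulVec, Matrix.mul_nonsing_inv _ u, Matrix.one_mulVec]
  have hwi : w ⬝ᵥ P.mulVec w = P⁻¹ i i := by
    rw [← quadForm_eq_dotProduct, quadForm_inv_single hP]
  have hsymm : w ⬝ᵥ P.mulVec v = v i := by
    have hT : P.transpose = P := by simpa using hP.isHermitian.eq
    rw [Matrix.dotProduct_mulVec, ← Matrix.mulVec_transpose, hT, hPw]
    simp
  have hvw : v ⬝ᵥ P.mulVec w = v i := by rw [hPw]; simp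
  have hpos : 0 < P⁻¹ i i := hP.inv.diag_pos
  -- This `s` minimises the quadratic form at `v - s w`; nonnegativity at the minimum is the
  -- inequality sought.
  set s := v i / P⁻¹ i i with hs
  have h0 := quadForm_nonneg hP (v - s • w)
  rw [quadForm_eq_dotProduct] at h0
  simp only [Matrix.mulVec_sub, Matrix.mulVec_smul, sub_dotProduct, dotProduct_sub,
    smul_dotProduct, dotProduct_smul, smul_eq_mul, hwi, hsymm, hvw] at h0
  rw [← quadForm_eq_dotProduct] at h0
  have hsv : s * P⁻¹ i i = v i := by rw [hs]; field_simp
  rw [hsv] at h0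
  have : s * v i ≤ quadForm P v := by linarith
  calc v i ^ 2 = P⁻¹ i i * (s * v i) := by rw [← hsv]; ring
    _ ≤ _ := by gcongr

/-- At the `j`-th column of `P⁻¹` the quadratic form of `P` equals `P⁻¹ j j`, so coercivity bounds
every square in that column by `c * P⁻¹ j j`. The diagonal entry first gives `P⁻¹ j j ≤ c`, and then
the others follow. -/
theorem abs_inv_entry_le {P : Matrix κ κ ℝ} (hP : P.PosDef) {c : ℝ}
    (hc : ∀ v, ∑ i, v i ^ 2 ≤ c * quadForm P v) (i j : κ) : |P⁻¹ i j| ≤ c := by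
  have hpos : 0 < P⁻¹ j j := hP.inv.diag_pos
  have h := hc (P⁻¹.mulVec (Pi.single j 1))
  rw [quadForm_inv_single hP] at h
  simp only [Matrix.mulVec_single_one, Matrix.col_apply] at h
  have h1 : ∀ a, P⁻¹ a j ^ 2 ≤ c * P⁻¹ j j := fun a =>
    (Finset.single_le_sum (f := fun a => P⁻¹ a j ^ 2) (fun _ _ => sq_nonneg _)
      (Finset.mem_univ a)).trans h
  have h2 : P⁻¹ j j ≤ c := by
    have := h1 j
    rw [pow_two] at this
    exact le_of_mul_le_mul_right this hpos
  have hc0 : 0 ≤ c := hpos.le.trans h2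
  refine abs_le_of_sq_le_sq ((h1 i).trans ?_) hc0
  rw [pow_two]
  gcongr

/-- Positivity at `eᵢ + eⱼ` and `eᵢ - eⱼ` gives `2 |P i j| ≤ P i i + P j j`. -/
theorem abs_entry_le_of_diag_le {P : Matrix κ κ ℝ} (hP : P.PosDef) {c : ℝ}
    (hc : ∀ i, P i i ≤ c) (i j : κ) : |P i j| ≤ c := by
  have hs : P j i = P i j := by simpa using congrFun (congrFun hP.isHermitian.eq i) j
  have key : ∀ s : ℝ, s ^ 2 = 1 → - (2 * s * P i j) ≤ P i i + P j j := by
    intro s hs2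
    have h0 := quadForm_nonneg hP (Pi.single i 1 + s • Pi.single j 1)
    rw [quadForm_eq_dotProduct] at h0
    simp only [Matrix.mulVec_add, Matrix.mulVec_smul, add_dotProduct, dotProduct_add,
      smul_dotProduct, dotProduct_smul, smul_eq_mul, Matrix.mulVec_single_one,
      single_one_dotProduct, Matrix.col_apply, hs] at h0
    have e : s * (P i j + s * P j j) = s * P i j + s ^ 2 * P j j := by ring
    rw [e, hs2] at h0
    linarith
  have h1 := key 1 (by norm_num)
  have h2 := key (-1) (by norm_num)
  have h3 := hc i
  have h4 := hc j
  rw [abs_le]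
  constructor <;> linarith

theorem quadForm_single (P : Matrix κ κ ℝ) (i : κ) : quadForm P (Pi.single i 1) = P i i := by
  rw [quadForm_eq_dotProduct]
  simp

/-- Coercivity with an explicit constant, by summing Cauchy–Schwarz over the coordinates. -/
theorem MatBound.sum_sq_le {B : ℝ} {H : Matrix (Fin n) (Fin n) ℝ} (hH : MatBound B H)
    (v : Fin n → ℝ) : ∑ i, v i ^ 2 ≤ n * B * quadForm H v := by
  have h0 := quadForm_nonneg hH.posDef v
  calc ∑ i, v i ^ 2 ≤ ∑ _i : Fin n, B * quadForm H v := by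
        refine Finset.sum_le_sum fun i _ => (sq_le_inv_mul_quadForm hH.posDef v i).trans ?_
        gcongr
        exact (le_abs_self _).trans (hH.inv_entry i i)
    _ = n * B * quadForm H v := by simp [mul_assoc]

/-- Matrices comparable to a bounded one are bounded. -/
theorem MatBound.of_comparable {B Λ : ℝ} {H G : Matrix (Fin n) (Fin n) ℝ} (hn : 0 < n)
    (hH : MatBound B H) (hG : G.PosDef)
    (h : ∀ v, Λ⁻¹ * quadForm H v ≤ quadForm G v ∧ quadForm G v ≤ Λ * quadForm H v) :
    MatBound (max (Λ * B) (n * B * Λ)) G := by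
  -- The sign of `Λ` is not assumed; it follows from `0 < G i i ≤ Λ H i i`.
  have hΛ : 0 < Λ := by
    have i : Fin n := ⟨0, hn⟩
    have h1 := (h (Pi.single i 1)).2
    rw [quadForm_single, quadForm_single] at h1
    exact pos_of_mul_pos_left (hG.diag_pos.trans_le h1) hH.posDef.diag_pos.le
  have hB : 0 ≤ B := (abs_nonneg _).trans (hH.entry ⟨0, hn⟩ ⟨0, hn⟩)
  refine ⟨hG, fun i j => (abs_entry_le_of_diag_le hG (c := Λ * B) (fun i => ?_) i j).trans
    (le_max_left _ _), fun i j => (abs_inv_entry_le hG (c := n * B * Λ) (fun v => ?_) i j).trans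
    (le_max_right _ _)⟩
  · have h1 := (h (Pi.single i 1)).2
    rw [quadForm_single, quadForm_single] at h1
    refine h1.trans ?_
    gcongr
    exact (le_abs_self _).trans (hH.entry i i)
  · refine (hH.sum_sq_le v).trans ?_
    rw [mul_assoc (n * B : ℝ)]
    gcongr
    have h1 := (h v).1
    rwa [inv_mul_le_iff₀ hΛ] at h1

/-- Positive definite matrices close to a bounded one are bounded. -/
theorem MatBound.of_close {B s : ℝ} {G G' : Matrix (Fin n) (Fin n) ℝ} (hB : 0 ≤ B)
    (hG : MatBound B G) (hG' : G'.PosDef) (hs : n * B * (s * n) ≤ 1 / 2)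
    (h : ∀ i j, |G' i j - G i j| ≤ s) :
    MatBound (max (B + s) (2 * n * B)) G' := by
  refine ⟨hG', fun i j => ?_, fun i j => (abs_inv_entry_le hG' (c := 2 * n * B) (fun v => ?_)
    i j).trans (le_max_right _ _)⟩
  · have h1 := hG.entry i j
    have h2 := h i j
    have h3 : |G' i j| ≤ |G i j| + |G' i j - G i j| := by
      have := abs_add_le (G i j) (G' i j - G i j)
      rwa [add_sub_cancel] at this
    exact (by linarith : |G' i j| ≤ B + s).trans (le_max_left _ _)
  · have h1 := hG.sum_sq_le v
    set N := ∑ i, v i ^ 2 with hN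
    have hN0 : 0 ≤ N := Finset.sum_nonneg fun _ _ => sq_nonneg _
    rcases Nat.eq_zero_or_pos n with rfl | hn
    · simp [hN]
    have hs0 : 0 ≤ s := (abs_nonneg _).trans (h ⟨0, hn⟩ ⟨0, hn⟩)
    have h2 : quadForm G v - quadForm G' v ≤ s * n * N := by
      have e : quadForm G v - quadForm G' v = ∑ i, ∑ j, (G i j - G' i j) * v i * v j := by
        simp only [quadForm, ← Finset.sum_sub_distrib]
        exact Finset.sum_congr rfl fun i _ => Finset.sum_congr rfl fun j _ => by ring
      have e2 : (∑ i, |v i|) ^ 2 ≤ n * N := by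
        have := sq_sum_le_card_mul_sum_sq (s := Finset.univ) (f := fun i => |v i|)
        simpa [hN] using this
      calc quadForm G v - quadForm G' v ≤ ∑ i, ∑ j, s * |v i| * |v j| := by
            rw [e]
            refine Finset.sum_le_sum fun i _ => Finset.sum_le_sum fun j _ => ?_
            refine (le_abs_self _).trans ?_
            rw [abs_mul, abs_mul, abs_sub_comm]
            gcongr
            exact h i j
        _ = s * (∑ i, |v i|) ^ 2 := by
            rw [pow_two, Finset.sum_mul_sum, Finset.mul_sum]
            refine Finset.sum_congr rfl fun i _ => ?_
            rw [Finset.mul_sum]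
            exact Finset.sum_congr rfl fun j _ => by ring
        _ ≤ s * (n * N) := by gcongr
        _ = s * n * N := by ring
    -- The smallness of `s` makes the last term at most `N / 2`, which is absorbed on the left; this
    -- doubles the coercivity constant to `2 n B`.
    have h3 : N ≤ n * B * quadForm G' v + (n * B * (s * n)) * N := by
      calc N ≤ n * B * quadForm G v := h1
        _ ≤ n * B * (quadForm G' v + s * n * N) := by gcongr; linarith
        _ = _ := by ring
    have h4 : (n * B * (s * n)) * N ≤ 1 / 2 * N := by gcongr
    linarith

/-- Components of a `2`-tensor are bounded by its norm. -/
theorem abs_le_norm2 {B : ℝ} {H : Matrix (Fin n) (Fin n) ℝ} (hH : MatBound B H)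
    (S : Fin n → Fin n → ℝ) (i j : Fin n) : |S i j| ≤ B * norm2 H S := by
  have hB : 0 ≤ B := (abs_nonneg _).trans (hH.entry i i)
  -- The squared norm is the quadratic form of `H⁻¹ ⊗ H⁻¹`, and Cauchy–Schwarz involves the diagonal
  -- of its inverse `H ⊗ H`.
  have hP : (H⁻¹ ⊗ₖ H⁻¹).PosDef := hH.posDef.inv.kronecker hH.posDef.inv
  have u : IsUnit H.det := hH.posDef.isUnit.map Matrix.detMonoidHom
  have h1 := sq_le_inv_mul_quadForm hP (fun a => S a.1 a.2) (i, j)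
  have hq : quadForm (H⁻¹ ⊗ₖ H⁻¹) (fun a => S a.1 a.2)
      = ∑ i, ∑ j, ∑ a, ∑ b, H⁻¹ i a * H⁻¹ j b * S i j * S a b := by
    simp only [quadForm, Fintype.sum_prod_type, Matrix.kroneckerMap_apply]
  have h0 := quadForm_nonneg hP (fun a => S a.1 a.2)
  rw [Matrix.inv_kronecker, Matrix.nonsing_inv_nonsing_inv _ u, Matrix.kroneckerMap_apply] at h1
  have hd : ∀ a, H a a ≤ B := fun a => (le_abs_self _).trans (hH.entry a a)
  have hd0 : ∀ a, 0 ≤ H a a := fun a => hH.posDef.diag_pos.le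
  refine abs_le_of_sq_le_sq ?_ (mul_nonneg hB (Real.sqrt_nonneg _))
  rw [mul_pow, norm2, Real.sq_sqrt (hq ▸ h0), ← hq]
  refine h1.trans ?_
  rw [pow_two]
  exact mul_le_mul_of_nonneg_right (mul_le_mul (hd i) (hd j) (hd0 j) hB) h0

/-- Components of a `3`-tensor are bounded by its norm. -/
theorem abs_le_norm3 {B : ℝ} {H : Matrix (Fin n) (Fin n) ℝ} (hH : MatBound B H) (hB1 : 1 ≤ B)
    (T : Fin n → Fin n → Fin n → ℝ) (k i j : Fin n) : |T k i j| ≤ B ^ 2 * norm3 H T := by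
  have hB : 0 ≤ B := zero_le_one.trans hB1
  have hP : (H⁻¹ ⊗ₖ (H⁻¹ ⊗ₖ H⁻¹)).PosDef :=
    hH.posDef.inv.kronecker (hH.posDef.inv.kronecker hH.posDef.inv)
  have u : IsUnit H.det := hH.posDef.isUnit.map Matrix.detMonoidHom
  have h1 := sq_le_inv_mul_quadForm hP (fun a => T a.1 a.2.1 a.2.2) (k, i, j)
  have hq : quadForm (H⁻¹ ⊗ₖ (H⁻¹ ⊗ₖ H⁻¹)) (fun a => T a.1 a.2.1 a.2.2)
      = ∑ k, ∑ i, ∑ j, ∑ c, ∑ a, ∑ b,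
        H⁻¹ k c * H⁻¹ i a * H⁻¹ j b * T k i j * T c a b := by
    simp only [quadForm, Fintype.sum_prod_type, Matrix.kroneckerMap_apply, mul_assoc]
  have h0 := quadForm_nonneg hP (fun a => T a.1 a.2.1 a.2.2)
  rw [Matrix.inv_kronecker, Matrix.inv_kronecker, Matrix.nonsing_inv_nonsing_inv _ u,
    Matrix.kroneckerMap_apply, Matrix.kroneckerMap_apply] at h1
  have hd : ∀ a, H a a ≤ B := fun a => (le_abs_self _).trans (hH.entry a a)
  have hd0 : ∀ a, 0 ≤ H a a := fun a => hH.posDef.diag_pos.le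
  refine abs_le_of_sq_le_sq ?_ (mul_nonneg (by positivity) (Real.sqrt_nonneg _))
  rw [mul_pow, norm3, Real.sq_sqrt (hq ▸ h0), ← hq]
  refine h1.trans (mul_le_mul_of_nonneg_right ?_ h0)
  calc H k k * (H i i * H j j) ≤ B * (B * B) :=
        mul_le_mul (hd k) (mul_le_mul (hd i) (hd j) (hd0 j) hB) (mul_nonneg (hd0 i) (hd0 j)) hB
    _ = B ^ 3 := by ring
    -- Raised to an even power, using `1 ≤ B`, so that the square root is again a power of `B`.
    _ ≤ B ^ 4 := pow_le_pow_right₀ hB1 (by norm_num)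
    _ = (B ^ 2) ^ 2 := by ring

end QuadraticForms

/-! ### Integration on the manifold through countably many chart pieces. -/

section ManifoldIntegration

variable {n : ℕ} {M : Type*} [TopologicalSpace M] [ChartedSpace (Rn n) M]
  [T2Space M] [SecondCountableTopology M] [MeasurableSpace M] [BorelSpace M]

theorem countable_range_chartCentre : (range (chartCentre n (M := M))).Countable :=
  (exists_chartCentre n M).choose_spec.1

theorem measurableSet_chartCentre_preimage (p : M) :
    MeasurableSet (chartCentre n ⁻¹' {p} : Set M) :=
  (exists_chartCentre n M).choose_spec.2.1 p

theorem chartCentre_preimage_subset (p : M) :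
    ∃ C : Set M, IsCompact C ∧ chartCentre n ⁻¹' {p} ⊆ C ∧ C ⊆ (chartAt (Rn n) p).source :=
  (exists_chartCentre n M).choose_spec.2.2.1 p

theorem finite_chartCentre_image {K : Set M} (hK : IsCompact K) : (chartCentre n '' K).Finite :=
  (exists_chartCentre n M).choose_spec.2.2.2 K hK

/-- A compact subset of the target of the chart at `p` which contains the coordinates of the points
with centre `p`. -/
noncomputable def chartPiece (n : ℕ) {M : Type*} [TopologicalSpace M] [ChartedSpace (Rn n) M]
    [T2Space M] [SecondCountableTopology M] [MeasurableSpace M] [BorelSpace M] (p : M) :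
    Set (Rn n) :=
  chartAt (Rn n) p '' (chartCentre_preimage_subset (n := n) p).choose

theorem isCompact_chartPiece (p : M) : IsCompact (chartPiece n p) := by
  obtain ⟨h1, -, h3⟩ := (chartCentre_preimage_subset (n := n) p).choose_spec
  exact h1.image_of_continuousOn ((chartAt (Rn n) p).continuousOn.mono h3)

theorem chartPiece_subset (p : M) : chartPiece n p ⊆ (chartAt (Rn n) p).target := by
  obtain ⟨-, -, h3⟩ := (chartCentre_preimage_subset (n := n) p).choose_spec
  rintro _ ⟨x, hx, rfl⟩
  exact (chartAt (Rn n) p).map_source (h3 hx)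

theorem mem_source_of_chartCentre_eq {p x : M} (hx : chartCentre n x = p) :
    x ∈ (chartAt (Rn n) p).source := by
  obtain ⟨-, h2, h3⟩ := (chartCentre_preimage_subset (n := n) p).choose_spec
  exact h3 (h2 hx)

theorem mem_chartPiece {p x : M} (hx : chartCentre n x = p) :
    chartAt (Rn n) p x ∈ chartPiece n p := by
  obtain ⟨-, h2, -⟩ := (chartCentre_preimage_subset (n := n) p).choose_spec
  exact mem_image_of_mem _ (h2 hx)

theorem mem_refChart_source (x : M) : x ∈ (refChart n x).source :=
  mem_source_of_chartCentre_eq rfl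

theorem refChart_mem_target (x : M) : refChart n x x ∈ (refChart n x).target :=
  (refChart n x).map_source (mem_refChart_source x)

theorem refChart_symm_apply (x : M) : (refChart n x).symm (refChart n x x) = x :=
  (refChart n x).left_inv (mem_refChart_source x)

/-- The centres needed for a compact set. -/
theorem exists_finset_chartCentre {L : Set M} (hL : IsCompact L) :
    ∃ P : Finset (range (chartCentre n (M := M))), ∀ x ∈ L,
      (⟨chartCentre n x, mem_range_self x⟩ : range (chartCentre n (M := M))) ∈ P := by
  classical
  have hf : {p : range (chartCentre n (M := M)) | (p : M) ∈ chartCentre n '' L}.Finite :=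
    (finite_chartCentre_image hL).preimage Subtype.val_injective.injOn
  exact ⟨hf.toFinset, fun x hx => by simpa using ⟨x, hx, rfl⟩⟩

/-- Functions given by continuous expressions in charts are bounded on compact sets. -/
theorem exists_bound_refChart {L : Set M} (hL : IsCompact L)
    {Φ : OpenPartialHomeomorph M (Rn n) → Rn n → ℝ}
    (hΦ : ∀ e ∈ atlas (Rn n) M, ContinuousOn (Φ e) e.target) :
    ∃ B, 0 ≤ B ∧ ∀ x ∈ L, |Φ (refChart n x) (refChart n x x)| ≤ B := by
  -- Only finitely many pieces meet `L`, and the coordinates of each lie in a compact part of the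
  -- chart; the sum of the finitely many bounds serves for all of them.
  obtain ⟨P, hP⟩ := exists_finset_chartCentre (n := n) hL
  have h : ∀ p : M, ∃ B, 0 ≤ B ∧ ∀ y ∈ chartPiece n p, |Φ (chartAt (Rn n) p) y| ≤ B := by
    intro p
    obtain ⟨B, hB⟩ := (isCompact_chartPiece (n := n) p).exists_bound_of_continuousOn
      ((hΦ _ (chart_mem_atlas (Rn n) p)).mono (chartPiece_subset p))
    exact ⟨|B|, abs_nonneg _, fun y hy => (hB y hy).trans (le_abs_self B)⟩
  choose B hB0 hB using h
  refine ⟨∑ p ∈ P, B p, Finset.sum_nonneg fun p _ => hB0 p, fun x hx => ?_⟩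
  exact (hB (chartCentre n x) _ (mem_chartPiece rfl)).trans
    (Finset.single_le_sum (f := fun p : range (chartCentre n (M := M)) => B p)
      (fun p _ => hB0 p) (hP x hx))

omit [ChartedSpace (Rn n) M] [T2Space M] [SecondCountableTopology M] in
theorem measurable_piecewise_chart (e : OpenPartialHomeomorph M (Rn n)) [DecidablePred (· ∈ e.source)] :
    Measurable (e.source.piecewise e fun _ => 0) :=
  e.continuousOn.measurable_piecewise continuousOn_const e.open_source.measurableSet

omit [ChartedSpace (Rn n) M] [T2Space M] [SecondCountableTopology M] in
theorem aemeasurable_symm (e : OpenPartialHomeomorph M (Rn n)) :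
    AEMeasurable e.symm (volume.restrict e.target) :=
  e.continuousOn_symm.aemeasurable e.open_target.measurableSet

omit [ChartedSpace (Rn n) M] [T2Space M] [SecondCountableTopology M] in
theorem aemeasurable_symm_withDensity (e : OpenPartialHomeomorph M (Rn n))
    (ρ : Rn n → ℝ≥0∞) : AEMeasurable e.symm ((volume.restrict e.target).withDensity ρ) :=
  (aemeasurable_symm e).mono_ac (withDensity_absolutelyContinuous _ _)

omit [T2Space M] [SecondCountableTopology M] in
theorem ae_chartVolume {g : BilinField n M} {e : OpenPartialHomeomorph M (Rn n)} {Q : M → Prop}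
    (h : ∀ᵐ y, y ∈ e.target → Q (e.symm y)) : ∀ᵐ x ∂chartVolume g e, Q x := by
  classical
  -- The exceptional set is enlarged to a Borel null set, since the push-forward is evaluated on a
  -- measurable subset of `M`. The complement of the chart domain is added to that subset; it has no
  -- mass because the inverse chart maps the target into the domain.
  obtain ⟨N, hN, hNm, hN0⟩ := exists_measurable_superset_of_null (ae_iff.1 h)
  have hA : MeasurableSet (e.source ∩ (e.source.piecewise e fun _ => 0) ⁻¹' N) :=
    e.open_source.measurableSet.inter (measurable_piecewise_chart e hNm)
  have hB := hA.union e.open_source.measurableSet.compl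
  refine measure_mono_null (t := (e.source ∩ (e.source.piecewise e fun _ => 0) ⁻¹' N)
    ∪ e.sourceᶜ) ?_ ?_
  · intro x hx
    by_cases hxs : x ∈ e.source
    · refine Or.inl ⟨hxs, ?_⟩
      simp only [mem_preimage, piecewise_eq_of_mem _ _ _ hxs]
      refine hN ?_
      simp only [Classical.not_imp, mem_ofPred_eq]
      exact ⟨e.map_source hxs, by rwa [e.left_inv hxs]⟩
    · exact Or.inr hxs
  · rw [chartVolume, Measure.map_apply_of_aemeasurable (aemeasurable_symm_withDensity e _) hB]
    refine withDensity_absolutelyContinuous _ _ ?_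
    rw [Measure.restrict_apply₀' e.open_target.measurableSet.nullMeasurableSet]
    refine measure_mono_null ?_ hN0
    rintro y ⟨hy, hyt⟩
    rcases hy with hy | hy
    · have := hy.2
      rwa [mem_preimage, piecewise_eq_of_mem _ _ _ hy.1, e.right_inv hyt] at this
    · exact absurd (e.map_target hyt) hy

/-- A property holds almost everywhere if it does so in coordinates. -/
theorem ae_riemVolume {g : BilinField n M} {Q : M → Prop}
    (h : ∀ p : M, ∀ᵐ y, y ∈ (chartAt (Rn n) p).target →
      chartCentre n ((chartAt (Rn n) p).symm y) = p → Q ((chartAt (Rn n) p).symm y)) :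
    ∀ᵐ x ∂riemVolume g, Q x := by
  have := (countable_range_chartCentre (n := n) (M := M)).to_subtype
  rw [riemVolume, Measure.ae_sum_iff]
  rintro ⟨p, -⟩
  rw [ae_restrict_iff' (measurableSet_chartCentre_preimage p)]
  exact ae_chartVolume (h p)

/-- Almost everywhere statements in all charts, at the points of the manifold. -/
theorem ae_riemVolume_refChart {g : BilinField n M}
    {Q : OpenPartialHomeomorph M (Rn n) → Rn n → Prop}
    (h : ∀ e ∈ atlas (Rn n) M, ∀ᵐ y, y ∈ e.target → Q e y) :
    ∀ᵐ x ∂riemVolume g, Q (refChart n x) (refChart n x x) := by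
  refine ae_riemVolume fun p => ?_
  filter_upwards [h _ (chart_mem_atlas (Rn n) p)] with y hy hyt hc
  rw [refChart, hc, (chartAt (Rn n) p).right_inv hyt]
  exact hy hyt

/-- Measurability of functions given by expressions in charts. -/
theorem aestronglyMeasurable_refChart {g : BilinField n M}
    {Φ : OpenPartialHomeomorph M (Rn n) → Rn n → ℝ}
    (hΦ : ∀ e ∈ atlas (Rn n) M, AEStronglyMeasurable (Φ e) (volume.restrict e.target)) :
    AEStronglyMeasurable (fun x => Φ (refChart n x) (refChart n x x)) (riemVolume g) := by
  classical
  have := (countable_range_chartCentre (n := n) (M := M)).to_subtype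
  rw [riemVolume, aestronglyMeasurable_sum_measure_iff]
  rintro ⟨p, -⟩
  set e := chartAt (Rn n) p with he
  have hm := hΦ e (chart_mem_atlas (Rn n) p)
  refine ⟨fun x => hm.mk _ (e.source.piecewise e (fun _ => 0) x),
    (hm.stronglyMeasurable_mk.comp_measurable (measurable_piecewise_chart e)), ?_⟩
  rw [EventuallyEq, ae_restrict_iff' (measurableSet_chartCentre_preimage p)]
  refine ae_chartVolume ?_
  have h1 := (ae_restrict_iff' e.open_target.measurableSet).1 hm.ae_eq_mk
  filter_upwards [h1] with y hy hyt hc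
  have hc' : chartCentre n (e.symm y) = p := hc
  rw [refChart, hc', ← he, piecewise_eq_of_mem _ _ _ (e.map_target hyt), e.right_inv hyt]
  exact hy hyt

/-- Integrals over compact sets are controlled by integrals in finitely many charts. -/
theorem exists_lintegral_riemVolume_le {g : BilinField n M}
    (hg : ∀ e ∈ atlas (Rn n) M, ContinuousOn (fun y => (gram g e y).det) e.target)
    {L : Set M} (hL : IsCompact L) :
    ∃ (c : ℝ≥0∞) (P : Finset (range (chartCentre n (M := M)))), c ≠ (∞ : ℝ≥0∞) ∧
      ∀ Φ : OpenPartialHomeomorph M (Rn n) → Rn n → ℝ≥0∞,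
        ∫⁻ x in L, Φ (refChart n x) (refChart n x x) ∂(riemVolume g)
          ≤ c * ∑ p ∈ P, ∫⁻ y in chartPiece n (p : M), Φ (chartAt (Rn n) (p : M)) y := by
  classical
  have := (countable_range_chartCentre (n := n) (M := M)).to_subtype
  obtain ⟨P, hP⟩ := exists_finset_chartCentre (n := n) hL
  obtain ⟨B, hB0, hB⟩ := exists_bound_refChart (n := n) hL
    (Φ := fun e y => Real.sqrt (gram g e y).det) fun e he => (hg e he).sqrt
  refine ⟨ENNReal.ofReal B, P, ENNReal.ofReal_ne_top, fun Φ => ?_⟩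
  have hLm : MeasurableSet L := hL.isClosed.measurableSet
  rw [riemVolume, Measure.restrict_sum _ hLm, lintegral_sum_measure, Finset.mul_sum,
    tsum_eq_sum (s := P)]
  · refine Finset.sum_le_sum ?_
    rintro ⟨p, hp⟩ -
    set e := chartAt (Rn n) p with he
    simp only
    set S := L ∩ chartCentre n ⁻¹' {p} with hS
    have hSm : MeasurableSet S := hLm.inter (measurableSet_chartCentre_preimage p)
    rw [Measure.restrict_restrict hLm, ← lintegral_indicator hSm, chartVolume]
    -- `Φ` is not assumed measurable, so the change of variables is used as an inequality only.
    refine (lintegral_map_le _ _).trans ?_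
    have hd : AEMeasurable (fun y => ENNReal.ofReal (Real.sqrt (gram g e y).det))
        (volume.restrict e.target) :=
      ((hg e (chart_mem_atlas (Rn n) p)).sqrt.aemeasurable
        e.open_target.measurableSet).ennreal_ofReal
    rw [lintegral_withDensity_eq_lintegral_mul_non_measurable₀ _ hd
      (Eventually.of_forall fun y => ENNReal.ofReal_lt_top)]
    calc _ ≤ ∫⁻ y in e.target, ENNReal.ofReal B * (chartPiece n p).indicator (Φ e) y := by
          refine lintegral_mono_ae ((ae_restrict_iff' e.open_target.measurableSet).2
            (Eventually.of_forall fun y hy => ?_))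
          simp only [Pi.mul_apply, indicator]
          split_ifs with h1 h2
          · have hc : chartCentre n (e.symm y) = p := h1.2
            have hb := hB _ h1.1
            rw [refChart, hc, ← he, e.right_inv hy, abs_of_nonneg (Real.sqrt_nonneg _)] at hb
            gcongr
            rw [refChart, hc, ← he, e.right_inv hy]
          · have hc : chartCentre n (e.symm y) = p := h1.2
            have := mem_chartPiece hc
            rw [← he, e.right_inv hy] at this
            exact absurd this h2
          · simp
          · simp
      _ = ENNReal.ofReal B * ∫⁻ y in e.target, (chartPiece n p).indicator (Φ e) y :=
          lintegral_const_mul' _ _ ENNReal.ofReal_ne_top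
      _ ≤ ENNReal.ofReal B * ∫⁻ y in chartPiece n p, Φ e y := by
          refine mul_le_mul' le_rfl ?_
          exact (lintegral_mono' Measure.restrict_le_self le_rfl).trans
            (lintegral_indicator_le _ _)
  · rintro ⟨p, hp⟩ hpP
    have : L ∩ chartCentre n ⁻¹' {p} = ∅ := by
      refine eq_empty_of_forall_notMem fun x hx => hpP ?_
      have h1 := hP x hx.1
      have h2 : chartCentre n x = p := hx.2
      convert h1 using 2
      exact h2.symm
    rw [Measure.restrict_restrict hLm, this]
    simp

theorem riemVolume_lt_top {g : BilinField n M}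
    (hg : ∀ e ∈ atlas (Rn n) M, ContinuousOn (fun y => (gram g e y).det) e.target)
    {L : Set M} (hL : IsCompact L) : riemVolume g L < (∞ : ℝ≥0∞) := by
  obtain ⟨c, P, hc, h⟩ := exists_lintegral_riemVolume_le hg hL
  have := h fun _ _ => 1
  simp only [lintegral_one, Measure.restrict_apply_univ] at this
  refine this.trans_lt (ENNReal.mul_lt_top hc.lt_top (ENNReal.sum_lt_top.2 fun p _ => ?_))
  exact (isCompact_chartPiece _).measure_lt_top

/-- Comparison of Riemannian measures through their densities. -/
theorem riemVolume_restrict_le {g h : BilinField n M} {K : Set M} (hK : MeasurableSet K) {C : ℝ}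
    (hC : 0 ≤ C) (hgh : ∀ x ∈ K, Real.sqrt (gram h (refChart n x) (refChart n x x)).det
      ≤ C * Real.sqrt (gram g (refChart n x) (refChart n x x)).det) :
    (riemVolume h).restrict K ≤ ENNReal.ofReal C • (riemVolume g).restrict K := by
  refine Measure.le_iff.2 fun S hS => ?_
  rw [Measure.smul_apply, Measure.restrict_apply hS, Measure.restrict_apply hS, smul_eq_mul,
    riemVolume, riemVolume, Measure.sum_apply _ (hS.inter hK), Measure.sum_apply _ (hS.inter hK),
    ← ENNReal.tsum_mul_left]
  refine ENNReal.tsum_le_tsum ?_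
  rintro ⟨p, hp⟩
  simp only
  set e := chartAt (Rn n) p with he
  have hm : MeasurableSet (S ∩ K ∩ chartCentre n ⁻¹' {p}) :=
    (hS.inter hK).inter (measurableSet_chartCentre_preimage p)
  rw [Measure.restrict_apply (hS.inter hK), Measure.restrict_apply (hS.inter hK), chartVolume,
    chartVolume, Measure.map_apply_of_aemeasurable (aemeasurable_symm_withDensity e _) hm,
    Measure.map_apply_of_aemeasurable (aemeasurable_symm_withDensity e _) hm,
    withDensity_apply', withDensity_apply', ← lintegral_const_mul' _ _ ENNReal.ofReal_ne_top]
  have hnull := (aemeasurable_symm e).nullMeasurableSet_preimage hm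
  refine lintegral_mono_ae ?_
  filter_upwards [ae_restrict_mem₀ hnull,
    ae_restrict_of_ae (ae_restrict_mem e.open_target.measurableSet)] with y hy hyt
  have hc : chartCentre n (e.symm y) = p := hy.2
  have := hgh _ hy.1.2
  rw [refChart, hc, ← he, e.right_inv hyt] at this
  rw [← ENNReal.ofReal_mul hC]
  exact ENNReal.ofReal_le_ofReal this

end ManifoldIntegration

/-! ### Metrics of class `C⁰ ∩ W^{1,n}_loc` and their covariant derivatives. -/

section RegularFields

variable {n : ℕ}

theorem contDiffOn_partialD {U : Set (Rn n)} (hU : IsOpen U) {f : Rn n → ℝ}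
    (hf : ContDiffOn ℝ ∞ f U) (k : Fin n) : ContDiffOn ℝ ∞ (partialD k f) U :=
  (hf.fderiv_of_isOpen hU (by simp)).clm_apply contDiffOn_const

theorem contDiffOn_matrix_det {m : ℕ∞ω} {U : Set (Rn n)} {G : Rn n → Matrix (Fin n) (Fin n) ℝ}
    (hG : ∀ i j, ContDiffOn ℝ m (fun y => G y i j) U) :
    ContDiffOn ℝ m (fun y => (G y).det) U := by
  simp only [Matrix.det_apply]
  exact ContDiffOn.sum fun σ _ => (contDiffOn_prod fun i _ => hG _ _).const_smul _

theorem contDiffOn_matrix_inv {m : ℕ∞ω} {U : Set (Rn n)} {G : Rn n → Matrix (Fin n) (Fin n) ℝ}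
    (hG : ∀ i j, ContDiffOn ℝ m (fun y => G y i j) U) (hd : ∀ y ∈ U, (G y).det ≠ 0) (i j : Fin n) :
    ContDiffOn ℝ m (fun y => (G y)⁻¹ i j) U := by
  simp only [Matrix.inv_apply_eq, Matrix.adjugate_apply]
  refine ContDiffOn.div (contDiffOn_matrix_det fun a b => ?_) (contDiffOn_matrix_det hG) hd
  simp only [Matrix.updateRow_apply]
  split_ifs
  · exact contDiffOn_const
  · exact hG a b

variable {M : Type*} [TopologicalSpace M] [ChartedSpace (Rn n) M] [IsManifold (𝓡 n) ∞ M]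

theorem mem_maximalAtlas_of_mem_atlas {e : OpenPartialHomeomorph M (Rn n)}
    (he : e ∈ atlas (Rn n) M) : e ∈ IsManifold.maximalAtlas (𝓡 n) ∞ M :=
  IsManifold.subset_maximalAtlas he

/-- The metrics of class `C⁰ ∩ W^{1,n}_loc`, in the charts of the atlas. -/
structure IsW1nMetric (g : BilinField n M) : Prop where
  symm : ∀ x v w, g x v w = g x w v
  pos : ∀ x v, v ≠ 0 → 0 < g x v v
  continuousOn : ∀ e ∈ atlas (Rn n) M, ∀ i j, ContinuousOn (fun y => gram g e y i j) e.target
  isWeakPartial : ∀ e ∈ atlas (Rn n) M, ∀ k i j,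
    IsWeakPartial e.target k (fun y => gram g e y i j)
      (weakPartial e.target k fun y => gram g e y i j)
  memLp : ∀ e ∈ atlas (Rn n) M, ∀ k i j, ∀ C ⊆ e.target, IsCompact C →
    MemLp (weakPartial e.target k fun y => gram g e y i j) n (volume.restrict C)

theorem memLp_restrict_congr {U C : Set (Rn n)} (hCU : C ⊆ U) (hC : IsCompact C)
    {f f' : Rn n → ℝ} {p : ℝ≥0∞} (hf : MemLp f p (volume.restrict C))
    (h : ∀ᵐ y, y ∈ U → f' y = f y) : MemLp f' p (volume.restrict C) := by
  refine hf.ae_eq ?_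
  rw [EventuallyEq, ae_restrict_iff' hC.isClosed.measurableSet]
  filter_upwards [h] with y hy hyC using (hy (hCU hyC)).symm

theorem ContinuousOn.memLp_of_isCompact {C : Set (Rn n)} (hC : IsCompact C) {f : Rn n → ℝ}
    (hf : ContinuousOn f C) (p : ℝ≥0∞) : MemLp f p (volume.restrict C) := by
  have : IsFiniteMeasure (volume.restrict C) := ⟨by simpa using hC.measure_lt_top⟩
  obtain ⟨B, hB⟩ := hC.exists_bound_of_continuousOn hf
  exact MemLp.of_bound (hf.aestronglyMeasurable_of_isCompact hC hC.isClosed.measurableSet) B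
    (ae_restrict_of_forall_mem hC.isClosed.measurableSet hB)

/-- Continuous and smooth metrics are brought under one interface, so that the estimates are proved
once. The chosen representative `weakPartial` inherits integrability from any weak derivative by
almost everywhere uniqueness. -/
theorem C0Metric.isW1nMetric (g : C0Metric n M) (hg : MemW1pLoc n g.inner) :
    IsW1nMetric g.inner where
  symm := g.symm
  pos := g.pos
  continuousOn e he i j := g.continuousOn_gram (mem_maximalAtlas_of_mem_atlas he) i j
  isWeakPartial e he k i j :=
    isWeakPartial_weakPartial (((hg e (mem_maximalAtlas_of_mem_atlas he) i j).2 k).imp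
      fun _ h => h.1)
  memLp e he k i j C hCe hC := by
    obtain ⟨f', h1, h2⟩ := (hg e (mem_maximalAtlas_of_mem_atlas he) i j).2 k
    exact memLp_restrict_congr hCe hC (h2 C hCe hC) (h1.weakPartial_ae_eq e.open_target)

theorem SmoothMetric.isW1nMetric (g : SmoothMetric n M) : IsW1nMetric g.inner where
  symm := g.symm
  pos := g.pos
  continuousOn e he i j := (g.contDiffOn_gram (mem_maximalAtlas_of_mem_atlas he) i j).continuousOn
  isWeakPartial e he k i j :=
    isWeakPartial_weakPartial ⟨_, isWeakPartial_of_contDiffOn e.open_target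
      ((g.contDiffOn_gram (mem_maximalAtlas_of_mem_atlas he) i j).of_le (by simp))⟩
  memLp e he k i j C hCe hC := by
    have h := g.contDiffOn_gram (mem_maximalAtlas_of_mem_atlas he) i j
    refine memLp_restrict_congr hCe hC (ContinuousOn.memLp_of_isCompact hC
      ((contDiffOn_partialD e.open_target h k).continuousOn.mono hCe) n)
      ((isWeakPartial_of_contDiffOn e.open_target (h.of_le (by simp))).weakPartial_ae_eq
        e.open_target)

section Gram

variable {g : BilinField n M} {e : OpenPartialHomeomorph M (Rn n)} {y : Rn n}

theorem IsW1nMetric.posDef (hg : IsW1nMetric g) (he : e ∈ atlas (Rn n) M) (hy : y ∈ e.target) :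
    (gram g e y).PosDef :=
  posDef_of_quadForm_pos (gram_symm hg.symm e y) fun _ hv =>
    gram_pos hg.pos (mem_maximalAtlas_of_mem_atlas he) hy hv

omit [IsManifold (𝓡 n) ∞ M] in
theorem IsW1nMetric.continuousOn_det (hg : IsW1nMetric g) (he : e ∈ atlas (Rn n) M) :
    ContinuousOn (fun y => (gram g e y).det) e.target := by
  rw [← contDiffOn_zero (𝕜 := ℝ)]
  exact contDiffOn_matrix_det fun i j => contDiffOn_zero.2 (hg.continuousOn e he i j)

theorem IsW1nMetric.continuousOn_inv (hg : IsW1nMetric g) (he : e ∈ atlas (Rn n) M)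
    (i j : Fin n) : ContinuousOn (fun y => (gram g e y)⁻¹ i j) e.target := by
  rw [← contDiffOn_zero (𝕜 := ℝ)]
  exact contDiffOn_matrix_inv (fun i j => contDiffOn_zero.2 (hg.continuousOn e he i j))
    (fun y hy => (hg.posDef he hy).det_pos.ne') i j

variable (h : SmoothMetric n M)

theorem SmoothMetric.contDiffOn_christoffel (he : e ∈ atlas (Rn n) M) (k i j : Fin n) :
    ContDiffOn ℝ ∞ (christoffel h.inner e k i j) e.target := by
  have hg := h.contDiffOn_gram (mem_maximalAtlas_of_mem_atlas he)
  have hd := fun k i j => contDiffOn_partialD e.open_target (hg i j) k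
  have hi := contDiffOn_matrix_inv hg fun y hy => (h.isW1nMetric.posDef he hy).det_pos.ne'
  unfold christoffel
  exact contDiffOn_const.mul (ContDiffOn.sum fun l _ =>
    (hi k l).mul (((hd i j l).add (hd j i l)).sub (hd l i j)))

theorem SmoothMetric.continuousOn_ricci (he : e ∈ atlas (Rn n) M) (i j : Fin n) :
    ContinuousOn (fun y => ricci h.inner e y i j) e.target := by
  have hc := h.contDiffOn_christoffel he
  have hd := fun m k i j => contDiffOn_partialD e.open_target (hc k i j) m
  refine ContDiffOn.continuousOn (𝕜 := ℝ) (n := ∞) ?_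
  simp only [ricci, Matrix.of_apply]
  exact ContDiffOn.sum fun k _ => ((hd k k i j).sub (hd j k i k)).add (ContDiffOn.sum fun l _ =>
    ((hc k k l).mul (hc l i j)).sub ((hc k j l).mul (hc l i k)))

theorem SmoothMetric.continuousOn_partialD_gram (he : e ∈ atlas (Rn n) M) (k i j : Fin n) :
    ContinuousOn (partialD k fun z => gram h.inner e z i j) e.target :=
  (contDiffOn_partialD e.open_target
    (h.contDiffOn_gram (mem_maximalAtlas_of_mem_atlas he) i j) k).continuousOn

theorem IsW1nMetric.continuousOn_christoffel_sum (hg : IsW1nMetric g) (he : e ∈ atlas (Rn n) M)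
    (k i j : Fin n) : ContinuousOn (fun y => (∑ l, christoffel h.inner e l k i y * gram g e y l j)
      + ∑ l, christoffel h.inner e l k j y * gram g e y i l) e.target :=
  (continuousOn_finsetSum _ fun l _ => (h.contDiffOn_christoffel he l k i).continuousOn.mul
    (hg.continuousOn e he l j)).add
  (continuousOn_finsetSum _ fun l _ => (h.contDiffOn_christoffel he l k j).continuousOn.mul
    (hg.continuousOn e he i l))

omit [IsManifold (𝓡 n) ∞ M] in
theorem covDeriv_eq_sub (h g : BilinField n M) (e : OpenPartialHomeomorph M (Rn n)) (y : Rn n)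
    (k i j : Fin n) : covDeriv h g e y k i j = weakPartial e.target k (fun z => gram g e z i j) y
      - ((∑ l, christoffel h e l k i y * gram g e y l j)
        + ∑ l, christoffel h e l k j y * gram g e y i l) := by
  rw [covDeriv, sub_sub]

theorem IsW1nMetric.memLp_covDeriv (hg : IsW1nMetric g) (he : e ∈ atlas (Rn n) M)
    (k i j : Fin n) {C : Set (Rn n)} (hCe : C ⊆ e.target) (hC : IsCompact C) :
    MemLp (fun y => covDeriv h.inner g e y k i j) n (volume.restrict C) := by
  simp only [covDeriv_eq_sub]
  exact (hg.memLp e he k i j C hCe hC).sub (ContinuousOn.memLp_of_isCompact hC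
    ((hg.continuousOn_christoffel_sum h he k i j).mono hCe) n)

theorem IsW1nMetric.aestronglyMeasurable_covDeriv (hg : IsW1nMetric g)
    (he : e ∈ atlas (Rn n) M) (k i j : Fin n) :
    AEStronglyMeasurable (fun y => covDeriv h.inner g e y k i j) (volume.restrict e.target) := by
  simp only [covDeriv_eq_sub]
  exact (hg.isWeakPartial e he k i j).2.1.aestronglyMeasurable.sub
    ((hg.continuousOn_christoffel_sum h he k i j).aestronglyMeasurable
      e.open_target.measurableSet)

theorem memLp_absSum {α : Type*} [MeasurableSpace α] {μ : Measure α} {p : ℝ≥0∞}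
    {T : α → Fin n → Fin n → Fin n → ℝ} (hT : ∀ k i j, MemLp (fun a => T a k i j) p μ) :
    MemLp (fun a => absSum (T a)) p μ :=
  memLp_finsetSum _ fun k _ => memLp_finsetSum _ fun i _ => memLp_finsetSum _ fun j _ =>
    (hT k i j).abs

theorem aestronglyMeasurable_absSum {α : Type*} [MeasurableSpace α] {μ : Measure α}
    {T : α → Fin n → Fin n → Fin n → ℝ} (hT : ∀ k i j, AEStronglyMeasurable (fun a => T a k i j) μ) :
    AEStronglyMeasurable (fun a => absSum (T a)) μ :=
  Finset.aestronglyMeasurable_fun_sum _ fun k _ => Finset.aestronglyMeasurable_fun_sum _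
    fun i _ => Finset.aestronglyMeasurable_fun_sum _ fun j _ => (hT k i j).norm

end Gram

end RegularFields

/-! ### Measurability of the coefficients. -/

section Measurability

variable {n : ℕ} {α : Type*} [MeasurableSpace α] {μ : Measure α}

theorem aemeasurable_matrix_det {G : α → Matrix (Fin n) (Fin n) ℝ}
    (hG : ∀ i j, AEMeasurable (fun a => G a i j) μ) : AEMeasurable (fun a => (G a).det) μ := by
  simp only [Matrix.det_apply]
  exact Finset.aemeasurable_fun_sum _ fun σ _ =>
    (Finset.aemeasurable_fun_prod _ fun i _ => hG _ _).const_smul _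

theorem aemeasurable_matrix_inv {G : α → Matrix (Fin n) (Fin n) ℝ}
    (hG : ∀ i j, AEMeasurable (fun a => G a i j) μ) (i j : Fin n) :
    AEMeasurable (fun a => (G a)⁻¹ i j) μ := by
  simp only [Matrix.inv_apply_eq, Matrix.adjugate_apply]
  refine (aemeasurable_matrix_det fun a b => ?_).div (aemeasurable_matrix_det hG)
  simp only [Matrix.updateRow_apply]
  split_ifs
  · exact aemeasurable_const
  · exact hG a b

variable {G H Ric : α → Matrix (Fin n) (Fin n) ℝ} {Γ dH T : α → Fin n → Fin n → Fin n → ℝ}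

theorem aemeasurable_gammaTensor (hG : ∀ i j, AEMeasurable (fun a => G a i j) μ)
    (hT : ∀ k i j, AEMeasurable (fun a => T a k i j) μ) (k i j : Fin n) :
    AEMeasurable (fun a => gammaTensor (G a) (T a) k i j) μ := by
  have hi := aemeasurable_matrix_inv hG
  unfold gammaTensor
  exact (Finset.aemeasurable_fun_sum _ fun l _ =>
    (hi k l).mul (((hT i j l).add (hT j i l)).sub (hT l i j))).const_mul _

theorem aemeasurable_vecV (hG : ∀ i j, AEMeasurable (fun a => G a i j) μ)
    (hT : ∀ k i j, AEMeasurable (fun a => T a k i j) μ) (k : Fin n) :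
    AEMeasurable (fun a => vecV (G a) (T a) k) μ := by
  have hi := aemeasurable_matrix_inv hG
  have hγ := aemeasurable_gammaTensor hG hT
  unfold vecV
  exact Finset.aemeasurable_fun_sum _ fun i _ => Finset.aemeasurable_fun_sum _ fun j _ =>
    ((hi i j).mul (hγ k i j)).sub ((hi i k).mul (hγ j j i))

theorem aemeasurable_scalF (hG : ∀ i j, AEMeasurable (fun a => G a i j) μ)
    (hR : ∀ i j, AEMeasurable (fun a => Ric a i j) μ)
    (hT : ∀ k i j, AEMeasurable (fun a => T a k i j) μ) :
    AEMeasurable (fun a => scalF (G a) (Ric a) (T a)) μ := by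
  have hi := aemeasurable_matrix_inv hG
  have hγ := aemeasurable_gammaTensor hG hT
  have hN : ∀ k i j, AEMeasurable (fun a => nablaInv (G a) (T a) k i j) μ := fun k i j => by
    unfold nablaInv
    exact (Finset.aemeasurable_fun_sum _ fun c _ => Finset.aemeasurable_fun_sum _ fun d _ =>
      ((hi i c).mul (hi j d)).mul (hT k c d)).neg
  unfold scalF
  refine (((Finset.aemeasurable_fun_sum _ fun i _ => Finset.aemeasurable_fun_sum _ fun j _ =>
    (hi i j).mul (hR i j)).sub
    (Finset.aemeasurable_fun_sum _ fun k _ => Finset.aemeasurable_fun_sum _ fun i _ =>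
      Finset.aemeasurable_fun_sum _ fun j _ => (hN k i j).mul (hγ k i j))).add
    (Finset.aemeasurable_fun_sum _ fun k _ => Finset.aemeasurable_fun_sum _ fun i _ =>
      Finset.aemeasurable_fun_sum _ fun j _ => (hN k i k).mul (hγ j j i))).add
    (Finset.aemeasurable_fun_sum _ fun i _ => Finset.aemeasurable_fun_sum _ fun j _ =>
      (hi i j).mul (Finset.aemeasurable_fun_sum _ fun k _ => Finset.aemeasurable_fun_sum _
        fun l _ => ((hγ k k l).mul (hγ l i j)).sub ((hγ k j l).mul (hγ l i k))))

theorem aemeasurable_sqrt_det_div (hG : ∀ i j, AEMeasurable (fun a => G a i j) μ)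
    (hH : ∀ i j, AEMeasurable (fun a => H a i j) μ) :
    AEMeasurable (fun a => Real.sqrt ((G a).det / (H a).det)) μ :=
  ((aemeasurable_matrix_det hG).div (aemeasurable_matrix_det hH)).sqrt

theorem aemeasurable_fluxTerm (hG : ∀ i j, AEMeasurable (fun a => G a i j) μ)
    (hH : ∀ i j, AEMeasurable (fun a => H a i j) μ)
    (hT : ∀ k i j, AEMeasurable (fun a => T a k i j) μ) (k : Fin n) :
    AEMeasurable (fun a => fluxTerm (G a) (H a) (T a) k) μ := by
  unfold fluxTerm
  exact (aemeasurable_vecV hG hT k).mul (aemeasurable_sqrt_det_div hG hH)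

theorem aemeasurable_potTerm (hG : ∀ i j, AEMeasurable (fun a => G a i j) μ)
    (hH : ∀ i j, AEMeasurable (fun a => H a i j) μ) (hR : ∀ i j, AEMeasurable (fun a => Ric a i j) μ)
    (hΓ : ∀ k i j, AEMeasurable (fun a => Γ a k i j) μ)
    (hdH : ∀ k i j, AEMeasurable (fun a => dH a k i j) μ)
    (hT : ∀ k i j, AEMeasurable (fun a => T a k i j) μ) :
    AEMeasurable (fun a => potTerm (G a) (H a) (Ric a) (Γ a) (dH a) (T a)) μ := by
  have hi := aemeasurable_matrix_inv hG
  have hj := aemeasurable_matrix_inv hH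
  have hρ := aemeasurable_sqrt_det_div hG hH
  unfold potTerm volRatioD
  refine ((aemeasurable_scalF hG hR hT).mul hρ).sub (Finset.aemeasurable_fun_sum _ fun k _ =>
    (aemeasurable_vecV hG hT k).mul ((hρ.const_mul _).mul
      ((Finset.aemeasurable_fun_sum _ fun i _ => Finset.aemeasurable_fun_sum _ fun j _ =>
        (hi j i).mul (((hT k i j).add ?_).add ?_)).sub
      (Finset.aemeasurable_fun_sum _ fun i _ => Finset.aemeasurable_fun_sum _ fun j _ =>
        (hj j i).mul (hdH k i j)))))
  · exact Finset.aemeasurable_fun_sum _ fun l _ => (hΓ l k i).mul (hG l j)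
  · exact Finset.aemeasurable_fun_sum _ fun l _ => (hΓ l k j).mul (hG i l)

end Measurability

/-! ### The density of `⟨R_g, u²⟩` in a chart. -/

section ChartDensity

variable {n : ℕ} {M : Type*} [TopologicalSpace M] [ChartedSpace (Rn n) M]

/-- The zeroth order coefficient of the scalar curvature density in a chart. -/
noncomputable def chartPot (h g : BilinField n M) (e : OpenPartialHomeomorph M (Rn n))
    (y : Rn n) : ℝ :=
  potTerm (gram g e y) (gram h e y) (ricci h e y) (fun k i j => christoffel h e k i j y)
    (fun k i j => partialD k (fun z => gram h e z i j) y) (covDeriv h g e y)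

/-- The first order coefficients of the scalar curvature density in a chart. -/
noncomputable def chartFlux (h g : BilinField n M) (e : OpenPartialHomeomorph M (Rn n))
    (k : Fin n) (y : Rn n) : ℝ :=
  fluxTerm (gram g e y) (gram h e y) (covDeriv h g e y) k

/-- The density of `⟨R_g, u²⟩` in a chart. -/
noncomputable def chartDensity (h g : BilinField n M) (u : M → ℝ)
    (e : OpenPartialHomeomorph M (Rn n)) (y : Rn n) : ℝ :=
  u (e.symm y) ^ 2 * chartPot h g e y
    - 2 * u (e.symm y) * ∑ k, partialD k (fun z => u (e.symm z)) y * chartFlux h g e k y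

variable [IsManifold (𝓡 n) ∞ M] {g : BilinField n M} {e : OpenPartialHomeomorph M (Rn n)}
  {u : M → ℝ}

theorem IsTest.contDiffOn (hu : IsTest (n := n) u) (he : e ∈ atlas (Rn n) M) :
    ContDiffOn ℝ ∞ (fun y => u (e.symm y)) e.target := by
  rw [← contMDiffOn_iff_contDiffOn]
  exact hu.1.comp_contMDiffOn
    (contMDiffOn_symm_of_mem_maximalAtlas (mem_maximalAtlas_of_mem_atlas he))

variable (h : SmoothMetric n M)

omit [IsManifold (𝓡 n) ∞ M] in
theorem IsW1nMetric.aemeasurable_gram (hg : IsW1nMetric g) (he : e ∈ atlas (Rn n) M)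
    (i j : Fin n) : AEMeasurable (fun y => gram g e y i j) (volume.restrict e.target) :=
  (hg.continuousOn e he i j).aemeasurable e.open_target.measurableSet

theorem IsW1nMetric.aemeasurable_chartFlux (hg : IsW1nMetric g) (he : e ∈ atlas (Rn n) M)
    (k : Fin n) : AEMeasurable (chartFlux h.inner g e k) (volume.restrict e.target) :=
  aemeasurable_fluxTerm (hg.aemeasurable_gram he) (h.isW1nMetric.aemeasurable_gram he)
    (fun k i j => (hg.aestronglyMeasurable_covDeriv h he k i j).aemeasurable) k

theorem IsW1nMetric.aemeasurable_chartPot (hg : IsW1nMetric g) (he : e ∈ atlas (Rn n) M) :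
    AEMeasurable (chartPot h.inner g e) (volume.restrict e.target) :=
  aemeasurable_potTerm (hg.aemeasurable_gram he) (h.isW1nMetric.aemeasurable_gram he)
    (fun i j => (h.continuousOn_ricci he i j).aemeasurable e.open_target.measurableSet)
    (fun k i j => (h.contDiffOn_christoffel he k i j).continuousOn.aemeasurable
      e.open_target.measurableSet)
    (fun k i j => (h.continuousOn_partialD_gram he k i j).aemeasurable
      e.open_target.measurableSet)
    (fun k i j => (hg.aestronglyMeasurable_covDeriv h he k i j).aemeasurable)

theorem IsTest.aemeasurable (hu : IsTest (n := n) u) (he : e ∈ atlas (Rn n) M) :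
    AEMeasurable (fun y => u (e.symm y)) (volume.restrict e.target) :=
  (hu.contDiffOn he).continuousOn.aemeasurable e.open_target.measurableSet

theorem IsTest.continuousOn_partialD (hu : IsTest (n := n) u) (he : e ∈ atlas (Rn n) M)
    (k : Fin n) : ContinuousOn (partialD k fun y => u (e.symm y)) e.target :=
  (contDiffOn_partialD e.open_target (hu.contDiffOn he) k).continuousOn

theorem IsTest.aemeasurable_partialD (hu : IsTest (n := n) u) (he : e ∈ atlas (Rn n) M)
    (k : Fin n) : AEMeasurable (partialD k fun y => u (e.symm y)) (volume.restrict e.target) :=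
  (hu.continuousOn_partialD he k).aemeasurable e.open_target.measurableSet

theorem IsW1nMetric.aestronglyMeasurable_chartDensity (hg : IsW1nMetric g)
    (he : e ∈ atlas (Rn n) M) (hu : IsTest (n := n) u) :
    AEStronglyMeasurable (chartDensity h.inner g u e) (volume.restrict e.target) := by
  refine AEMeasurable.aestronglyMeasurable ?_
  unfold chartDensity
  exact (((hu.aemeasurable he).pow_const 2).mul (hg.aemeasurable_chartPot h he)).sub
    (((hu.aemeasurable he).const_mul 2).mul (Finset.aemeasurable_fun_sum _ fun k _ =>
      (hu.aemeasurable_partialD he k).mul (hg.aemeasurable_chartFlux h he k)))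

/-- The product rule for the weak gradient of `u² dμ_g/dμ_h`. -/
theorem IsW1nMetric.ae_density_eq (hg : IsW1nMetric g) (he : e ∈ atlas (Rn n) M)
    (hu : IsTest (n := n) u) : ∀ᵐ y, y ∈ e.target →
      scalF (gram g e y) (ricci h.inner e y) (covDeriv h.inner g e y) * u (e.symm y) ^ 2
          * volRatio h.inner g e y
        - ∑ k, vecV (gram g e y) (covDeriv h.inner g e y) k
          * weakPartial e.target k (fun z => u (e.symm z) ^ 2 * volRatio h.inner g e z) y
      = chartDensity h.inner g u e y := by
  have hU := hu.contDiffOn he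
  have hφ : ContDiffOn ℝ 1 (fun y => u (e.symm y) ^ 2) e.target := (hU.of_le (by simp)).pow 2
  have key : ∀ k, ∀ᵐ y, y ∈ e.target →
      weakPartial e.target k (fun z => u (e.symm z) ^ 2 * volRatio h.inner g e z) y
        = partialD k (fun z => u (e.symm z) ^ 2) y
            * Real.sqrt ((gram g e y).det / (gram h.inner e y).det)
          + u (e.symm y) ^ 2 * volRatioD (gram g e y) (gram h.inner e y)
            (fun i j => weakPartial e.target k (fun z => gram g e z i j) y)
            (fun i j => partialD k (fun z => gram h.inner e z i j) y) := fun k => by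
    obtain ⟨f', h1, h2⟩ := IsWeakPartial.mul_volRatio e.open_target hφ (hg.continuousOn e he)
      (hg.isWeakPartial e he k)
      (fun i j => (h.contDiffOn_gram (mem_maximalAtlas_of_mem_atlas he) i j).of_le (by simp))
      (fun y hy => (hg.posDef he hy).det_pos)
      (fun y hy => (h.isW1nMetric.posDef he hy).det_pos)
    filter_upwards [h1.weakPartial_ae_eq e.open_target] with y hy hyt
    rw [← h2 y hyt]
    exact hy hyt
  filter_upwards [ae_all_iff.2 key] with y hy hyt
  have hd : ∀ k, partialD k (fun z => u (e.symm z) ^ 2) y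
      = 2 * u (e.symm y) * partialD k (fun z => u (e.symm z)) y := fun k => by
    have hdiff : DifferentiableAt ℝ (fun z => u (e.symm z)) y :=
      (hU.differentiableOn (by simp)).differentiableAt (e.open_target.mem_nhds hyt)
    simp only [pow_two]
    rw [partialD_mul hdiff hdiff]
    ring
  -- Adding the Christoffel terms back to `∇̃g` recovers `∂g`, so the density depends on the first
  -- derivatives of `g` through `∇̃g` only.
  have hT : ∀ k, (fun i j => weakPartial e.target k (fun z => gram g e z i j) y)
      = fun i j => covDeriv h.inner g e y k i j
        + ∑ l, christoffel h.inner e l k i y * gram g e y l j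
        + ∑ l, christoffel h.inner e l k j y * gram g e y i l := fun k => by
    ext i j
    rw [covDeriv]
    ring
  simp only [hy _ hyt, hd, hT]
  simp only [chartDensity, chartPot, chartFlux, potTerm, fluxTerm, volRatio]
  rw [mul_sub, Finset.mul_sum, Finset.mul_sum, sub_sub, ← Finset.sum_add_distrib]
  congr 1
  · ring
  · exact Finset.sum_congr rfl fun k _ => by ring

/-- Metrics that agree on an open set have the same density there. -/
theorem IsW1nMetric.ae_chartDensity_eq {g' : BilinField n M} (hg : IsW1nMetric g)
    (hg' : IsW1nMetric g') {K : Set M} (hK : IsClosed K) (hgg : ∀ x ∉ K, g' x = g x)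
    (he : e ∈ atlas (Rn n) M) (u : M → ℝ) : ∀ᵐ y, y ∈ e.target → e.symm y ∉ K →
      chartDensity h.inner g' u e y = chartDensity h.inner g u e y := by
  have hV : IsOpen (e.target ∩ e.symm ⁻¹' Kᶜ) := e.isOpen_inter_preimage_symm hK.isOpen_compl
  have hgram : ∀ y ∈ e.target ∩ e.symm ⁻¹' Kᶜ, gram g' e y = gram g e y := fun y hy => by
    unfold gram
    rw [hgg _ hy.2]
  -- Both weak derivatives restrict to the open set where the metrics agree, and uniqueness there
  -- identifies them almost everywhere.
  have key : ∀ k i j, ∀ᵐ y, y ∈ e.target ∩ e.symm ⁻¹' Kᶜ →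
      weakPartial e.target k (fun z => gram g' e z i j) y
        = weakPartial e.target k (fun z => gram g e z i j) y := fun k i j =>
    (((hg'.isWeakPartial e he k i j).mono inter_subset_left).congr hV
      fun y hy => by rw [hgram y hy]).ae_eq hV
      ((hg.isWeakPartial e he k i j).mono inter_subset_left)
  filter_upwards [ae_all_iff.2 fun k => ae_all_iff.2 fun i => ae_all_iff.2 (key k i)]
    with y hy hyt hyK
  have hc : covDeriv h.inner g' e y = covDeriv h.inner g e y := by
    ext k i j
    rw [covDeriv, covDeriv, hy k i j ⟨hyt, hyK⟩, hgram y ⟨hyt, hyK⟩]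
  simp only [chartDensity, chartPot, chartFlux, hc, hgram y ⟨hyt, hyK⟩]

end ChartDensity

/-! ### Hölder's inequality for the two kinds of terms. -/

section Holder

variable {α : Type*} [MeasurableSpace α] {μ : Measure α}

/-- Hölder's inequality for a potential and a flux term. -/
theorem eLpNorm_one_le_of_abs_le {p q : ℝ≥0∞} [ENNReal.HolderTriple q p 2]
    {u a X E f : α → ℝ} {C : ℝ} (hC : 0 ≤ C) (hu : AEStronglyMeasurable u μ)
    (ha : AEStronglyMeasurable a μ) (hX : AEStronglyMeasurable X μ)
    (hE : AEStronglyMeasurable E μ)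
    (hf : ∀ᵐ x ∂μ, |f x| ≤ C * (u x ^ 2 * X x * E x + |u x| * a x * E x)) :
    eLpNorm f 1 μ ≤ ENNReal.ofReal C * ((eLpNorm u q μ * eLpNorm E p μ) *
      (eLpNorm u q μ * eLpNorm X p μ + eLpNorm a 2 μ)) := by
  set v : α → ℝ := fun x => |u x| with hv
  have hvm : AEStronglyMeasurable v μ := hu.norm
  have hvn : eLpNorm v q μ = eLpNorm u q μ := eLpNorm_norm u
  -- The bound factors as `(|u| E)(|u| X + a)`. Cauchy–Schwarz separates the two brackets, and the
  -- Hölder triple is then applied to `|u| E` and `|u| X`.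
  have h1 : eLpNorm f 1 μ ≤ ENNReal.ofReal C * eLpNorm ((v • E) • (v • X + a)) 1 μ := by
    have hab : ∀ᵐ x ∂μ, ‖f x‖ ≤ C * ((v • E) • (v • X + a)) x := by
      filter_upwards [hf] with x hx
      rw [Real.norm_eq_abs]
      refine hx.trans (le_of_eq ?_)
      simp only [hv, Pi.smul_apply', Pi.mul_apply, Pi.add_apply, smul_eq_mul, ← sq_abs (u x)]
      ring
    refine eLpNorm_le_mul_eLpNorm_of_ae_le_mul ?_ 1
    filter_upwards [hab] with x hx
    exact hx.trans (mul_le_mul_of_nonneg_left (le_abs_self _) hC)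
  refine h1.trans (mul_le_mul' le_rfl ?_)
  refine (eLpNorm_smul_le_mul_eLpNorm (p := 2) (q := 2) ((hvm.smul hX).add ha)
    (hvm.smul hE)).trans ?_
  refine mul_le_mul' ?_ ((eLpNorm_add_le (hvm.smul hX) ha (by norm_num)).trans
    (add_le_add ?_ le_rfl))
  · rw [← hvn]
    exact eLpNorm_smul_le_mul_eLpNorm hE hvm
  · rw [← hvn]
    exact eLpNorm_smul_le_mul_eLpNorm hX hvm

/-- Lets the `p`-th root be distributed over the finitely many charts in an `L^p` norm. -/
theorem ENNReal.rpow_finsetSum_le {ι : Type*} (s : Finset ι) (f : ι → ℝ≥0∞) {r : ℝ} (hr : 0 < r)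
    (hr1 : r ≤ 1) : (∑ i ∈ s, f i) ^ r ≤ ∑ i ∈ s, f i ^ r := by
  classical
  induction s using Finset.induction_on with
  | empty => simp [ENNReal.zero_rpow_of_pos hr]
  | insert a s ha ih =>
    rw [Finset.sum_insert ha, Finset.sum_insert ha]
    exact (ENNReal.rpow_add_le_add_rpow _ _ hr.le hr1).trans (add_le_add le_rfl ih)

end Holder

/-! ### Comparison of volume densities. -/

section MatrixBounds

variable {n : ℕ}

theorem MatBound.mono {B B' : ℝ} {G : Matrix (Fin n) (Fin n) ℝ} (hG : MatBound B G)
    (hB : B ≤ B') : MatBound B' G :=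
  ⟨hG.posDef, fun i j => (hG.entry i j).trans hB, fun i j => (hG.inv_entry i j).trans hB⟩

/-- Both `det H` and `1 / det G = det G⁻¹` are at most `n! Bⁿ`, hence `det H ≤ (n! Bⁿ)² det G`. This
constant compares the measures of `h` and `g`. -/
theorem MatBound.sqrt_det_le {B : ℝ} {G H : Matrix (Fin n) (Fin n) ℝ} (hG : MatBound B G)
    (hH : MatBound B H) :
    Real.sqrt H.det ≤ (n.factorial * B ^ n) * Real.sqrt G.det := by
  have h1 : H.det ≤ n.factorial * B ^ n := by
    have := Matrix.det_le (abv := AbsoluteValue.abs) (A := H) hH.entry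
    simp only [Fintype.card_fin, nsmul_eq_mul] at this
    exact (le_abs_self _).trans this
  have h2 : G⁻¹.det ≤ n.factorial * B ^ n := by
    have := Matrix.det_le (abv := AbsoluteValue.abs) (A := G⁻¹) hG.inv_entry
    simp only [Fintype.card_fin, nsmul_eq_mul] at this
    exact (le_abs_self _).trans this
  have h0 := hG.posDef.det_pos
  have hc : 0 ≤ (n.factorial : ℝ) * B ^ n := hH.posDef.det_pos.le.trans h1
  rw [Matrix.det_nonsing_inv, Ring.inverse_eq_inv', inv_le_iff_one_le_mul₀ h0] at h2
  calc Real.sqrt H.det ≤ Real.sqrt ((n.factorial * B ^ n) ^ 2 * G.det) := by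
        refine Real.sqrt_le_sqrt (h1.trans ?_)
        nlinarith
    _ = (n.factorial * B ^ n) * Real.sqrt G.det := by
        rw [Real.sqrt_mul (sq_nonneg _), Real.sqrt_sq hc]

end MatrixBounds

/-! ### Pointwise bounds for the density and for its variation. -/

section DensityBounds

variable {n : ℕ} {M : Type*} [TopologicalSpace M] [ChartedSpace (Rn n) M]

/-- The jets of two metrics at a point of a chart. -/
noncomputable def chartJet (h g g' : BilinField n M) (t : ℝ) (e : OpenPartialHomeomorph M (Rn n))
    (y : Rn n) : JetPair n where
  G := gram g e y
  G' := gram g' e y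
  H := gram h e y
  Ric := ricci h e y
  Γ := fun k i j => christoffel h e k i j y
  dH := fun k i j => partialD k (fun z => gram h e z i j) y
  T := covDeriv h g e y
  T' := covDeriv h g' e y
  t := t
  D := absSum (covDeriv h g' e y - covDeriv h g e y)

/-- The sum of the absolute values of the derivatives of `u` in a chart. -/
noncomputable def chartGrad (u : M → ℝ) (e : OpenPartialHomeomorph M (Rn n)) (y : Rn n) : ℝ :=
  ∑ k, |partialD k (fun z => u (e.symm z)) y|

omit [ChartedSpace (Rn n) M] in
theorem chartGrad_nonneg (u : M → ℝ) (e : OpenPartialHomeomorph M (Rn n)) (y : Rn n) :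
    0 ≤ chartGrad u e y := Finset.sum_nonneg fun _ _ => abs_nonneg _

/-- The growth function of the coefficients of the density. -/
noncomputable def chartSize (h g g' : BilinField n M) (e : OpenPartialHomeomorph M (Rn n))
    (y : Rn n) : ℝ :=
  1 + absSum (covDeriv h g e y) + absSum (covDeriv h g' e y - covDeriv h g e y)

/-- The distance of the coefficients of two densities. -/
noncomputable def chartGap (h g g' : BilinField n M) (t : ℝ) (e : OpenPartialHomeomorph M (Rn n))
    (y : Rn n) : ℝ :=
  t * chartSize h g g' e y + absSum (covDeriv h g' e y - covDeriv h g e y)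

/-- The density is linear in its coefficients, so a density and a difference of densities have the
same shape. One estimate covers both, with the size as last factor for the former and the gap for
the latter. -/
theorem exists_chartDensity_bound (n : ℕ) (M : Type*) [TopologicalSpace M] [ChartedSpace (Rn n) M]
    (B : ℝ) : ∃ C, 0 ≤ C ∧
    ∀ (h g g' : BilinField n M) (t : ℝ) (u : M → ℝ) (e : OpenPartialHomeomorph M (Rn n)) (y : Rn n),
      (chartJet h g g' t e y).Bounded B →
      |chartDensity h g u e y| ≤ C * (u (e.symm y) ^ 2 * chartSize h g g' e y * chartSize h g g' e y
        + |u (e.symm y)| * chartGrad u e y * chartSize h g g' e y) ∧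
      |chartDensity h g' u e y - chartDensity h g u e y|
        ≤ C * (u (e.symm y) ^ 2 * chartSize h g g' e y * chartGap h g g' t e y
          + |u (e.symm y)| * chartGrad u e y * chartGap h g g' t e y) := by
  obtain ⟨C, hC, hb⟩ := exists_potTerm_fluxTerm_bound n B
  refine ⟨2 * C, by positivity, fun h g g' t u e y hj => ?_⟩
  obtain ⟨h1, h2, h3⟩ := hb _ hj
  change |chartPot h g e y| ≤ C * chartSize h g g' e y ^ 2 at h1
  change |chartPot h g' e y - chartPot h g e y|
    ≤ C * (chartSize h g g' e y * chartGap h g g' t e y) at h2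
  change ∀ k, |chartFlux h g e k y| ≤ C * chartSize h g g' e y ∧
    |chartFlux h g' e k y - chartFlux h g e k y| ≤ C * chartGap h g g' t e y at h3
  set X := chartSize h g g' e y
  set E := chartGap h g g' t e y
  set w := u (e.symm y)
  have key : ∀ {P Z : ℝ} {F : Fin n → ℝ}, |P| ≤ C * (X * Z) → (∀ k, |F k| ≤ C * Z) →
      |w ^ 2 * P - 2 * w * ∑ k, partialD k (fun z => u (e.symm z)) y * F k|
        ≤ 2 * C * (w ^ 2 * X * Z + |w| * chartGrad u e y * Z) := by
    intro P Z F hP hF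
    have hs : |∑ k, partialD k (fun z => u (e.symm z)) y * F k|
        ≤ chartGrad u e y * (C * Z) := by
      rw [chartGrad, Finset.sum_mul]
      refine (Finset.abs_sum_le_sum_abs _ _).trans (Finset.sum_le_sum fun k _ => ?_)
      rw [abs_mul]
      exact mul_le_mul_of_nonneg_left (hF k) (abs_nonneg _)
    have hP' : 0 ≤ C * (X * Z) := (abs_nonneg _).trans hP
    calc _ ≤ |w ^ 2 * P| + |2 * w * ∑ k, partialD k (fun z => u (e.symm z)) y * F k| :=
          abs_sub _ _
      _ = w ^ 2 * |P| + 2 * |w| * |∑ k, partialD k (fun z => u (e.symm z)) y * F k| := by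
          rw [abs_mul, abs_mul, abs_mul, abs_of_nonneg (sq_nonneg w), abs_two]
      _ ≤ w ^ 2 * (C * (X * Z)) + 2 * |w| * (chartGrad u e y * (C * Z)) := by gcongr
      _ ≤ 2 * (w ^ 2 * (C * (X * Z))) + 2 * |w| * (chartGrad u e y * (C * Z)) := by
          have := mul_nonneg (sq_nonneg w) hP'
          linarith
      _ = _ := by ring
  refine ⟨?_, ?_⟩
  · exact key (by rwa [← pow_two]) fun k => (h3 k).1
  · have : chartDensity h g' u e y - chartDensity h g u e y
        = w ^ 2 * (chartPot h g' e y - chartPot h g e y) - 2 * w *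
          ∑ k, partialD k (fun z => u (e.symm z)) y
            * (chartFlux h g' e k y - chartFlux h g e k y) := by
      simp only [chartDensity, mul_sub, Finset.sum_sub_distrib]
      ring
    rw [this]
    exact key h2 fun k => (h3 k).2

end DensityBounds

/-! ### Bounds on compact sets and integrability of the density. -/

section CompactBounds

variable {n : ℕ} {M : Type*} [TopologicalSpace M] [ChartedSpace (Rn n) M]
  [T2Space M] [SecondCountableTopology M] [MeasurableSpace M] [BorelSpace M]

theorem refChart_mem_atlas (x : M) : refChart n x ∈ atlas (Rn n) M := chart_mem_atlas (Rn n) _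

omit [TopologicalSpace M] [T2Space M] [SecondCountableTopology M] [MeasurableSpace M] [BorelSpace M] in
theorem exists_common_bound {L : Set M} {ι : Type*} [Fintype ι] {f : ι → M → ℝ}
    (hf : ∀ i, ∃ B, 0 ≤ B ∧ ∀ x ∈ L, |f i x| ≤ B) : ∃ B, 0 ≤ B ∧ ∀ x ∈ L, ∀ i, |f i x| ≤ B := by
  choose B hB0 hB using hf
  exact ⟨∑ i, B i, Finset.sum_nonneg fun i _ => hB0 i, fun x hx i => (hB i x hx).trans
    (Finset.single_le_sum (fun i _ => hB0 i) (Finset.mem_univ i))⟩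

variable [IsManifold (𝓡 n) ∞ M] {g : BilinField n M}

theorem IsW1nMetric.exists_matBound (hg : IsW1nMetric g) {L : Set M} (hL : IsCompact L) :
    ∃ B, 0 ≤ B ∧ ∀ x ∈ L, MatBound B (gram g (refChart n x) (refChart n x x)) := by
  obtain ⟨B₁, h0, h1⟩ := exists_common_bound (L := L) (ι := Fin n × Fin n)
    (f := fun i x => gram g (refChart n x) (refChart n x x) i.1 i.2) fun i =>
    exists_bound_refChart hL fun e he => hg.continuousOn e he i.1 i.2
  obtain ⟨B₂, h0', h2⟩ := exists_common_bound (L := L) (ι := Fin n × Fin n)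
    (f := fun i x => (gram g (refChart n x) (refChart n x x))⁻¹ i.1 i.2) fun i =>
    exists_bound_refChart (Φ := fun e y => (gram g e y)⁻¹ i.1 i.2) hL
      fun e he => hg.continuousOn_inv he i.1 i.2
  refine ⟨max B₁ B₂, h0.trans (le_max_left _ _), fun x hx => ⟨?_, fun i j => ?_, fun i j => ?_⟩⟩
  · exact hg.posDef (refChart_mem_atlas x) (refChart_mem_target x)
  · exact (h1 x hx (i, j)).trans (le_max_left _ _)
  · exact (h2 x hx (i, j)).trans (le_max_right _ _)

/-- The bounds for the background metric. -/
structure BackgroundBound (h : BilinField n M) (B : ℝ) (x : M) : Prop where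
  H : MatBound B (gram h (refChart n x) (refChart n x x))
  Ric : ∀ i j, |ricci h (refChart n x) (refChart n x x) i j| ≤ B
  Γ : ∀ k i j, |christoffel h (refChart n x) k i j (refChart n x x)| ≤ B
  dH : ∀ k i j, |partialD k (fun z => gram h (refChart n x) z i j) (refChart n x x)| ≤ B

omit [IsManifold (𝓡 n) ∞ M] in
theorem BackgroundBound.mono {h : BilinField n M} {B B' : ℝ} {x : M} (hb : BackgroundBound h B x)
    (hB : B ≤ B') : BackgroundBound h B' x :=
  ⟨hb.H.mono hB, fun i j => (hb.Ric i j).trans hB, fun k i j => (hb.Γ k i j).trans hB,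
    fun k i j => (hb.dH k i j).trans hB⟩

theorem SmoothMetric.exists_backgroundBound (h : SmoothMetric n M) {L : Set M}
    (hL : IsCompact L) : ∃ B, 0 ≤ B ∧ ∀ x ∈ L, BackgroundBound h.inner B x := by
  obtain ⟨B₁, p1, h1⟩ := h.isW1nMetric.exists_matBound hL
  obtain ⟨B₂, p2, h2⟩ := exists_common_bound (L := L) (ι := Fin n × Fin n)
    (f := fun i x => ricci h.inner (refChart n x) (refChart n x x) i.1 i.2) fun i =>
    exists_bound_refChart (Φ := fun e y => ricci h.inner e y i.1 i.2) hL
      fun e he => h.continuousOn_ricci he i.1 i.2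
  obtain ⟨B₃, p3, h3⟩ := exists_common_bound (L := L) (ι := Fin n × Fin n × Fin n)
    (f := fun i x => christoffel h.inner (refChart n x) i.1 i.2.1 i.2.2 (refChart n x x)) fun i =>
    exists_bound_refChart hL fun e he => (h.contDiffOn_christoffel he i.1 i.2.1 i.2.2).continuousOn
  obtain ⟨B₄, p4, h4⟩ := exists_common_bound (L := L) (ι := Fin n × Fin n × Fin n)
    (f := fun i x => partialD i.1 (fun z => gram h.inner (refChart n x) z i.2.1 i.2.2)
      (refChart n x x)) fun i =>
    exists_bound_refChart (Φ := fun e y => partialD i.1 (fun z => gram h.inner e z i.2.1 i.2.2) y)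
      hL fun e he => h.continuousOn_partialD_gram he i.1 i.2.1 i.2.2
  refine ⟨B₁ + B₂ + B₃ + B₄, by positivity, fun x hx => ⟨(h1 x hx).mono ?_, fun i j => ?_,
    fun k i j => ?_, fun k i j => ?_⟩⟩
  · linarith
  · linarith [h2 x hx (i, j)]
  · linarith [h3 x hx (k, i, j)]
  · linarith [h4 x hx (k, i, j)]

omit [IsManifold (𝓡 n) ∞ M] in
theorem BackgroundBound.chartJet {h g g' : BilinField n M} {B t : ℝ} {x : M}
    (hb : BackgroundBound h B x) (hg : MatBound B (gram g (refChart n x) (refChart n x x)))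
    (hg' : MatBound B (gram g' (refChart n x) (refChart n x x))) (ht : 0 ≤ t)
    (hd : ∀ i j, |gram g' (refChart n x) (refChart n x x) i j
      - gram g (refChart n x) (refChart n x x) i j| ≤ t) :
    (chartJet h g g' t (refChart n x) (refChart n x x)).Bounded B where
  G := hg
  G' := hg'
  H := hb.H
  Ric := hb.Ric
  Γ := hb.Γ
  dH := hb.dH
  t := ht
  D := absSum_nonneg _
  dist_G := hd
  dist_T := abs_le_absSum (covDeriv h g' (refChart n x) (refChart n x x)
    - covDeriv h g (refChart n x) (refChart n x x))

omit [IsManifold (𝓡 n) ∞ M] in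
/-- `L^p` norms on compact sets are controlled by `L^p` norms in finitely many charts. -/
theorem IsW1nMetric.exists_eLpNorm_le (hg : IsW1nMetric g) {L : Set M} (hL : IsCompact L)
    {p : ℝ≥0∞} (hp : 1 ≤ p) (hp' : p ≠ (∞ : ℝ≥0∞)) :
    ∃ (c : ℝ≥0∞) (P : Finset (range (chartCentre n (M := M)))), c ≠ (∞ : ℝ≥0∞) ∧
      ∀ Φ : OpenPartialHomeomorph M (Rn n) → Rn n → ℝ,
        eLpNorm (fun x => Φ (refChart n x) (refChart n x x)) p ((riemVolume g).restrict L)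
          ≤ c * ∑ q ∈ P, eLpNorm (Φ (chartAt (Rn n) (q : M))) p
            (volume.restrict (chartPiece n (q : M))) := by
  obtain ⟨c, P, hc, h⟩ := exists_lintegral_riemVolume_le (n := n)
    (fun e he => hg.continuousOn_det he) hL
  have hp0 : p ≠ 0 := (zero_lt_one.trans_le hp).ne'
  have hr1 : 1 ≤ p.toReal := by simpa using ENNReal.toReal_mono hp' hp
  have hr : 0 < p.toReal := zero_lt_one.trans_le hr1
  have hr' : 0 < 1 / p.toReal := by positivity
  refine ⟨c ^ (1 / p.toReal), P, ENNReal.rpow_ne_top_of_nonneg hr'.le hc, fun Φ => ?_⟩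
  simp only [eLpNorm_eq_lintegral_rpow_enorm_toReal hp0 hp']
  calc _ ≤ (c * ∑ q ∈ P, ∫⁻ y in chartPiece n (q : M),
        ‖Φ (chartAt (Rn n) (q : M)) y‖ₑ ^ p.toReal) ^ (1 / p.toReal) :=
        ENNReal.rpow_le_rpow (h fun e y => ‖Φ e y‖ₑ ^ p.toReal) hr'.le
    _ ≤ _ := by
        rw [ENNReal.mul_rpow_of_nonneg _ _ hr'.le]
        refine mul_le_mul' le_rfl (ENNReal.rpow_finsetSum_le P _ hr' ?_)
        rw [div_le_one hr]
        exact hr1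

omit [IsManifold (𝓡 n) ∞ M] in
theorem IsW1nMetric.memLp_refChart (hg : IsW1nMetric g) {L : Set M} (hL : IsCompact L)
    {p : ℝ≥0∞} (hp : 1 ≤ p) (hp' : p ≠ (∞ : ℝ≥0∞))
    {Φ : OpenPartialHomeomorph M (Rn n) → Rn n → ℝ}
    (hm : ∀ e ∈ atlas (Rn n) M, AEStronglyMeasurable (Φ e) (volume.restrict e.target))
    (hΦ : ∀ e ∈ atlas (Rn n) M, ∀ C ⊆ e.target, IsCompact C → MemLp (Φ e) p (volume.restrict C)) :
    MemLp (fun x => Φ (refChart n x) (refChart n x x)) p ((riemVolume g).restrict L) := by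
  obtain ⟨c, P, hc, h⟩ := hg.exists_eLpNorm_le hL hp hp'
  refine ⟨(aestronglyMeasurable_refChart hm).restrict, (h Φ).trans_lt
    (ENNReal.mul_lt_top hc.lt_top (ENNReal.sum_lt_top.2 fun q _ => ?_))⟩
  exact (hΦ _ (chart_mem_atlas (Rn n) _) _ (chartPiece_subset _) (isCompact_chartPiece _)).2

omit [IsManifold (𝓡 n) ∞ M] in
theorem IsW1nMetric.isFiniteMeasureOnCompacts (hg : IsW1nMetric g) :
    IsFiniteMeasureOnCompacts (riemVolume g) :=
  ⟨fun _ hL => riemVolume_lt_top (fun _ he => hg.continuousOn_det he) hL⟩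

variable (h : SmoothMetric n M)

theorem IsW1nMetric.memLp_absSum_covDeriv (hg : IsW1nMetric g) (hn : 1 ≤ n) {L : Set M}
    (hL : IsCompact L) : MemLp (fun x => absSum (covDeriv h.inner g (refChart n x) (refChart n x x)))
      n ((riemVolume h.inner).restrict L) :=
  h.isW1nMetric.memLp_refChart hL (by exact_mod_cast hn) (ENNReal.natCast_ne_top n)
    (Φ := fun e y => absSum (covDeriv h.inner g e y))
    (fun e he => aestronglyMeasurable_absSum fun k i j => hg.aestronglyMeasurable_covDeriv h he k i j)
    fun e he C hCe hC => memLp_absSum fun k i j => hg.memLp_covDeriv h he k i j hCe hC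

theorem IsW1nMetric.memLp_absSum_covDeriv_sub {g' : BilinField n M} (hg : IsW1nMetric g)
    (hg' : IsW1nMetric g') (hn : 1 ≤ n) {L : Set M} (hL : IsCompact L) :
    MemLp (fun x => absSum (covDeriv h.inner g' (refChart n x) (refChart n x x)
      - covDeriv h.inner g (refChart n x) (refChart n x x))) n
      ((riemVolume h.inner).restrict L) :=
  h.isW1nMetric.memLp_refChart hL (by exact_mod_cast hn) (ENNReal.natCast_ne_top n)
    (Φ := fun e y => absSum (covDeriv h.inner g' e y - covDeriv h.inner g e y))
    (fun e he => aestronglyMeasurable_absSum fun k i j =>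
      (hg'.aestronglyMeasurable_covDeriv h he k i j).sub (hg.aestronglyMeasurable_covDeriv h he k i j))
    fun e he C hCe hC => memLp_absSum fun k i j => (hg'.memLp_covDeriv h he k i j hCe hC).sub
      (hg.memLp_covDeriv h he k i j hCe hC)

variable {u : M → ℝ}

omit [T2Space M] [SecondCountableTopology M] [MeasurableSpace M] [BorelSpace M] [IsManifold (𝓡 n) ∞ M] in
theorem IsTest.continuous (hu : IsTest (n := n) u) : Continuous u := hu.1.continuous

omit [T2Space M] [SecondCountableTopology M] [MeasurableSpace M] [BorelSpace M] in
theorem IsTest.continuousOn_chartGrad (hu : IsTest (n := n) u)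
    {e : OpenPartialHomeomorph M (Rn n)} (he : e ∈ atlas (Rn n) M) :
    ContinuousOn (chartGrad u e) e.target :=
  continuousOn_finsetSum _ fun k _ => (hu.continuousOn_partialD he k).abs

/-- The product rule replaces the chosen weak gradient. The equality is only almost everywhere
because a weak derivative is determined up to null sets. -/
theorem scalarCurvDensity_ae_eq (hg : IsW1nMetric g) (hu : IsTest (n := n) u) :
    scalarCurvDensity h.inner g (fun x => u x ^ 2)
      =ᵐ[riemVolume h.inner] fun x => chartDensity h.inner g u (refChart n x) (refChart n x x) := by
  filter_upwards [ae_riemVolume_refChart (g := h.inner) fun e he => hg.ae_density_eq h he hu]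
    with x hx
  rw [← hx, scalarCurvDensity]
  simp only [refChart_symm_apply]

/-- The scalar curvature density is integrable. -/
theorem IsW1nMetric.integrable_chartDensity (hg : IsW1nMetric g) (hn : 2 ≤ n)
    (hu : IsTest (n := n) u) :
    Integrable (fun x => chartDensity h.inner g u (refChart n x) (refChart n x x))
      (riemVolume h.inner) := by
  have hL : IsCompact (tsupport u) := hu.2
  have hLm := hL.isClosed.measurableSet
  have hfin := h.isW1nMetric.isFiniteMeasureOnCompacts
  have hm := aestronglyMeasurable_refChart (g := h.inner)
    fun e he => hg.aestronglyMeasurable_chartDensity h he hu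
  rw [← integrableOn_iff_integrable_of_support_subset (s := tsupport u)]
  swap
  · refine Function.support_subset_iff'.2 fun x hx => ?_
    simp [chartDensity, refChart_symm_apply, image_eq_zero_of_notMem_tsupport hx]
  obtain ⟨B₁, p1, h1⟩ := hg.exists_matBound hL
  obtain ⟨B₂, p2, h2⟩ := h.exists_backgroundBound hL
  obtain ⟨B₃, p3, h3⟩ := exists_bound_refChart hL fun e he => hu.continuousOn_chartGrad he
  obtain ⟨B₄, hB₄⟩ := hL.exists_bound_of_continuousOn hu.continuous.continuousOn
  obtain ⟨C, hC, hb⟩ := exists_chartDensity_bound n M (B₁ + B₂)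
  have hfm : IsFiniteMeasure ((riemVolume h.inner).restrict (tsupport u)) :=
    ⟨by simpa using hL.measure_lt_top⟩
  set τ : M → ℝ := fun x => 1 + absSum (covDeriv h.inner g (refChart n x) (refChart n x x)) with hτ
  have hT := hg.memLp_absSum_covDeriv h (by omega) hL
  have hc : MemLp (fun _ : M => (1 : ℝ)) n ((riemVolume h.inner).restrict (tsupport u)) :=
    memLp_const 1
  have hn2 : (2 : ℝ≥0∞) ≤ n := by exact_mod_cast hn
  -- The density is bounded by a multiple of `τ²`, as `u` and its gradient are bounded on the
  -- support. On a set of finite measure `Lⁿ` is contained in `L²` because `2 ≤ n`.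
  have hτL : MemLp τ 2 ((riemVolume h.inner).restrict (tsupport u)) :=
    (hc.add hT).mono_exponent hn2
  refine Integrable.mono' (hτL.integrable_sq.const_mul (C * (B₄ ^ 2 + B₄ * B₃))) hm.restrict
    ((ae_restrict_iff' hLm).2 (Eventually.of_forall fun x hx => ?_))
  have h0 := absSum_nonneg (covDeriv h.inner g (refChart n x) (refChart n x x))
  -- The estimate for pairs is used with `g' = g` and `t = 0`, where the size reduces to `τ`.
  have hj := (hb h.inner g g 0 u _ _ (((h2 x hx).mono (le_add_of_nonneg_left p1)).chartJet
    ((h1 x hx).mono (le_add_of_nonneg_right p2)) ((h1 x hx).mono (le_add_of_nonneg_right p2))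
    le_rfl (fun i j => by simp))).1
  have hs : chartSize h.inner g g (refChart n x) (refChart n x x) = τ x := by
    simp [chartSize, hτ, absSum]
  have hu1 := hB₄ x hx
  have hu2 := (le_abs_self _).trans (h3 x hx)
  have hu3 := chartGrad_nonneg u (refChart n x) (refChart n x x)
  have hτ1 : 1 ≤ τ x := by simp only [hτ]; linarith
  rw [hs, refChart_symm_apply] at hj
  rw [Real.norm_eq_abs] at hu1 ⊢
  have hB4 : 0 ≤ B₄ := (abs_nonneg _).trans hu1
  refine hj.trans ?_
  rw [mul_assoc C]
  refine mul_le_mul_of_nonneg_left ?_ hC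
  have e1 : u x ^ 2 ≤ B₄ ^ 2 := sq_le_sq' (neg_le_of_abs_le hu1) (le_of_abs_le hu1)
  calc u x ^ 2 * τ x * τ x + |u x| * chartGrad u (refChart n x) (refChart n x x) * τ x
      ≤ B₄ ^ 2 * τ x * τ x + B₄ * B₃ * (τ x * τ x) := by
        gcongr
        nlinarith
    _ = _ := by ring

end CompactBounds

/-! ### Energy, gradient and Sobolev bounds as `L^p` norms. -/

section CoreEstimate

variable {n : ℕ} {M : Type*} [TopologicalSpace M] [ChartedSpace (Rn n) M]
  [T2Space M] [SecondCountableTopology M] [MeasurableSpace M] [BorelSpace M]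

theorem gradSq_eq_quadForm (g : BilinField n M) (u : M → ℝ) (x : M) :
    gradSq g u x = quadForm (gram g (refChart n x) (refChart n x x))⁻¹
      fun k => partialD k (fun z => u ((refChart n x).symm z)) (refChart n x x) := rfl

variable [IsManifold (𝓡 n) ∞ M] {g : BilinField n M} {u : M → ℝ}

theorem IsW1nMetric.gradSq_nonneg (hg : IsW1nMetric g) (u : M → ℝ) (x : M) : 0 ≤ gradSq g u x := by
  rw [gradSq_eq_quadForm]
  exact quadForm_nonneg (hg.posDef (refChart_mem_atlas x) (refChart_mem_target x)).inv _

omit [IsManifold (𝓡 n) ∞ M] in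
theorem gradSq_eq_zero (g : BilinField n M) {x : M} (hx : x ∉ tsupport u) : gradSq g u x = 0 := by
  have hc : ContinuousAt (refChart n x).symm (refChart n x x) :=
    (refChart n x).continuousAt_symm (refChart_mem_target x)
  have h0 : u =ᶠ[𝓝 ((refChart n x).symm (refChart n x x))] 0 := by
    rw [refChart_symm_apply]
    exact notMem_tsupport_iff_eventuallyEq.1 hx
  have h1 : (fun z => u ((refChart n x).symm z)) =ᶠ[𝓝 (refChart n x x)] 0 := hc.eventually h0
  have h2 : ∀ k, partialD k (fun z => u ((refChart n x).symm z)) (refChart n x x) = 0 := fun k => by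
    rw [partialD, h1.fderiv_eq]
    simp
  simp [gradSq, h2]

theorem IsW1nMetric.integrable_gradSq (hg : IsW1nMetric g) (hu : IsTest (n := n) u) :
    Integrable (gradSq g u) (riemVolume g) := by
  have hL : IsCompact (tsupport u) := hu.2
  have hfin := hg.isFiniteMeasureOnCompacts
  let Φ : OpenPartialHomeomorph M (Rn n) → Rn n → ℝ := fun e y => ∑ i, ∑ j,
    (gram g e y)⁻¹ i j * partialD i (fun z => u (e.symm z)) y * partialD j (fun z => u (e.symm z)) y
  have hcont : ∀ e ∈ atlas (Rn n) M, ContinuousOn (Φ e) e.target :=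
    fun e he => continuousOn_finsetSum _ fun i _ => continuousOn_finsetSum _ fun j _ =>
      ((hg.continuousOn_inv he i j).mul (hu.continuousOn_partialD he i)).mul
        (hu.continuousOn_partialD he j)
  rw [← integrableOn_iff_integrable_of_support_subset (s := tsupport u)
    (Function.support_subset_iff'.2 fun x hx => gradSq_eq_zero g hx)]
  obtain ⟨B, -, hB⟩ := exists_bound_refChart (Φ := Φ) hL hcont
  have hm : AEStronglyMeasurable (gradSq g u) (riemVolume g) :=
    aestronglyMeasurable_refChart (Φ := Φ) fun e he =>
      (hcont e he).aestronglyMeasurable e.open_target.measurableSet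
  have hfm : IsFiniteMeasure ((riemVolume g).restrict (tsupport u)) :=
    ⟨by simpa using hL.measure_lt_top⟩
  have hb : ∀ᵐ x ∂(riemVolume g).restrict (tsupport u), ‖gradSq g u x‖ ≤ B :=
    (ae_restrict_iff' hL.isClosed.measurableSet).2 (Eventually.of_forall hB)
  exact Integrable.of_bound hm.restrict B hb

theorem IsW1nMetric.energy_nonneg (hg : IsW1nMetric g) (u : M → ℝ) : 0 ≤ energy g u :=
  integral_nonneg fun x => hg.gradSq_nonneg u x

omit [IsManifold (𝓡 n) ∞ M] in
-- Cauchy–Schwarz for the form `g⁻¹`, whose inverse is `g`, bounds each squared derivative by `B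
-- |∇u|²`. One factor `n` comes from passing from `ℓ¹` to `ℓ²`, the other from the sum.
theorem chartGrad_sq_le {B : ℝ} {x : M}
    (hG : MatBound B (gram g (refChart n x) (refChart n x x))) (u : M → ℝ) :
    chartGrad u (refChart n x) (refChart n x x) ^ 2 ≤ n ^ 2 * B * gradSq g u x := by
  have u' : IsUnit (gram g (refChart n x) (refChart n x x)).det :=
    hG.posDef.isUnit.map Matrix.detMonoidHom
  have hq := quadForm_nonneg hG.posDef.inv
    fun k => partialD k (fun z => u ((refChart n x).symm z)) (refChart n x x)
  rw [← gradSq_eq_quadForm] at hq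
  calc chartGrad u (refChart n x) (refChart n x x) ^ 2
      ≤ n * ∑ k, |partialD k (fun z => u ((refChart n x).symm z)) (refChart n x x)| ^ 2 := by
        simpa [chartGrad] using sq_sum_le_card_mul_sum_sq (s := Finset.univ)
          (f := fun k : Fin n => |partialD k (fun z => u ((refChart n x).symm z)) (refChart n x x)|)
    _ ≤ n * ∑ _k : Fin n, B * gradSq g u x := by
        gcongr with k
        rw [sq_abs]
        refine (sq_le_inv_mul_quadForm hG.posDef.inv
          (fun k => partialD k (fun z => u ((refChart n x).symm z)) (refChart n x x)) k).trans ?_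
        rw [Matrix.nonsing_inv_nonsing_inv _ u', ← gradSq_eq_quadForm]
        gcongr
        exact (le_abs_self _).trans (hG.entry k k)
    _ = n ^ 2 * B * gradSq g u x := by
        simp only [Finset.sum_const, Finset.card_univ, Fintype.card_fin, nsmul_eq_mul]
        ring

/-- The gradient of `u` on a set where `g` is comparable with the background metric. -/
theorem IsW1nMetric.eLpNorm_chartGrad_le (hg : IsW1nMetric g) (hu : IsTest (n := n) u)
    {ν : Measure M} {K : Set M} {B C : ℝ} (hB : 0 ≤ B) (hC : 0 ≤ C) (hK : MeasurableSet K)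
    (hν : ν.restrict K ≤ ENNReal.ofReal C • (riemVolume g).restrict K)
    (hG : ∀ x ∈ K, MatBound B (gram g (refChart n x) (refChart n x x))) :
    eLpNorm (fun x => chartGrad u (refChart n x) (refChart n x x)) 2 (ν.restrict K)
      ≤ ENNReal.ofReal (Real.sqrt (C * (n ^ 2 * B)) * Real.sqrt (energy g u)) := by
  have h0 : ∀ x, 0 ≤ n ^ 2 * B * gradSq g u x := fun x =>
    mul_nonneg (by positivity) (hg.gradSq_nonneg u x)
  rw [eLpNorm_eq_lintegral_rpow_enorm_toReal (by simp) (by simp), ← Real.sqrt_mul (by positivity),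
    Real.sqrt_eq_rpow, ← ENNReal.ofReal_rpow_of_nonneg
      (mul_nonneg (by positivity) (hg.energy_nonneg u)) (by norm_num)]
  simp only [ENNReal.toReal_ofNat]
  refine ENNReal.rpow_le_rpow ?_ (by norm_num)
  calc ∫⁻ x in K, ‖chartGrad u (refChart n x) (refChart n x x)‖ₑ ^ (2 : ℝ) ∂ν
      ≤ ∫⁻ x in K, ENNReal.ofReal (n ^ 2 * B * gradSq g u x) ∂ν := by
        refine setLIntegral_mono' hK fun x hx => ?_
        rw [Real.enorm_eq_ofReal (chartGrad_nonneg _ _ _), ENNReal.ofReal_rpow_of_nonneg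
          (chartGrad_nonneg _ _ _) (by norm_num)]
        exact ENNReal.ofReal_le_ofReal (by exact_mod_cast chartGrad_sq_le (hG x hx) u)
    _ ≤ ∫⁻ x, ENNReal.ofReal (n ^ 2 * B * gradSq g u x)
          ∂(ENNReal.ofReal C • (riemVolume g).restrict K) := lintegral_mono' hν le_rfl
    _ ≤ ENNReal.ofReal C * ∫⁻ x, ENNReal.ofReal (n ^ 2 * B * gradSq g u x) ∂(riemVolume g) := by
        rw [lintegral_smul_measure, smul_eq_mul]
        exact mul_le_mul' le_rfl (lintegral_mono' Measure.restrict_le_self le_rfl)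
    _ = ENNReal.ofReal (C * (n ^ 2 * B) * energy g u) := by
        rw [← ofReal_integral_eq_lintegral_ofReal ((hg.integrable_gradSq hu).const_mul _)
          (Eventually.of_forall h0), integral_const_mul, ← ENNReal.ofReal_mul hC, energy]
        congr 1
        ring

/-- The Sobolev exponent. -/
noncomputable def sobolevExp (n : ℕ) : ℝ := 2 * (n : ℝ) / ((n : ℝ) - 2)

theorem sobolevExp_pos (hn : 3 ≤ n) : 0 < sobolevExp n := by
  have : (3 : ℝ) ≤ n := by exact_mod_cast hn
  exact div_pos (by linarith) (by linarith)

/-- The identity `(n - 2) / (2n) + 1 / n = 1 / 2`: a Sobolev function times an `Lⁿ` coefficient lies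
in `L²`. -/
theorem holderTriple_sobolevExp (hn : 3 ≤ n) :
    ENNReal.HolderTriple (ENNReal.ofReal (sobolevExp n)) n 2 where
  inv_add_inv_eq_inv := by
    have h3 : (3 : ℝ) ≤ n := by exact_mod_cast hn
    have hn0 : (0 : ℝ) < n := by linarith
    have h1 : ((n : ℝ≥0∞))⁻¹ = ENNReal.ofReal ((n : ℝ)⁻¹) := by
      rw [ENNReal.ofReal_inv_of_pos hn0, ENNReal.ofReal_natCast]
    have h2 : (2 : ℝ≥0∞)⁻¹ = ENNReal.ofReal ((2 : ℝ)⁻¹) := by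
      rw [ENNReal.ofReal_inv_of_pos two_pos, ENNReal.ofReal_ofNat]
    rw [h1, h2, ← ENNReal.ofReal_inv_of_pos (sobolevExp_pos hn), ← ENNReal.ofReal_add
      (inv_nonneg.2 (sobolevExp_pos hn).le) (inv_nonneg.2 hn0.le)]
    congr 1
    have : (n : ℝ) - 2 ≠ 0 := by linarith
    rw [sobolevExp]
    field_simp
    ring

/-- The Sobolev inequality, as a bound of an `L^q` norm. -/
theorem IsW1nMetric.eLpNorm_le_of_sobolevBound (hg : IsW1nMetric g) (hn : 3 ≤ n)
    {Cs : ℝ} (hS : SobolevBound g Cs) (hu : IsTest (n := n) u) :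
    eLpNorm u (ENNReal.ofReal (sobolevExp n)) (riemVolume g)
      ≤ ENNReal.ofReal (Real.sqrt (max Cs 0) * Real.sqrt (energy g u)) := by
  have hfin := hg.isFiniteMeasureOnCompacts
  have hq := sobolevExp_pos hn
  have h3 : (3 : ℝ) ≤ n := by exact_mod_cast hn
  have hE := hg.energy_nonneg u
  have hint : Integrable (fun x => |u x| ^ sobolevExp n) (riemVolume g) := by
    refine Continuous.integrable_of_hasCompactSupport
      (hu.continuous.abs.rpow_const fun x => Or.inr hq.le) ?_
    exact hu.2.comp_left (g := fun r => |r| ^ sobolevExp n) (by simp [hq.ne'])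
  have hI0 : 0 ≤ ∫ x, |u x| ^ sobolevExp n ∂riemVolume g :=
    integral_nonneg fun x => Real.rpow_nonneg (abs_nonneg _) _
  -- No sign is assumed for `Cs`; it is replaced by `max Cs 0` so that square roots can be taken.
  have hb : (∫ x, |u x| ^ sobolevExp n ∂riemVolume g) ^ (((n : ℝ) - 2) / n)
      ≤ max Cs 0 * energy g u :=
    (hS u hu).trans (mul_le_mul_of_nonneg_right (le_max_left _ _) hE)
  rw [eLpNorm_eq_lintegral_rpow_enorm_toReal (by simpa using hq) (by simp),
    ENNReal.toReal_ofReal hq.le]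
  have h1 : ∫⁻ x, ‖u x‖ₑ ^ sobolevExp n ∂riemVolume g
      = ENNReal.ofReal (∫ x, |u x| ^ sobolevExp n ∂riemVolume g) := by
    rw [ofReal_integral_eq_lintegral_ofReal hint
      (Eventually.of_forall fun x => Real.rpow_nonneg (abs_nonneg _) _)]
    refine lintegral_congr fun x => ?_
    rw [← ENNReal.ofReal_rpow_of_nonneg (abs_nonneg _) hq.le, ← Real.norm_eq_abs,
      ofReal_norm]
  rw [h1, ENNReal.ofReal_rpow_of_nonneg hI0 (by positivity), ← Real.sqrt_mul (le_max_right _ _)]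
  refine ENNReal.ofReal_le_ofReal (Real.le_sqrt_of_sq_le ?_)
  refine le_trans (le_of_eq ?_) hb
  rw [← Real.rpow_natCast, ← Real.rpow_mul hI0]
  congr 1
  have : (n : ℝ) - 2 ≠ 0 := by linarith
  rw [sobolevExp]
  push_cast
  field_simp

/-- The Sobolev inequality concerns `μ_g`, while the density is integrated against `μ_h`; this
passes from one to the other on `K`, scaling the measure by `C` and so the norm by `C ^ (1 / q)`. -/
theorem eLpNorm_restrict_le_of_le_smul {α : Type*} [MeasurableSpace α] {μ ν : Measure α}
    {K : Set α} {C : ℝ} (hν : ν.restrict K ≤ ENNReal.ofReal C • μ.restrict K) (hC : 0 ≤ C)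
    (f : α → ℝ) {q : ℝ} (hq : 0 < q) {b : ℝ} 
    (hb : eLpNorm f (ENNReal.ofReal q) μ ≤ ENNReal.ofReal b) :
    eLpNorm f (ENNReal.ofReal q) (ν.restrict K) ≤ ENNReal.ofReal (C ^ (1 / q) * b) := by
  refine (eLpNorm_mono_measure f hν).trans ((eLpNorm_smul_measure_le _ _ _ _).trans ?_)
  have h1 : (1 / ENNReal.ofReal q).toReal = 1 / q := by
    rw [ENNReal.toReal_div, ENNReal.toReal_ofReal hq.le]
    simp
  rw [h1, smul_eq_mul, ENNReal.ofReal_mul (Real.rpow_nonneg hC _),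
    ENNReal.ofReal_rpow_of_nonneg hC (by positivity)]
  exact mul_le_mul' le_rfl ((eLpNorm_mono_measure f Measure.restrict_le_self).trans hb)

end CoreEstimate

/-! ### The main estimate for a pair of metrics. -/

section CoreEstimate

variable {n : ℕ} {M : Type*} [TopologicalSpace M] [ChartedSpace (Rn n) M]
  [T2Space M] [SecondCountableTopology M] [MeasurableSpace M] [BorelSpace M]
  [IsManifold (𝓡 n) ∞ M]

/-- `∑ |∇̃_k g_ij|` at the point `x`. -/
noncomputable def covSum (h g : BilinField n M) (x : M) : ℝ :=
  absSum (covDeriv h g (refChart n x) (refChart n x x))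

/-- `∑ |∇̃_k g'_ij - ∇̃_k g_ij|` at the point `x`. -/
noncomputable def covDistSum (h g g' : BilinField n M) (x : M) : ℝ :=
  absSum (covDeriv h g' (refChart n x) (refChart n x x)
    - covDeriv h g (refChart n x) (refChart n x x))

theorem eLpNorm_size_le {α : Type*} [MeasurableSpace α] {μ : Measure α} [IsFiniteMeasure μ]
    {p : ℝ≥0∞} (hp : 1 ≤ p) {τ D : α → ℝ} (hτ : AEStronglyMeasurable τ μ)
    (hD : AEStronglyMeasurable D μ) {a d : ℝ} (ha : 0 ≤ a) (hd : 0 ≤ d)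
    (h1 : eLpNorm τ p μ ≤ ENNReal.ofReal a) (h2 : eLpNorm D p μ ≤ ENNReal.ofReal d) :
    eLpNorm (fun x => 1 + τ x + D x) p μ
      ≤ ENNReal.ofReal ((eLpNorm (fun _ : α => (1 : ℝ)) p μ).toReal + a + d) := by
  have hc : eLpNorm (fun _ : α => (1 : ℝ)) p μ ≠ (∞ : ℝ≥0∞) := (memLp_const 1).2.ne
  have hm : AEStronglyMeasurable (fun _ : α => (1 : ℝ)) μ := aestronglyMeasurable_const
  rw [ENNReal.ofReal_add (by positivity) hd, ENNReal.ofReal_add (by positivity) ha,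
    ENNReal.ofReal_toReal hc]
  exact (eLpNorm_add_le (hm.add hτ) hD hp).trans
    (add_le_add ((eLpNorm_add_le hm hτ hp).trans (add_le_add le_rfl h1)) h2)

theorem eLpNorm_gap_le {α : Type*} [MeasurableSpace α] {μ : Measure α}
    {p : ℝ≥0∞} (hp : 1 ≤ p) {X D : α → ℝ} (hX : AEStronglyMeasurable X μ)
    (hD : AEStronglyMeasurable D μ) {t Y d : ℝ} (ht : 0 ≤ t) (hY : 0 ≤ Y) (hd : 0 ≤ d)
    (h1 : eLpNorm X p μ ≤ ENNReal.ofReal Y) (h2 : eLpNorm D p μ ≤ ENNReal.ofReal d) :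
    eLpNorm (fun x => t * X x + D x) p μ ≤ ENNReal.ofReal (t * Y + d) := by
  rw [ENNReal.ofReal_add (by positivity) hd, ENNReal.ofReal_mul ht]
  refine (eLpNorm_add_le (hX.const_mul t) hD hp).trans (add_le_add ?_ h2)
  refine (eLpNorm_le_mul_eLpNorm_of_ae_le_mul (g := X) (c := t)
    (Eventually.of_forall fun x => ?_) p).trans (mul_le_mul' le_rfl h1)
  rw [norm_mul, Real.norm_of_nonneg ht]

/-- The difference of the pairings is an integral over the set where the metrics differ. -/
theorem scalarCurvPairing_sub_eq (h : SmoothMetric n M) {g g' : BilinField n M}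
    (hg : IsW1nMetric g) (hg' : IsW1nMetric g') (hn : 2 ≤ n) {K : Set M} (hK : IsClosed K)
    (hgg : ∀ x ∉ K, g' x = g x) {u : M → ℝ} (hu : IsTest (n := n) u) :
    scalarCurvPairing h.inner g' (fun x => u x ^ 2) - scalarCurvPairing h.inner g (fun x => u x ^ 2)
      = ∫ x in K, (chartDensity h.inner g' u (refChart n x) (refChart n x x)
        - chartDensity h.inner g u (refChart n x) (refChart n x x)) ∂(riemVolume h.inner) := by
  rw [scalarCurvPairing, scalarCurvPairing, integral_congr_ae (scalarCurvDensity_ae_eq h hg' hu),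
    integral_congr_ae (scalarCurvDensity_ae_eq h hg hu),
    ← integral_sub (hg'.integrable_chartDensity h hn hu) (hg.integrable_chartDensity h hn hu)]
  refine (setIntegral_eq_integral_of_ae_compl_eq_zero ?_).symm
  filter_upwards [ae_riemVolume_refChart (g := h.inner)
    (Q := fun e y => e.symm y ∉ K → chartDensity h.inner g' u e y = chartDensity h.inner g u e y)
    fun e he => hg.ae_chartDensity_eq h hg' hK hgg he u] with x hx hxK
  rw [refChart_symm_apply] at hx
  rw [hx hxK, sub_self]

/-- Outside `K` the densities cancel. On `K` the pointwise bound, Hölder's inequality and the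
Sobolev inequality produce two factors `√(energy)`, the factor `t (m + a + d) + d` from the `Lⁿ`
norm of the gap, and the last bracket from the size and the gradient. The constants are chosen
before the metrics; both parts of the theorem rest on this uniformity. -/
theorem exists_scalarCurvPairing_bound (hn : 3 ≤ n) (h : SmoothMetric n M) {K : Set M}
    (hK : IsCompact K) (Cs : ℝ) {B : ℝ} (hB : 0 ≤ B) : ∃ C m, 0 ≤ C ∧ 0 ≤ m ∧
    ∀ g g' : BilinField n M, IsW1nMetric g → IsW1nMetric g' → SobolevBound g Cs →
      (∀ x ∉ K, g' x = g x) →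
      (∀ x ∈ K, MatBound B (gram g (refChart n x) (refChart n x x))) →
      (∀ x ∈ K, MatBound B (gram g' (refChart n x) (refChart n x x))) →
      ∀ t a d : ℝ, 0 ≤ t → 0 ≤ a → 0 ≤ d →
      (∀ x ∈ K, ∀ i j, |gram g' (refChart n x) (refChart n x x) i j
        - gram g (refChart n x) (refChart n x x) i j| ≤ t) →
      eLpNorm (covSum h.inner g) n ((riemVolume h.inner).restrict K) ≤ ENNReal.ofReal a →
      eLpNorm (covDistSum h.inner g g') n ((riemVolume h.inner).restrict K)
        ≤ ENNReal.ofReal d →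
      ∀ u : M → ℝ, IsTest (n := n) u →
        |scalarCurvPairing h.inner g' (fun x => u x ^ 2)
            - scalarCurvPairing h.inner g (fun x => u x ^ 2)|
          ≤ C * (t * (m + a + d) + d) * (m + a + d + 1) * energy g u := by
  have hfin := h.isW1nMetric.isFiniteMeasureOnCompacts
  have hKm := hK.isClosed.measurableSet
  set μ := (riemVolume h.inner).restrict K with hμ
  have hfm : IsFiniteMeasure μ := ⟨by simpa [hμ] using hK.measure_lt_top⟩
  have hp : (1 : ℝ≥0∞) ≤ n := by exact_mod_cast (by omega : 1 ≤ n)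
  have hq := sobolevExp_pos hn
  have hH := holderTriple_sobolevExp hn
  obtain ⟨B₀, hB₀, hb⟩ := h.exists_backgroundBound hK
  obtain ⟨C₀, hC₀, hd⟩ := exists_chartDensity_bound n M (B + B₀)
  -- `c₀` compares `μ_h` with `μ_g` on `K`; `c₁` and `c₂` are the resulting constants for the `L^q`
  -- norm of `u` and the `L²` norm of its derivatives.
  set c₀ : ℝ := n.factorial * (B + B₀) ^ n with hc₀
  have hc₀' : 0 ≤ c₀ := by positivity
  set c₁ : ℝ := c₀ ^ (1 / sobolevExp n) * Real.sqrt (max Cs 0)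
  have hc₁ : 0 ≤ c₁ := by positivity
  set c₂ : ℝ := Real.sqrt (c₀ * (n ^ 2 * (B + B₀)))
  have hc₂ : 0 ≤ c₂ := by positivity
  -- The contribution of the summand `1` of the size to its `Lⁿ` norm on `K`.
  set m : ℝ := (eLpNorm (fun _ : M => (1 : ℝ)) n μ).toReal
  have hm : 0 ≤ m := ENNReal.toReal_nonneg
  refine ⟨C₀ * c₁ * (c₁ + c₂), m, by positivity, hm, ?_⟩
  intro g g' hg hg' hS hgg hGB hGB' t a d ht ha hd0 hGG hT hD u hu
  have hE := hg.energy_nonneg u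
  have hbK : ∀ x ∈ K, BackgroundBound h.inner (B + B₀) x := fun x hx =>
    (hb x hx).mono (by linarith)
  have hGK : ∀ x ∈ K, MatBound (B + B₀) (gram g (refChart n x) (refChart n x x)) := fun x hx =>
    (hGB x hx).mono (by linarith)
  have hGK' : ∀ x ∈ K, MatBound (B + B₀) (gram g' (refChart n x) (refChart n x x)) := fun x hx =>
    (hGB' x hx).mono (by linarith)
  have hν : μ ≤ ENNReal.ofReal c₀ • (riemVolume g).restrict K :=
    riemVolume_restrict_le hKm hc₀' fun x hx => (hGK x hx).sqrt_det_le (hbK x hx).H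
  have nu : eLpNorm u (ENNReal.ofReal (sobolevExp n)) μ
      ≤ ENNReal.ofReal (c₁ * Real.sqrt (energy g u)) := by
    have := eLpNorm_restrict_le_of_le_smul hν hc₀' u hq
      (hg.eLpNorm_le_of_sobolevBound hn hS hu)
    rwa [← mul_assoc] at this
  have na := hg.eLpNorm_chartGrad_le hu (by linarith : 0 ≤ B + B₀) hc₀' hKm hν hGK
  have mT : AEStronglyMeasurable (covSum h.inner g) μ :=
    (hg.memLp_absSum_covDeriv h (by omega) hK).1
  have mD : AEStronglyMeasurable (covDistSum h.inner g g') μ :=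
    (hg.memLp_absSum_covDeriv_sub h hg' (by omega) hK).1
  have mX : AEStronglyMeasurable
      (fun x => 1 + covSum h.inner g x + covDistSum h.inner g g' x) μ :=
    (aestronglyMeasurable_const.add mT).add mD
  have nX := eLpNorm_size_le hp mT mD ha hd0 hT hD
  have hY : 0 ≤ m + a + d := by positivity
  have nE := eLpNorm_gap_le hp mX mD ht hY hd0 nX hD
  have ma : AEStronglyMeasurable (fun x => chartGrad u (refChart n x) (refChart n x x)) μ :=
    (aestronglyMeasurable_refChart (Φ := chartGrad u) fun e he =>
      (hu.continuousOn_chartGrad he).aestronglyMeasurable e.open_target.measurableSet).restrict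
  have mE := (mX.const_mul t).add mD
  have key := eLpNorm_one_le_of_abs_le (μ := μ) (p := n) (q := ENNReal.ofReal (sobolevExp n))
    (f := fun x => chartDensity h.inner g' u (refChart n x) (refChart n x x)
        - chartDensity h.inner g u (refChart n x) (refChart n x x)) hC₀
    hu.continuous.aestronglyMeasurable ma mX mE
    ((ae_restrict_iff' hKm).2 (Eventually.of_forall fun x hx => by
      have := (hd h.inner g g' t u _ _ ((hbK x hx).chartJet (hGK x hx) (hGK' x hx) ht
        (hGG x hx))).2
      rw [refChart_symm_apply] at this
      exact this))
  rw [scalarCurvPairing_sub_eq h hg hg' (by omega) hK.isClosed hgg hu]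
  have h1 := enorm_integral_le_lintegral_enorm (μ := μ)
    (fun x => chartDensity h.inner g' u (refChart n x) (refChart n x x)
        - chartDensity h.inner g u (refChart n x) (refChart n x x))
  rw [← eLpNorm_one_eq_lintegral_enorm] at h1
  set S := Real.sqrt (energy g u) with hSdef
  have hS0 : 0 ≤ S := Real.sqrt_nonneg _
  set Y := m + a + d
  set ε := t * Y + d
  have hε : 0 ≤ ε := by positivity
  have h2 := h1.trans (key.trans (mul_le_mul' le_rfl (mul_le_mul' (mul_le_mul' nu nE)
    (add_le_add (mul_le_mul' nu nX) na))))
  rw [← ENNReal.ofReal_mul (by positivity), ← ENNReal.ofReal_mul (by positivity),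
    ← ENNReal.ofReal_add (by positivity) (by positivity), ← ENNReal.ofReal_mul (by positivity),
    ← ENNReal.ofReal_mul hC₀, Real.enorm_eq_ofReal_abs,
    ENNReal.ofReal_le_ofReal_iff (by positivity)] at h2
  refine h2.trans ?_
  have hSS : S * S = energy g u := Real.mul_self_sqrt hE
  calc _ = C₀ * c₁ * ε * (c₁ * Y + c₂) * (S * S) := by ring
    _ = C₀ * c₁ * ε * (c₁ * Y + c₂) * energy g u := by rw [hSS]
    _ ≤ C₀ * c₁ * ε * ((c₁ + c₂) * (Y + 1)) * energy g u := by
        gcongr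
        nlinarith [mul_nonneg hc₂ hY]
    _ = _ := by ring

end CoreEstimate

/-! ### The quantitative bound with a modulus depending on `t`. -/

section QuantitativeBound

variable {n : ℕ} {M : Type*} [TopologicalSpace M] [ChartedSpace (Rn n) M]
  [T2Space M] [SecondCountableTopology M] [MeasurableSpace M] [BorelSpace M]
  [IsManifold (𝓡 n) ∞ M]

theorem absSum_le_norm3 {B : ℝ} {H : Matrix (Fin n) (Fin n) ℝ} (hH : MatBound B H) (hB : 1 ≤ B)
    (T : Fin n → Fin n → Fin n → ℝ) : absSum T ≤ n ^ 3 * B ^ 2 * norm3 H T := by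
  calc absSum T ≤ ∑ _k : Fin n, ∑ _i : Fin n, ∑ _j : Fin n, B ^ 2 * norm3 H T :=
        Finset.sum_le_sum fun k _ => Finset.sum_le_sum fun i _ => Finset.sum_le_sum fun j _ =>
          abs_le_norm3 hH hB T k i j
    _ = _ := by
        simp only [Finset.sum_const, Finset.card_univ, Fintype.card_fin, nsmul_eq_mul]
        ring

/-- Turns a bound on the integral of an `n`-th power into one on the norm. For negative `A` the
number `ENNReal.ofReal A` is zero, so `max A 0` loses nothing. -/
theorem eLpNorm_le_of_lintegral_pow_le {α : Type*} [MeasurableSpace α] {μ : Measure α}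
    {K : Set α} (hK : MeasurableSet K) (hn : n ≠ 0) {f w : α → ℝ} {c A : ℝ} (hc : 0 ≤ c)
    (hw : ∀ x ∈ K, 0 ≤ w x) (hf : ∀ x ∈ K, |f x| ≤ c * w x)
    (h : ∫⁻ x in K, ENNReal.ofReal (w x ^ n) ∂μ ≤ ENNReal.ofReal A) :
    eLpNorm f n (μ.restrict K) ≤ ENNReal.ofReal (c * max A 0 ^ (1 / (n : ℝ))) := by
  have h1 : eLpNorm f n (μ.restrict K) ≤ ENNReal.ofReal c * eLpNorm w n (μ.restrict K) :=
    eLpNorm_le_mul_eLpNorm_of_ae_le_mul ((ae_restrict_iff' hK).2 (Eventually.of_forall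
      fun x hx => (hf x hx).trans (mul_le_mul_of_nonneg_left (le_abs_self _) hc))) _
  refine h1.trans ?_
  rw [ENNReal.ofReal_mul hc]
  refine mul_le_mul' le_rfl ?_
  rw [eLpNorm_eq_lintegral_rpow_enorm_toReal (by simpa using hn) (by simp),
    ← ENNReal.ofReal_rpow_of_nonneg (le_max_right _ _) (by positivity), ENNReal.toReal_natCast]
  refine ENNReal.rpow_le_rpow (le_trans ?_ (h.trans (ENNReal.ofReal_le_ofReal (le_max_left _ _))))
    (by positivity)
  refine setLIntegral_mono' hK fun x hx => ?_
  rw [Real.enorm_eq_ofReal (hw x hx), ENNReal.ofReal_rpow_of_nonneg (hw x hx) (by positivity),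
    Real.rpow_natCast]

theorem ComparableOn.matBound {K : Set M} {Λ B : ℝ} {h g : BilinField n M} (hn : 0 < n)
    (hc : ComparableOn K Λ h g) (hg : IsW1nMetric g) {x : M} (hx : x ∈ K)
    (hH : MatBound B (gram h (refChart n x) (refChart n x x))) :
    MatBound (max (Λ * B) (n * B * Λ)) (gram g (refChart n x) (refChart n x x)) := by
  refine MatBound.of_comparable hn hH (hg.posDef (refChart_mem_atlas x) (refChart_mem_target x))
    fun v => ?_
  simp only [quadForm, gram_quadratic]
  exact hc _ (by rwa [refChart_symm_apply]) _

/-- The scalar curvature distribution depends continuously on the metric. -/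
theorem exists_uniform_scalarCurvPairing_bound (hn : 3 ≤ n) (h : SmoothMetric n M) {K : Set M}
    (hK : IsCompact K) (Cs Λ A : ℝ) : ∃ ψ : ℝ → ℝ, Tendsto ψ (𝓝[≥] 0) (𝓝 0) ∧
      ∀ g g' : BilinField n M, IsW1nMetric g → IsW1nMetric g' → SobolevBound g Cs →
        ComparableOn K Λ h.inner g → ComparableOn K Λ h.inner g' →
        ∫⁻ x in K, ENNReal.ofReal (nablaAt h.inner g x ^ n) ∂(riemVolume h.inner)
          ≤ ENNReal.ofReal A →
        (∀ x ∉ K, g' x = g x) →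
        ∀ t : ℝ, 0 ≤ t → (∀ x ∈ K, distAt h.inner g g' x ≤ t) →
          ∫⁻ x in K, ENNReal.ofReal (nablaDistAt h.inner g g' x ^ n) ∂(riemVolume h.inner)
            ≤ ENNReal.ofReal (t ^ n) →
          ∀ u : M → ℝ, IsTest (n := n) u →
            |scalarCurvPairing h.inner g' (fun x => u x ^ 2)
                - scalarCurvPairing h.inner g (fun x => u x ^ 2)| ≤ ψ t * energy g u := by
  obtain ⟨B₀, hB₀, hb⟩ := h.isW1nMetric.exists_matBound hK
  have hn0 : 0 < n := by omega
  have hKm := hK.isClosed.measurableSet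
  set B := max B₀ 1
  have hB1 : 1 ≤ B := le_max_right _ _
  have hH : ∀ x ∈ K, MatBound B (gram h.inner (refChart n x) (refChart n x x)) := fun x hx =>
    (hb x hx).mono (le_max_left _ _)
  obtain ⟨C, m, hC, hm, hcore⟩ := exists_scalarCurvPairing_bound hn h hK Cs
    (le_max_right (max (Λ * B) (n * B * Λ)) 0)
  set κ : ℝ := n ^ 3 * B ^ 2 with hκ
  have hκ0 : 0 ≤ κ := by positivity
  set a : ℝ := κ * max A 0 ^ (1 / (n : ℝ))
  have ha : 0 ≤ a := by positivity
  -- The main estimate with `B t` for the components of `g' - g` and `κ t` for those of its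
  -- covariant derivative; `B` and `κ` convert tensor norms into components. The polynomial vanishes
  -- at `t = 0`.
  refine ⟨fun t => C * ((B * t) * (m + a + κ * t) + κ * t) * (m + a + κ * t + 1),
    Tendsto.mono_left ?_ nhdsWithin_le_nhds, ?_⟩
  · exact Continuous.tendsto' (by fun_prop) 0 0 (by simp)
  intro g g' hg hg' hS hc hc' hA hgg t ht hdist hnd u hu
  refine hcore g g' hg hg' hS hgg
    (fun x hx => (hc.matBound hn0 hg hx (hH x hx)).mono (le_max_left _ _))
    (fun x hx => (hc'.matBound hn0 hg' hx (hH x hx)).mono (le_max_left _ _))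
    (B * t) a (κ * t) (by positivity) ha (by positivity) (fun x hx i j => ?_) ?_ ?_ u hu
  · refine (abs_le_norm2 (hH x hx) (fun i j => gram g' (refChart n x) (refChart n x x) i j
      - gram g (refChart n x) (refChart n x x) i j) i j).trans ?_
    exact mul_le_mul_of_nonneg_left (hdist x hx) (by positivity)
  · refine eLpNorm_le_of_lintegral_pow_le hKm hn0.ne' hκ0 (fun x _ => Real.sqrt_nonneg _)
      (fun x hx => ?_) hA
    rw [covSum, abs_of_nonneg (absSum_nonneg _)]
    exact absSum_le_norm3 (hH x hx) hB1 _
  · have := eLpNorm_le_of_lintegral_pow_le (f := covDistSum h.inner g g') hKm hn0.ne' hκ0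
      (fun x _ => Real.sqrt_nonneg _) (fun x hx => ?_) hnd
    · rwa [max_eq_left (by positivity), one_div, Real.pow_rpow_inv_natCast ht hn0.ne'] at this
    · rw [covDistSum, abs_of_nonneg (absSum_nonneg _)]
      exact absSum_le_norm3 (hH x hx) hB1 _

end QuantitativeBound

/-! ### Optimal constants and convergence of `L^p` norms. -/

section Convergence

/-- If a family of bounds holds with some constants, and eventually with any positive constant,
then the optimal constants tend to zero. -/
theorem exists_tendsto_zero_bound {ι : Type*} {F : ℝ → ι → ℝ} {E : ι → ℝ} (hE : ∀ u, 0 ≤ E u)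
    (hb : ∀ δ > 0, ∃ c, 0 ≤ c ∧ ∀ u, F δ u ≤ c * E u)
    (hs : ∀ ε > 0, ∀ᶠ δ in 𝓝[>] (0 : ℝ), ∀ u, F δ u ≤ ε * E u) :
    ∃ Ψ : ℝ → ℝ, Tendsto Ψ (𝓝[>] 0) (𝓝 0) ∧ ∀ δ > 0, ∀ u, F δ u ≤ Ψ δ * E u := by
  set V : ℝ → Set ℝ := fun δ => {c | 0 ≤ c ∧ ∀ u, F δ u ≤ c * E u} with hV
  have hbdd : ∀ δ, BddBelow (V δ) := fun δ => ⟨0, fun c hc => hc.1⟩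
  refine ⟨fun δ => sInf (V δ), ?_, fun δ hδ u => ?_⟩
  · rw [Metric.tendsto_nhds]
    intro ε hε
    filter_upwards [hs (ε / 2) (half_pos hε)] with δ hδ
    have h1 : 0 ≤ sInf (V δ) := Real.sInf_nonneg fun c hc => hc.1
    have h2 : sInf (V δ) ≤ ε / 2 := csInf_le (hbdd δ) ⟨(half_pos hε).le, hδ⟩
    rw [Real.dist_eq, sub_zero, abs_of_nonneg h1]
    linarith
  · obtain ⟨c, hc⟩ := hb δ hδ
    -- If `E u = 0`, any admissible constant shows `F δ u ≤ 0`. Otherwise `F δ u / E u` is a lower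
    -- bound of the admissible constants, so their infimum is admissible too.
    rcases (hE u).eq_or_lt with h0 | h0
    · have := hc.2 u
      rwa [← h0, mul_zero] at this ⊢
    · rw [← div_le_iff₀ h0]
      exact le_csInf ⟨c, hc⟩ fun b hb => (div_le_iff₀ h0).2 (hb.2 u)

variable {α κ : Type*} [MeasurableSpace α] {μ : Measure α} {p : ℝ≥0∞} {l : Filter κ}

theorem tendsto_eLpNorm_add (hp : 1 ≤ p) {f g : κ → α → ℝ}
    (hf : ∀ a, AEStronglyMeasurable (f a) μ) (hg : ∀ a, AEStronglyMeasurable (g a) μ)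
    (h1 : Tendsto (fun a => eLpNorm (f a) p μ) l (𝓝 0))
    (h2 : Tendsto (fun a => eLpNorm (g a) p μ) l (𝓝 0)) :
    Tendsto (fun a => eLpNorm (fun x => f a x + g a x) p μ) l (𝓝 0) :=
  tendsto_of_tendsto_of_tendsto_of_le_of_le tendsto_const_nhds (by simpa using h1.add h2)
    (fun _ => zero_le) fun a => eLpNorm_add_le (hf a) (hg a) hp

theorem tendsto_eLpNorm_sum (hp : 1 ≤ p) {ι : Type*} (s : Finset ι) {f : ι → κ → α → ℝ}
    (hf : ∀ i a, AEStronglyMeasurable (f i a) μ)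
    (h : ∀ i, Tendsto (fun a => eLpNorm (f i a) p μ) l (𝓝 0)) :
    Tendsto (fun a => eLpNorm (fun x => ∑ i ∈ s, f i a x) p μ) l (𝓝 0) := by
  classical
  induction s using Finset.induction_on with
  | empty => simpa using tendsto_const_nhds
  | insert i s hi ih =>
    simp only [Finset.sum_insert hi]
    exact tendsto_eLpNorm_add hp (hf i)
      (fun a => Finset.aestronglyMeasurable_fun_sum _ fun i _ => hf i a) (h i) ih

theorem tendsto_eLpNorm_mul {b : α → ℝ} {B : ℝ} (hb : ∀ᵐ x ∂μ, |b x| ≤ B) {f : κ → α → ℝ}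
    (h : Tendsto (fun a => eLpNorm (f a) p μ) l (𝓝 0)) :
    Tendsto (fun a => eLpNorm (fun x => b x * f a x) p μ) l (𝓝 0) := by
  have h1 : Tendsto (fun a => ENNReal.ofReal B * eLpNorm (f a) p μ) l (𝓝 0) := by
    simpa using ENNReal.Tendsto.const_mul h (Or.inr ENNReal.ofReal_ne_top)
  refine tendsto_of_tendsto_of_tendsto_of_le_of_le tendsto_const_nhds h1
    (fun _ => zero_le) fun a => eLpNorm_le_mul_eLpNorm_of_ae_le_mul ?_ p
  filter_upwards [hb] with x hx
  rw [norm_mul]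
  exact mul_le_mul_of_nonneg_right hx (norm_nonneg _)

end Convergence

/-! ### Convergence of the distributions along converging metrics. -/

section MetricConvergence

theorem tendsto_eLpNorm_absSum {n : ℕ} {α κ : Type*} [MeasurableSpace α] {μ : Measure α}
    {p : ℝ≥0∞} {l : Filter κ} (hp : 1 ≤ p) {T : κ → α → Fin n → Fin n → Fin n → ℝ}
    (hm : ∀ δ k i j, AEStronglyMeasurable (fun y => T δ y k i j) μ)
    (ht : ∀ k i j, Tendsto (fun δ => eLpNorm (fun y => T δ y k i j) p μ) l (𝓝 0)) :
    Tendsto (fun δ => eLpNorm (fun y => absSum (T δ y)) p μ) l (𝓝 0) := by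
  have t5 : ∀ k i j, Tendsto (fun δ => eLpNorm (fun y => |T δ y k i j|) p μ) l (𝓝 0) :=
    fun k i j => (ht k i j).congr fun δ => (eLpNorm_norm (p := p) fun y => T δ y k i j).symm
  have m5 : ∀ k i j δ, AEStronglyMeasurable (fun y => |T δ y k i j|) μ :=
    fun k i j δ => (hm δ k i j).norm
  have m6 : ∀ k i δ, AEStronglyMeasurable (fun y => ∑ j, |T δ y k i j|) μ :=
    fun k i δ => Finset.aestronglyMeasurable_fun_sum _ fun j _ => m5 k i j δ
  have m7 : ∀ k δ, AEStronglyMeasurable (fun y => ∑ i, ∑ j, |T δ y k i j|) μ :=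
    fun k δ => Finset.aestronglyMeasurable_fun_sum _ fun i _ => m6 k i δ
  exact tendsto_eLpNorm_sum hp _ m7 fun k => tendsto_eLpNorm_sum hp _ (m6 k) fun i =>
    tendsto_eLpNorm_sum hp _ (m5 k i) (t5 k i)

variable {n : ℕ} {M : Type*} [TopologicalSpace M] [ChartedSpace (Rn n) M]
  [IsManifold (𝓡 n) ∞ M] {g : BilinField n M} {gδ : ℝ → BilinField n M}

/-- Convergence in `W^{1,n}` of the metrics is convergence in `L^n` of the covariant derivatives. -/
theorem TendstoW1pLoc.tendsto_covDeriv (hw : TendstoW1pLoc n gδ g) (hn : 1 ≤ n)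
    (h : SmoothMetric n M) (hg : IsW1nMetric g) (hgδ : ∀ δ, IsW1nMetric (gδ δ))
    {e : OpenPartialHomeomorph M (Rn n)} (he : e ∈ atlas (Rn n) M) {C : Set (Rn n)}
    (hCe : C ⊆ e.target) (hC : IsCompact C) :
    Tendsto (fun δ => eLpNorm (fun y => absSum (covDeriv h.inner (gδ δ) e y
      - covDeriv h.inner g e y)) n (volume.restrict C)) (𝓝[>] 0) (𝓝 0) := by
  have hp : (1 : ℝ≥0∞) ≤ n := by exact_mod_cast hn
  have hCm := hC.isClosed.measurableSet
  have hw' := hw e (mem_maximalAtlas_of_mem_atlas he)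
  have m1 : ∀ δ i j, AEStronglyMeasurable (fun y => gram (gδ δ) e y i j - gram g e y i j)
      (volume.restrict C) := fun δ i j =>
    (((hgδ δ).continuousOn e he i j).sub (hg.continuousOn e he i j)).mono hCe
      |>.aestronglyMeasurable hCm
  have mΓ : ∀ l k i, AEStronglyMeasurable (christoffel h.inner e l k i) (volume.restrict C) :=
    fun l k i => ((h.contDiffOn_christoffel he l k i).continuousOn.mono hCe).aestronglyMeasurable hCm
  have tΓ : ∀ l k i a b, Tendsto (fun δ => eLpNorm (fun y => christoffel h.inner e l k i y
      * (gram (gδ δ) e y a b - gram g e y a b)) n (volume.restrict C)) (𝓝[>] 0) (𝓝 0) := by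
    intro l k i a b
    obtain ⟨B, hB⟩ := hC.exists_bound_of_continuousOn
      ((h.contDiffOn_christoffel he l k i).continuousOn.mono hCe)
    exact tendsto_eLpNorm_mul (ae_restrict_of_forall_mem hCm hB) (hw' a b C hCe hC).1
  have m2 : ∀ δ k i j, AEStronglyMeasurable (fun y =>
      weakPartial e.target k (fun z => gram (gδ δ) e z i j) y
        - weakPartial e.target k (fun z => gram g e z i j) y) (volume.restrict C) := fun δ k i j =>
    ((hgδ δ).memLp e he k i j C hCe hC).1.sub (hg.memLp e he k i j C hCe hC).1
  have m3 : ∀ δ k i j, AEStronglyMeasurable (fun y =>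
      (covDeriv h.inner (gδ δ) e y - covDeriv h.inner g e y) k i j) (volume.restrict C) :=
    fun δ k i j => ((hgδ δ).memLp_covDeriv h he k i j hCe hC).1.sub
      (hg.memLp_covDeriv h he k i j hCe hC).1
  have t3 : ∀ k i j, Tendsto (fun δ => eLpNorm (fun y =>
      (covDeriv h.inner (gδ δ) e y - covDeriv h.inner g e y) k i j) n (volume.restrict C))
      (𝓝[>] 0) (𝓝 0) := by
    intro k i j
    -- The difference of the covariant derivatives is the difference of the weak derivatives minus
    -- continuous Christoffel symbols times differences of components; each term tends to zero in
    -- `Lⁿ` on the compact set.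
    have t4 := tendsto_eLpNorm_add hp (fun δ => m2 δ k i j)
      (fun δ => AEStronglyMeasurable.const_mul (Finset.aestronglyMeasurable_fun_sum Finset.univ
        fun l _ => ((mΓ l k i).mul (m1 δ l j)).add ((mΓ l k j).mul (m1 δ i l))) (-1))
      ((hw' i j C hCe hC).2 k)
      (tendsto_eLpNorm_mul (b := fun _ => -1) (B := 1) (by simp)
        (tendsto_eLpNorm_sum hp Finset.univ
          (fun l δ => ((mΓ l k i).mul (m1 δ l j)).add ((mΓ l k j).mul (m1 δ i l)))
          fun l => tendsto_eLpNorm_add hp (fun δ => (mΓ l k i).mul (m1 δ l j))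
            (fun δ => (mΓ l k j).mul (m1 δ i l)) (tΓ l k i l j) (tΓ l k j i l)))
    refine t4.congr fun δ => ?_
    congr 1
    ext y
    simp only [Pi.sub_apply, Pi.add_apply, Pi.mul_apply, covDeriv, mul_sub, Finset.sum_add_distrib,
      Finset.sum_sub_distrib]
    ring
  exact tendsto_eLpNorm_absSum hp m3 t3

variable [T2Space M] [SecondCountableTopology M] [MeasurableSpace M] [BorelSpace M]

theorem TendstoW1pLoc.tendsto_covDistSum (hw : TendstoW1pLoc n gδ g) (hn : 1 ≤ n)
    (h : SmoothMetric n M) (hg : IsW1nMetric g) (hgδ : ∀ δ, IsW1nMetric (gδ δ)) {K : Set M}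
    (hK : IsCompact K) : Tendsto (fun δ => eLpNorm (covDistSum h.inner g (gδ δ)) n
      ((riemVolume h.inner).restrict K)) (𝓝[>] 0) (𝓝 0) := by
  have hp : (1 : ℝ≥0∞) ≤ n := by exact_mod_cast hn
  obtain ⟨c, P, hc, hle⟩ := h.isW1nMetric.exists_eLpNorm_le hK hp (ENNReal.natCast_ne_top n)
  have hsum : Tendsto (fun δ => c * ∑ q ∈ P, eLpNorm (fun y =>
      absSum (covDeriv h.inner (gδ δ) (chartAt (Rn n) (q : M)) y
        - covDeriv h.inner g (chartAt (Rn n) (q : M)) y)) n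
      (volume.restrict (chartPiece n (q : M)))) (𝓝[>] 0) (𝓝 0) := by
    have := tendsto_finsetSum P fun q _ => hw.tendsto_covDeriv hn h hg hgδ
      (chart_mem_atlas (Rn n) (q : M)) (chartPiece_subset _) (isCompact_chartPiece _)
    simpa using ENNReal.Tendsto.const_mul this (Or.inr hc)
  exact tendsto_of_tendsto_of_tendsto_of_le_of_le tendsto_const_nhds hsum (fun _ => zero_le)
    fun δ => hle fun e y => absSum (covDeriv h.inner (gδ δ) e y - covDeriv h.inner g e y)

theorem TendstoC0Loc.eventually_close (hw : TendstoC0Loc gδ g) {K : Set M} (hK : IsCompact K)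
    {ε : ℝ} (hε : 0 < ε) : ∀ᶠ δ in 𝓝[>] 0, ∀ x ∈ K, ∀ i j,
      |gram (gδ δ) (refChart n x) (refChart n x x) i j
        - gram g (refChart n x) (refChart n x x) i j| ≤ ε := by
  obtain ⟨P, hP⟩ := exists_finset_chartCentre (n := n) hK
  have h1 : ∀ᶠ δ in 𝓝[>] 0, ∀ q ∈ P, ∀ i j, ∀ y ∈ chartPiece n (q : M),
      |gram (gδ δ) (chartAt (Rn n) (q : M)) y i j - gram g (chartAt (Rn n) (q : M)) y i j|
        ≤ ε := by
    rw [Filter.eventually_all_finset]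
    intro q _
    rw [eventually_all]
    intro i
    rw [eventually_all]
    intro j
    have := hw _ (mem_maximalAtlas_of_mem_atlas (chart_mem_atlas (Rn n) (q : M))) i j
      (chartPiece n (q : M)) (chartPiece_subset _) (isCompact_chartPiece _)
    filter_upwards [Metric.tendstoUniformlyOn_iff.1 this ε hε] with δ hδ y hy
    rw [abs_sub_comm]
    exact (hδ y hy).le
  filter_upwards [h1] with δ hδ x hx i j
  exact hδ _ (hP x hx) i j _ (mem_chartPiece rfl)

/-- Convergence of the scalar curvature distributions along converging metrics. -/
theorem exists_tendsto_scalarCurvPairing_bound (hn : 3 ≤ n) (h : SmoothMetric n M) {K : Set M}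
    (hK : IsCompact K) {Cs : ℝ} (hg : IsW1nMetric g) (hgδ : ∀ δ, IsW1nMetric (gδ δ))
    (hS : SobolevBound g Cs) (h0 : TendstoC0Loc gδ g) (h1 : TendstoW1pLoc n gδ g)
    (hgg : ∀ δ > 0, ∀ x ∉ K, gδ δ x = g x) :
    ∃ Ψ : ℝ → ℝ, Tendsto Ψ (𝓝[>] 0) (𝓝 0) ∧ ∀ δ > 0, ∀ u : M → ℝ, IsTest (n := n) u →
      |scalarCurvPairing h.inner (gδ δ) (fun x => u x ^ 2)
        - scalarCurvPairing h.inner g (fun x => u x ^ 2)| ≤ Ψ δ * energy g u := by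
  have hfinite : ∀ {f : M → ℝ}, MemLp f n ((riemVolume h.inner).restrict K) →
      eLpNorm f n ((riemVolume h.inner).restrict K)
        ≤ ENNReal.ofReal (eLpNorm f n ((riemVolume h.inner).restrict K)).toReal := fun hf =>
    (ENNReal.ofReal_toReal hf.2.ne).ge
  have hT := hfinite (hg.memLp_absSum_covDeriv h (by omega) hK)
  set a := (eLpNorm (covSum h.inner g) n ((riemVolume h.inner).restrict K)).toReal
  have ha : 0 ≤ a := ENNReal.toReal_nonneg
  obtain ⟨B, hB, hGB⟩ := hg.exists_matBound hK
  have main := exists_tendsto_zero_bound (ι := {u : M → ℝ // IsTest (n := n) u})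
    (F := fun δ u => |scalarCurvPairing h.inner (gδ δ) (fun x => u.1 x ^ 2)
        - scalarCurvPairing h.inner g (fun x => u.1 x ^ 2)|)
    (E := fun u => energy g u.1) (fun u => hg.energy_nonneg u.1) ?_ ?_
  · obtain ⟨Ψ, hΨ, hb⟩ := main
    exact ⟨Ψ, hΨ, fun δ hδ u hu => hb δ hδ ⟨u, hu⟩⟩
  · intro δ hδ
    -- For a fixed `δ` only a finite constant is needed, so the bounds may depend on `δ` and the
    -- crude distance `B + B'` is enough.
    obtain ⟨B', hB', hGB'⟩ := (hgδ δ).exists_matBound hK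
    obtain ⟨C, m, hC, hm, hcore⟩ := exists_scalarCurvPairing_bound hn h hK Cs (add_nonneg hB hB')
    have hD := hfinite (hg.memLp_absSum_covDeriv_sub h (hgδ δ) (by omega) hK)
    set d := (eLpNorm (covDistSum h.inner g (gδ δ)) n ((riemVolume h.inner).restrict K)).toReal
    have hd : 0 ≤ d := ENNReal.toReal_nonneg
    refine ⟨_, ?_, fun u => hcore g (gδ δ) hg (hgδ δ) hS (hgg δ hδ)
      (fun x hx => (hGB x hx).mono (by linarith)) (fun x hx => (hGB' x hx).mono (by linarith))
      (B + B') a d (by positivity) ha hd (fun x hx i j => ?_) hT hD u.1 u.2⟩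
    · positivity
    · refine (abs_sub _ _).trans ?_
      rw [add_comm B]
      exact add_le_add ((hGB' x hx).entry i j) ((hGB x hx).entry i j)
  · intro ε hε
    -- The matrix bound is the one that all `g_δ` close to `g` satisfy by `MatBound.of_close` with
    -- `s ≤ 1`. It is fixed before `s`, so that `C` and `m` do not depend on the smallness chosen
    -- next.
    obtain ⟨C, m, hC, hm, hcore⟩ := exists_scalarCurvPairing_bound hn h hK Cs
      (B := max (B + 1) (2 * n * B)) (by positivity)
    have hlim : Tendsto (fun s : ℝ => C * (s * (m + a + s) + s) * (m + a + s + 1)) (𝓝[>] 0)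
        (𝓝 0) :=
      Tendsto.mono_left (Continuous.tendsto' (by fun_prop) 0 0 (by simp)) nhdsWithin_le_nhds
    have hlim2 : Tendsto (fun s : ℝ => n * B * (s * n)) (𝓝[>] 0) (𝓝 0) :=
      Tendsto.mono_left (Continuous.tendsto' (by fun_prop) 0 0 (by simp)) nhdsWithin_le_nhds
    -- A single `s` bounds both the `C⁰` and the `Lⁿ` distance: small enough for the main estimate
    -- to give `ε`, for the matrices `g_δ` to remain coercive, and for `s ≤ 1`.
    obtain ⟨s, ⟨⟨hs1, hs2⟩, hs3⟩, hs0⟩ := (((hlim.eventually (ge_mem_nhds hε)).and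
      (hlim2.eventually (ge_mem_nhds (by norm_num : (0 : ℝ) < 1 / 2)))).and
      (nhdsWithin_le_nhds (ge_mem_nhds zero_lt_one))).and self_mem_nhdsWithin |>.exists
    have hs0' : 0 < s := hs0
    filter_upwards [h0.eventually_close hK hs0', (h1.tendsto_covDistSum (by omega) h hg hgδ
      hK).eventually (ge_mem_nhds (ENNReal.ofReal_pos.2 hs0')), self_mem_nhdsWithin]
      with δ hd1 hd2 hδ u
    refine (hcore g (gδ δ) hg (hgδ δ) hS (hgg δ hδ)
      (fun x hx => (hGB x hx).mono (le_max_of_le_left (by linarith)))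
      (fun x hx => (MatBound.of_close hB (hGB x hx)
        ((hgδ δ).posDef (refChart_mem_atlas x) (refChart_mem_target x)) hs2 (hd1 x hx)).mono
          (max_le_max (by linarith [show s ≤ 1 from hs3]) le_rfl))
      s a s hs0'.le ha hs0'.le hd1 hT hd2 u.1 u.2).trans ?_
    exact mul_le_mul_of_nonneg_right hs1 (hg.energy_nonneg u.1)

end MetricConvergence

/-- The `Lⁿ` hypotheses of the second part are stated with lower Lebesgue integrals, so that
finiteness is part of the assumption and a nonintegrable function is not assigned the integral zero.
-/
theorem mainTheorem7 (n : ℕ) (hn : 3 ≤ n) (M : Type*) [TopologicalSpace M]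
    [ChartedSpace (Rn n) M] [IsManifold (𝓡 n) ∞ M] [T2Space M] [SecondCountableTopology M]
    [MeasurableSpace M] [BorelSpace M]
    (h : SmoothMetric n M) (K : Set M) (hK : IsCompact K) (Cs : ℝ) :
    (∀ (g : C0Metric n M) (gδ : ℝ → SmoothMetric n M),
      MemW1pLoc n g.inner → SobolevBound g.inner Cs →
      TendstoC0Loc (fun δ => (gδ δ).inner) g.inner →
      TendstoW1pLoc n (fun δ => (gδ δ).inner) g.inner →
      (∀ δ > 0, ∀ x ∉ K, (gδ δ).inner x = g.inner x) →
      ∃ Ψ : ℝ → ℝ, Tendsto Ψ (𝓝[>] 0) (𝓝 0) ∧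
        ∀ δ > 0, ∀ u : M → ℝ, IsTest (n := n) u →
          |scalarCurvPairing h.inner (gδ δ).inner (fun x => u x ^ 2)
              - scalarCurvPairing h.inner g.inner (fun x => u x ^ 2)|
            ≤ Ψ δ * energy g.inner u) ∧
    (∀ Λ A : ℝ, ∃ ψ : ℝ → ℝ, Tendsto ψ (𝓝[≥] 0) (𝓝 0) ∧
      ∀ (g : C0Metric n M) (g' : SmoothMetric n M),
        MemW1pLoc n g.inner → SobolevBound g.inner Cs →
        ComparableOn K Λ h.inner g.inner → ComparableOn K Λ h.inner g'.inner →
        ∫⁻ x in K, ENNReal.ofReal (nablaAt h.inner g.inner x ^ n) ∂(riemVolume h.inner)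
          ≤ ENNReal.ofReal A →
        (∀ x ∉ K, g'.inner x = g.inner x) →
        ∀ t : ℝ, 0 ≤ t → (∀ x ∈ K, distAt h.inner g.inner g'.inner x ≤ t) →
          ∫⁻ x in K, ENNReal.ofReal (nablaDistAt h.inner g.inner g'.inner x ^ n)
            ∂(riemVolume h.inner) ≤ ENNReal.ofReal (t ^ n) →
          ∀ u : M → ℝ, IsTest (n := n) u →
            |scalarCurvPairing h.inner g'.inner (fun x => u x ^ 2)
                - scalarCurvPairing h.inner g.inner (fun x => u x ^ 2)|
              ≤ ψ t * energy g.inner u) := by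
  refine ⟨fun g gδ hW hS h0 h1 hgg => ?_, fun Λ A => ?_⟩
  · exact exists_tendsto_scalarCurvPairing_bound hn h hK (g.isW1nMetric hW)
      (fun δ => (gδ δ).isW1nMetric) hS h0 h1 hgg
  · obtain ⟨ψ, hψ, hb⟩ := exists_uniform_scalarCurvPairing_bound hn h hK Cs Λ A
    exact ⟨ψ, hψ, fun g g' hW hS hc hc' hA hgg t ht hd hnd u hu =>
      hb g.inner g'.inner (g.isW1nMetric hW) g'.isW1nMetric hS hc hc' hA hgg t ht hd hnd u hu⟩
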